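/- Let $g\ge 1$ and $k\ge 1$ be integers. Let $S_g$ be the closed connected oriented surface of genus $g$, and let $\mathrm{Mod}(S_g)$ be its mapping class group, that is, the group of orientation-preserving homeomorphisms of $S_g$ modulo isotopy. Let $a_1,b_1,\dots,a_g,b_g$ and $c_1,\dots,c_{g-1}$ be the standard simple closed curves on $S_g$: each of the pairs $(a_i,b_i)$, $(c_i,b_i)$, $(c_i,b_{i+1})$ meets transversally in exactly one point, all other pairs of these curves are disjoint, and $c_i$ is placed between the $i$-th and the $(i+1)$-st handle; with suitable orientations $c_i$ is homologous to $a_i-a_{i+1}$. Write $T_c$ for the left-handed Dehn twist about $c$. The homology classes of $a_1,b_1,\dots,a_g,b_g$ form a symplectic basis of $H_1(S_g;\mathbb Z)$, and the action of $\mathrm{Mod}(S_g)$ on $H_1(S_g;\mathbb Z)$, written in this basis, is a homomorphism $\Psi:\mathrm{Mod}(S_g)\to \mathrm{Sp}(2g,\mathbb Z)$. Let $\mathrm{Mod}_{p_k}(S_g,e_1)$ be the stabilizer in $\mathrm{Mod}(S_g)$ of the class $e_1$ of $a_1$ in $H_1(S_g;\mathbb Z/k)$. Let $$\Gamma_1(k)=\left\{\begin{bmatrix}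 a&b\\c&d\end{bmatrix}\in \mathrm{SL}(2,\mathbb Z): a\equiv d\equiv 1,\ c\equiv 0 \pmod k\right\},$$ and let $\eta_g:\mathrm{SL}(2,\mathbb Z)\to \mathrm{Sp}(2g,\mathbb Z)$ be the homomorphism $$\eta_g(A)=\begin{bmatrix} A & 0\\ 0& I_{2g-2}\end{bmatrix}$$ with respect to the ordered basis $a_1,b_1,\dots,a_g,b_g$. Then the subgroup $\Psi(\mathrm{Mod}_{p_k}(S_g,e_1))$ of $\mathrm{Sp}(2g,\mathbb Z)$ is generated by $$\eta_g(\Gamma_1(k))\ \cup\ \Psi\big(\{T_{a_2},T_{b_2},\dots,T_{a_g},T_{b_g},T_{c_1},\dots,T_{c_{g-1}}\}\big).$$ -/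

import Mathlib

open CategoryTheory

noncomputable section

/-! ### Singular homology -/

/-- `H_n(X; R)`: singular homology of `X` with coefficients in (the abelian group) `R`. -/
abbrev SHom (n : ℕ) (R : Type) [CommRing R] (X : Type) [TopologicalSpace X] : ModuleCat.{0} ℤ :=
  ((AlgebraicTopology.singularHomologyFunctor (ModuleCat.{0} ℤ) n).obj (ModuleCat.of ℤ R)).obj
    (TopCat.of X)

/-- The singular chain complex of `X` with coefficients in `R`. -/
abbrev SChain (R : Type) [CommRing R] (X : Type) [TopologicalSpace X] :
    ChainComplex (ModuleCat.{0} ℤ) ℕ :=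
  ((AlgebraicTopology.singularChainComplexFunctor (ModuleCat.{0} ℤ)).obj (ModuleCat.of ℤ R)).obj
    (TopCat.of X)

/-- The map `R → C_n(X; R)`, `r ↦ r • σ`, for a singular simplex `σ`. -/
def simplexChain {n : ℕ} (R : Type) [CommRing R] {X : Type} [TopologicalSpace X]
    (σ : C(stdSimplex ℝ (Fin (n + 1)), X)) : ModuleCat.of ℤ R ⟶ (SChain R X).X n :=
  (TopCat.toSSet.obj (TopCat.of X)).ιChainComplex
    ((TopCat.toSSetObjEquiv (TopCat.of X) (Opposite.op (SimplexCategory.mk n))).symm σ)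

/-- The `i`-th face of a singular simplex. -/
def simplexFace {n : ℕ} {X : Type} [TopologicalSpace X]
    (σ : C(stdSimplex ℝ (Fin (n + 2)), X)) (i : Fin (n + 2)) : C(stdSimplex ℝ (Fin (n + 1)), X) :=
  σ.comp ⟨stdSimplex.map i.succAbove, stdSimplex.continuous_map _⟩

theorem simplexChain_d {n : ℕ} (R : Type) [CommRing R] {X : Type} [TopologicalSpace X]
    (σ : C(stdSimplex ℝ (Fin (n + 2)), X)) :
    simplexChain R σ ≫ (SChain R X).d (n + 1) n =
      ∑ i : Fin (n + 2), (-1 : ℤ) ^ i.val • simplexChain R (simplexFace σ i) := by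
  have h := SSet.ιChainComplex_d (TopCat.toSSet.obj (TopCat.of X)) (ModuleCat.of ℤ R)
    ((TopCat.toSSetObjEquiv (TopCat.of X) (Opposite.op (SimplexCategory.mk (n + 1)))).symm σ)
  exact h

/-- The action of the homeomorphisms of `X` on `H_n(X; R)`, `f ↦ f_*`. -/
def homeoAct (n : ℕ) (R : Type) [CommRing R] (X : Type) [TopologicalSpace X] :
    (X ≃ₜ X) →* Module.End ℤ (SHom n R X) where
  toFun f := (((AlgebraicTopology.singularHomologyFunctor (ModuleCat.{0} ℤ) n).obj
    (ModuleCat.of ℤ R)).map (TopCat.ofHom (f : C(X, X)))).hom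
  map_one' := by
    have : TopCat.ofHom ((1 : X ≃ₜ X) : C(X, X)) = 𝟙 (TopCat.of X) := rfl
    rw [this, CategoryTheory.Functor.map_id]
    rfl
  map_mul' f g := by
    have : TopCat.ofHom ((f * g : X ≃ₜ X) : C(X, X)) =
      TopCat.ofHom (g : C(X, X)) ≫ TopCat.ofHom (f : C(X, X)) := rfl
    rw [this, CategoryTheory.Functor.map_comp]
    rfl

/-- The homology class of a singular cycle. -/
def cycleClass {n : ℕ} {R : Type} [CommRing R] {X : Type} [TopologicalSpace X]
    (c : ModuleCat.of ℤ R ⟶ (SChain R X).X (n + 1))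
    (hc : c ≫ (SChain R X).d (n + 1) n = 0) : SHom (n + 1) R X :=
  ((SChain R X).liftCycles c n (ChainComplex.next_nat_succ n) hc ≫
    (SChain R X).homologyπ (n + 1)).hom (1 : R)

/-- A path in `X`, as a singular `1`-simplex. -/
def pathSimplex {X : Type} [TopologicalSpace X] (γ : C(unitInterval, X)) :
    C(stdSimplex ℝ (Fin 2), X) :=
  γ.comp (stdSimplexHomeomorphUnitInterval : C(stdSimplex ℝ (Fin 2), unitInterval))

theorem pathSimplex_face {X : Type} [TopologicalSpace X] (γ : C(unitInterval, X)) :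
    simplexFace (pathSimplex γ) 0 = ContinuousMap.const _ (γ 1) ∧
    simplexFace (pathSimplex γ) 1 = ContinuousMap.const _ (γ 0) := by
  constructor
  · ext p
    have hp : p = stdSimplex.vertex 0 := Subsingleton.elim _ _
    subst hp
    change γ (stdSimplexHomeomorphUnitInterval
      (stdSimplex.map (Fin.succAbove 0) (stdSimplex.vertex 0))) = γ 1
    rw [stdSimplex.map_vertex]
    exact congrArg γ stdSimplexHomeomorphUnitInterval_one
  · ext p
    have hp : p = stdSimplex.vertex 0 := Subsingleton.elim _ _
    subst hp
    change γ (stdSimplexHomeomorphUnitInterval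
      (stdSimplex.map (Fin.succAbove 1) (stdSimplex.vertex 0))) = γ 0
    rw [stdSimplex.map_vertex]
    exact congrArg γ stdSimplexHomeomorphUnitInterval_zero

theorem loop_cycle (R : Type) [CommRing R] {X : Type} [TopologicalSpace X]
    (γ : C(unitInterval, X)) (h : γ 0 = γ 1) :
    simplexChain R (pathSimplex γ) ≫ (SChain R X).d 1 0 = 0 := by
  rw [simplexChain_d, Fin.sum_univ_two, (pathSimplex_face γ).1, (pathSimplex_face γ).2, h]
  simp

/-- The class in `H_1(X; R)` of a closed path. -/
def loopClass (R : Type) [CommRing R] {X : Type} [TopologicalSpace X]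
    (γ : C(unitInterval, X)) (h : γ 0 = γ 1) : SHom 1 R X :=
  cycleClass (simplexChain R (pathSimplex γ)) (loop_cycle R γ h)

/-! ### Mapping class groups -/

/-- The homeomorphisms of `X` that preserve a given class `μ ∈ H_n(X; ℤ)`. If `X` is a closed
connected `n`-manifold oriented by its fundamental class `μ`, these are the orientation preserving
homeomorphisms of `X`. -/
def homeoPlus {n : ℕ} {X : Type} [TopologicalSpace X] (μ : SHom n ℤ X) : Subgroup (X ≃ₜ X) where
  carrier := {f | homeoAct n ℤ X f μ = μ}
  one_mem' := by simp
  mul_mem' {f g} hf hg := by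
    simp only [Set.mem_ofPred_eq, map_mul, Module.End.mul_apply] at *
    rw [hg, hf]
  inv_mem' {f} hf := by
    simp only [Set.mem_ofPred_eq] at *
    have h : homeoAct n ℤ X (f⁻¹ * f) μ = μ := by simp
    rw [map_mul, Module.End.mul_apply, hf] at h
    exact h

/-- `f` is isotopic to the identity: there is a continuous family `H_t`, `0 ≤ t ≤ 1`, of
homeomorphisms of `X` with `H_0 = id` and `H_1 = f`. -/
def IsotopicToId {X : Type} [TopologicalSpace X] (f : X ≃ₜ X) : Prop :=
  ∃ H : unitInterval → (X ≃ₜ X),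
    Continuous (fun p : unitInterval × X => H p.1 p.2) ∧ H 0 = 1 ∧ H 1 = f

/-- The orientation preserving homeomorphisms that are isotopic to the identity. -/
def isotopySubgroup {n : ℕ} {X : Type} [TopologicalSpace X] (μ : SHom n ℤ X) :
    Subgroup (homeoPlus μ) where
  carrier := {f | IsotopicToId f.1}
  one_mem' := ⟨fun _ => 1, continuous_snd, rfl, rfl⟩
  mul_mem' := by
    rintro f g ⟨H, hH, h0, h1⟩ ⟨K, hK, k0, k1⟩
    refine ⟨fun t => H t * K t, ?_, by simp [h0, k0], by simp [h1, k1]⟩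
    exact hH.comp (continuous_fst.prodMk hK)
  inv_mem' := by
    rintro f ⟨H, hH, h0, h1⟩
    refine ⟨fun t => H (unitInterval.symm t) * f.1⁻¹, ?_, by simp [h1], by simp [h0]⟩
    exact hH.comp ((unitInterval.continuous_symm.comp continuous_fst).prodMk
      ((f.1⁻¹).continuous.comp continuous_snd))

instance isotopySubgroup_normal {n : ℕ} {X : Type} [TopologicalSpace X] (μ : SHom n ℤ X) :
    (isotopySubgroup μ).Normal where
  conj_mem := by
    rintro f ⟨H, hH, h0, h1⟩ g
    refine ⟨fun t => g.1 * H t * g.1⁻¹, ?_, by simp [h0], by simp [h1]⟩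
    exact g.1.continuous.comp (hH.comp (continuous_fst.prodMk
      ((g.1⁻¹).continuous.comp continuous_snd)))

/-- The mapping class group: orientation preserving homeomorphisms of `X` up to isotopy. -/
abbrev MCG {n : ℕ} {X : Type} [TopologicalSpace X] (μ : SHom n ℤ X) : Type :=
  homeoPlus μ ⧸ isotopySubgroup μ

theorem homeoAct_eq_one {X : Type} [TopologicalSpace X] (f : X ≃ₜ X) (hf : IsotopicToId f)
    (m : ℕ) (R : Type) [CommRing R] : homeoAct m R X f = 1 := by
  obtain ⟨H, hH, h0, h1⟩ := hf
  have K : TopCat.Homotopy (𝟙 (TopCat.of X)) (TopCat.ofHom (f : C(X, X))) :=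
    { toFun := fun p => H p.1 p.2
      continuous_toFun := hH
      map_zero_left := fun x => by rw [h0]; rfl
      map_one_left := fun x => by rw [h1]; rfl }
  have := K.congr_homologyMap_singularChainComplexFunctor (ModuleCat.of ℤ R) m
  have h2 : homeoAct m R X f = homeoAct m R X 1 :=
    congrArg ModuleCat.Hom.hom this.symm
  rw [h2, map_one]

/-- The action of the mapping class group on `H_m(X; R)`. -/
def mcgAct {n : ℕ} {X : Type} [TopologicalSpace X] (μ : SHom n ℤ X) (m : ℕ) (R : Type)
    [CommRing R] : MCG μ →* Module.End ℤ (SHom m R X) :=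
  QuotientGroup.lift (isotopySubgroup μ) ((homeoAct m R X).comp (homeoPlus μ).subtype)
    (fun f hf => homeoAct_eq_one f.1 hf m R)

/-- The stabilizer in the mapping class group of a class in `H_m(X; R)`. -/
def mcgStab {n : ℕ} {X : Type} [TopologicalSpace X] (μ : SHom n ℤ X) {m : ℕ} {R : Type}
    [CommRing R] (v : SHom m R X) : Subgroup (MCG μ) where
  carrier := {f | mcgAct μ m R f v = v}
  one_mem' := by simp
  mul_mem' {f g} hf hg := by
    simp only [Set.mem_ofPred_eq, map_mul, Module.End.mul_apply] at *
    rw [hg, hf]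
  inv_mem' {f} hf := by
    simp only [Set.mem_ofPred_eq] at *
    have h : mcgAct μ m R (f⁻¹ * f) v = v := by simp
    rw [map_mul, Module.End.mul_apply, hf] at h
    exact h

/-! ### The surface `S_g` -/

/-- Labels of the squares that make up `S_g`. In row `i`, the three squares are the crossings of
the curve `b_i` (running horizontally through the row) with vertical curves: `(i, 1)` lies on `a_i`,
`(i, 2)` on `c_i` (the curve between the handles `i` and `i + 1`), and `(i, 0)` on `c_{i-1}`. -/
abbrev Sq (g : ℕ) : Type := Fin g × Fin 3

/-- The right neighbour of a square. The rows are cyclic; they are traversed in opposite directions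
for even and odd `i`. -/
def rightPerm (g : ℕ) : Equiv.Perm (Sq g) :=
  Equiv.prodShear (Equiv.refl _)
    (fun i => if Even i.val then Equiv.addRight 1 else Equiv.subRight 1)

/-- The upper neighbour of a square, as a function: `(i, 2)` and `(i + 1, 0)` are exchanged, and all
the other squares are their own upper neighbours. -/
def upFun (g : ℕ) (s : Sq g) : Sq g :=
  if s.2 = 2 then
    if h : s.1.val + 1 < g then (⟨s.1.val + 1, h⟩, 0) else s
  else if s.2 = 0 then
    if 0 < s.1.val then (⟨s.1.val - 1, by omega⟩, 2) else s
  else s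

theorem upFun_involutive (g : ℕ) : Function.Involutive (upFun g) := by
  rintro ⟨⟨i, hi⟩, j⟩
  fin_cases j
  · rcases Nat.eq_zero_or_pos i with rfl | h
    · simp [upFun]
    · have h2 : i - 1 + 1 = i := by omega
      simp [upFun, h, h2, hi]
  · simp [upFun]
  · by_cases h : i + 1 < g <;> simp [upFun, h]

/-- The upper neighbour of a square. -/
def upPerm (g : ℕ) : Equiv.Perm (Sq g) := (upFun_involutive g).toPerm

/-- The gluing: the right side of a square is glued to the left side of its right neighbour, the
upper side to the lower side of its upper neighbour, by translations. -/
inductive Glue (g : ℕ) :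
    Sq g × unitInterval × unitInterval → Sq g × unitInterval × unitInterval → Prop
  | side (s : Sq g) (y : unitInterval) : Glue g (s, 1, y) (rightPerm g s, 0, y)
  | top (s : Sq g) (x : unitInterval) : Glue g (s, x, 1) (upPerm g s, x, 0)

/-- The closed oriented surface `S_g` of genus `g ≥ 1`, as a union of `3g` unit squares
glued along their sides. It has `3g` faces, `6g` edges and `g + 2` vertices, hence Euler
characteristic `2 - 2g`; it is connected, and oriented by the plane since all gluings are
translations. -/
def Surf (g : ℕ) : Type := Quot (Glue g)

instance (g : ℕ) : TopologicalSpace (Surf g) := inferInstanceAs (TopologicalSpace (Quot (Glue g)))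

/-- The point with coordinates `(x, y)` of the square `s`. -/
def Surf.mk {g : ℕ} (s : Sq g) (x y : unitInterval) : Surf g := Quot.mk _ (s, x, y)

theorem Surf.continuous_mk {g : ℕ} :
    Continuous (fun p : Sq g × unitInterval × unitInterval => Surf.mk p.1 p.2.1 p.2.2) :=
  continuous_quot_mk

theorem Surf.mk_side {g : ℕ} (s : Sq g) (y : unitInterval) :
    Surf.mk s 1 y = Surf.mk (rightPerm g s) 0 y := Quot.sound (Glue.side s y)

theorem Surf.mk_top {g : ℕ} (s : Sq g) (x : unitInterval) :
    Surf.mk s x 1 = Surf.mk (upPerm g s) x 0 := Quot.sound (Glue.top s x)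

/-- The square `s` as a map to the surface. -/
def squareMap {g : ℕ} (s : Sq g) : C(unitInterval × unitInterval, Surf g) :=
  ⟨fun p => Surf.mk s p.1 p.2, Surf.continuous_mk.comp (continuous_const.prodMk continuous_id)⟩

/-! ### The fundamental class -/

/-- The affine `2`-simplex with vertices `(0,0), (1,0), (1,1)`. -/
def lowerTri : C(stdSimplex ℝ (Fin 3), unitInterval × unitInterval) where
  toFun p := (⟨p.1 1 + p.1 2, by
      have h := p.2.2
      rw [Fin.sum_univ_three] at h
      have := p.2.1 0
      have := p.2.1 1
      have := p.2.1 2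
      constructor <;> linarith⟩,
    ⟨p.1 2, p.2.1 2, stdSimplex.le_one p 2⟩)
  continuous_toFun := by
    refine Continuous.prodMk (Continuous.subtype_mk ?_ _) (Continuous.subtype_mk ?_ _)
    · exact ((continuous_apply 1).comp continuous_subtype_val).add
        ((continuous_apply 2).comp continuous_subtype_val)
    · exact (continuous_apply 2).comp continuous_subtype_val

/-- The affine `2`-simplex with vertices `(0,0), (0,1), (1,1)`. -/
def upperTri : C(stdSimplex ℝ (Fin 3), unitInterval × unitInterval) :=
  ContinuousMap.prodSwap.comp lowerTri

theorem lowerTri_face :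
    simplexFace lowerTri 0 = pathSimplex ⟨fun t => (1, t), by fun_prop⟩ ∧
    simplexFace lowerTri 1 = pathSimplex ⟨fun t => (t, t), by fun_prop⟩ ∧
    simplexFace lowerTri 2 = pathSimplex ⟨fun t => (t, 0), by fun_prop⟩ := by
  have key : ∀ (i : Fin 3) (q : stdSimplex ℝ (Fin 2)) (j : Fin 3),
      (stdSimplex.map i.succAbove q).1 j = (if i.succAbove 0 = j then q.1 0 else 0) +
        (if i.succAbove 1 = j then q.1 1 else 0) := by
    intro i q j
    refine (FunOnFinite.linearMap_apply_apply ..).trans ?_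
    rw [Finset.sum_filter, Fin.sum_univ_two]
    rfl
  have hs : ∀ q : stdSimplex ℝ (Fin 2), q.1 0 + q.1 1 = 1 := fun q => stdSimplex.add_eq_one q
  refine ⟨?_, ?_, ?_⟩
  · refine ContinuousMap.ext fun q => Prod.ext (Subtype.ext ?_) (Subtype.ext ?_)
    · change (stdSimplex.map _ q).1 1 + (stdSimplex.map _ q).1 2 = 1
      rw [key, key, ← hs q]
      simp [Fin.succAbove]
    · change (stdSimplex.map _ q).1 2 = q.1 1
      rw [key]
      simp [Fin.succAbove]
  · refine ContinuousMap.ext fun q => Prod.ext (Subtype.ext ?_) (Subtype.ext ?_)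
    · change (stdSimplex.map _ q).1 1 + (stdSimplex.map _ q).1 2 = q.1 1
      rw [key, key]
      simp [Fin.succAbove]
    · change (stdSimplex.map _ q).1 2 = q.1 1
      rw [key]
      simp [Fin.succAbove]
  · refine ContinuousMap.ext fun q => Prod.ext (Subtype.ext ?_) (Subtype.ext ?_)
    · change (stdSimplex.map _ q).1 1 + (stdSimplex.map _ q).1 2 = q.1 1
      rw [key, key]
      simp [Fin.succAbove, Fin.lt_def]
    · change (stdSimplex.map _ q).1 2 = 0
      rw [key]
      simp [Fin.succAbove, Fin.lt_def]

/-- The `2`-chain `∑ (lower triangle of s - upper triangle of s)`, the sum over all squares `s`. -/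
def fundamentalChain (g : ℕ) : ModuleCat.of ℤ ℤ ⟶ (SChain ℤ (Surf g)).X 2 :=
  ∑ s : Sq g, (simplexChain ℤ ((squareMap s).comp lowerTri) -
    simplexChain ℤ ((squareMap s).comp upperTri))

theorem fundamentalChain_d (g : ℕ) : fundamentalChain g ≫ (SChain ℤ (Surf g)).d 2 1 = 0 := by
  obtain ⟨f0, f1, f2⟩ := lowerTri_face
  let right (s : Sq g) := simplexChain ℤ (pathSimplex ((squareMap s).comp ⟨fun t => (1, t), by fun_prop⟩))
  let left (s : Sq g) := simplexChain ℤ (pathSimplex ((squareMap s).comp ⟨fun t => (0, t), by fun_prop⟩))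
  let up (s : Sq g) := simplexChain ℤ (pathSimplex ((squareMap s).comp ⟨fun t => (t, 1), by fun_prop⟩))
  let down (s : Sq g) := simplexChain ℤ (pathSimplex ((squareMap s).comp ⟨fun t => (t, 0), by fun_prop⟩))
  let diag (s : Sq g) := simplexChain ℤ (pathSimplex ((squareMap s).comp ⟨fun t => (t, t), by fun_prop⟩))
  have hl : ∀ s, simplexChain ℤ ((squareMap s).comp lowerTri) ≫ (SChain ℤ (Surf g)).d 2 1 =
      right s - diag s + down s := by
    intro s
    have h0 : simplexFace ((squareMap s).comp lowerTri) 0 =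
      pathSimplex ((squareMap s).comp ⟨fun t => (1, t), by fun_prop⟩) :=
      congrArg (squareMap s).comp f0
    have h1 : simplexFace ((squareMap s).comp lowerTri) 1 =
      pathSimplex ((squareMap s).comp ⟨fun t => (t, t), by fun_prop⟩) :=
      congrArg (squareMap s).comp f1
    have h2 : simplexFace ((squareMap s).comp lowerTri) 2 =
      pathSimplex ((squareMap s).comp ⟨fun t => (t, 0), by fun_prop⟩) :=
      congrArg (squareMap s).comp f2
    rw [simplexChain_d, Fin.sum_univ_three, h0, h1, h2]
    simp [right, diag, down, sub_eq_add_neg]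
  have hu : ∀ s, simplexChain ℤ ((squareMap s).comp upperTri) ≫ (SChain ℤ (Surf g)).d 2 1 =
      up s - diag s + left s := by
    intro s
    have h0 : simplexFace ((squareMap s).comp upperTri) 0 =
      pathSimplex ((squareMap s).comp ⟨fun t => (t, 1), by fun_prop⟩) :=
      congrArg ((squareMap s).comp ContinuousMap.prodSwap).comp f0
    have h1 : simplexFace ((squareMap s).comp upperTri) 1 =
      pathSimplex ((squareMap s).comp ⟨fun t => (t, t), by fun_prop⟩) :=
      congrArg ((squareMap s).comp ContinuousMap.prodSwap).comp f1
    have h2 : simplexFace ((squareMap s).comp upperTri) 2 =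
      pathSimplex ((squareMap s).comp ⟨fun t => (0, t), by fun_prop⟩) :=
      congrArg ((squareMap s).comp ContinuousMap.prodSwap).comp f2
    rw [simplexChain_d, Fin.sum_univ_three, h0, h1, h2]
    simp [up, diag, left, sub_eq_add_neg]
  have hr : ∀ s, right s = left (rightPerm g s) := by
    intro s
    refine congrArg (fun γ => simplexChain ℤ (pathSimplex γ)) (ContinuousMap.ext fun t => ?_)
    exact Surf.mk_side s t
  have ht : ∀ s, up s = down (upPerm g s) := by
    intro s
    refine congrArg (fun γ => simplexChain ℤ (pathSimplex γ)) (ContinuousMap.ext fun t => ?_)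
    exact Surf.mk_top s t
  have e1 : ∑ s, right s = ∑ s, left s := by
    simp_rw [hr]
    exact Equiv.sum_comp (rightPerm g) left
  have e2 : ∑ s, up s = ∑ s, down s := by
    simp_rw [ht]
    exact Equiv.sum_comp (upPerm g) down
  rw [fundamentalChain, Preadditive.sum_comp]
  simp_rw [Preadditive.sub_comp, hl, hu, Finset.sum_sub_distrib, Finset.sum_add_distrib,
    Finset.sum_sub_distrib]
  rw [e1, e2]
  abel

/-- The fundamental class `[S_g] ∈ H_2(S_g; ℤ)`. -/
def fundamentalClass (g : ℕ) : SHom 2 ℤ (Surf g) :=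
  cycleClass (fundamentalChain g) (fundamentalChain_d g)

/-- `Mod(S_g)`. -/
abbrev ModS (g : ℕ) : Type := MCG (fundamentalClass g)

/-! ### Annuli and Dehn twists -/

/-- An embedded annulus `(ℝ/ℤ) × [0, 1] → X`, given as a map on `ℝ × [0, 1]` that has period `1` in
the first variable. -/
structure EmbAnnulus (X : Type) [TopologicalSpace X] where
  /-- the parametrization -/
  map : C(ℝ × unitInterval, X)
  periodic : ∀ θ t, map (θ + 1, t) = map (θ, t)
  injOn : Set.InjOn map (Set.Ico 0 1 ×ˢ Set.univ)

/-- The point `1/2` of the unit interval. -/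
def halfI : unitInterval := ⟨1 / 2, by norm_num, by norm_num⟩

/-- The core curve `θ ↦ A(θ, 1/2)`, `0 ≤ θ ≤ 1`, of an annulus. -/
def EmbAnnulus.core {X : Type} [TopologicalSpace X] (A : EmbAnnulus X) : C(unitInterval, X) :=
  A.map.comp ⟨fun θ => (θ.1, halfI), by fun_prop⟩

theorem EmbAnnulus.core_closed {X : Type} [TopologicalSpace X] (A : EmbAnnulus X) :
    A.core 0 = A.core 1 := by
  have h := A.periodic 0 halfI
  rw [zero_add] at h
  exact h.symm

/-- `T` is the twist map `(θ, t) ↦ (θ + t, t)` on the annulus, and the identity outside of it.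
If the annulus is embedded so that the frame `(∂/∂t, ∂/∂θ)` is positively oriented, then this is
the left-handed Dehn twist about the core curve. -/
def EmbAnnulus.IsTwist {X : Type} [TopologicalSpace X] (A : EmbAnnulus X) (T : X ≃ₜ X) : Prop :=
  (∀ (θ : ℝ) (t : unitInterval), T (A.map (θ, t)) = A.map (θ + t.1, t)) ∧
  ∀ p, p ∉ Set.range A.map → T p = p

/-- The fractional part as a point of the unit interval. -/
def fractI (x : ℝ) : unitInterval := ⟨Int.fract x, Int.fract_nonneg x, (Int.fract_lt_one x).le⟩

theorem continuous_strip {S X : Type} [TopologicalSpace X] (π : Equiv.Perm S)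
    (F : S → unitInterval → unitInterval → X)
    (hF : ∀ s, Continuous fun p : unitInterval × unitInterval => F s p.1 p.2)
    (hπ : ∀ s t, F s 1 t = F (π s) 0 t) (s : S) :
    Continuous fun p : ℝ × unitInterval => F ((π ^ ⌊p.1⌋) s) (fractI p.1) p.2 := by
  have lf : LocallyFinite fun n : ℤ =>
      (Prod.fst : ℝ × unitInterval → ℝ) ⁻¹' Set.Icc (n : ℝ) (n + 1) := by
    have h : LocallyFinite fun n : ℤ => Set.Icc (n : ℝ) (n + 1) :=
      locallyFinite_Icc_of_tendsto tendsto_intCast_atTop_atTop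
        (Filter.tendsto_atBot_add_const_right _ _ (tendsto_intCast_atBot_iff.2 Filter.tendsto_id))
    exact h.preimage_continuous continuous_fst
  refine lf.continuous ?_ (fun n => isClosed_Icc.preimage continuous_fst) fun n => ?_
  · refine Set.eq_univ_of_forall fun p => Set.mem_iUnion.2 ⟨⌊p.1⌋, ?_⟩
    exact ⟨Int.floor_le _, (Int.lt_floor_add_one _).le⟩
  · have hc : Continuous fun p : ℝ × unitInterval =>
        F ((π ^ n) s) (Set.projIcc 0 1 zero_le_one (p.1 - n)) p.2 :=
      (hF _).comp (((continuous_projIcc (h := zero_le_one)).comp (by fun_prop)).prodMk continuous_snd)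
    refine hc.continuousOn.congr fun p hp => ?_
    obtain ⟨h1, h2⟩ : (n : ℝ) ≤ p.1 ∧ p.1 ≤ n + 1 := hp
    rcases h2.lt_or_eq with h2 | h2
    · have hn : ⌊p.1⌋ = n := Int.floor_eq_iff.2 ⟨h1, h2⟩
      have : fractI p.1 = Set.projIcc 0 1 zero_le_one (p.1 - n) := by
        rw [Set.projIcc_of_mem _ (x := p.1 - n) ⟨by linarith, by linarith⟩]
        exact Subtype.ext (by simp [fractI, Int.fract, hn])
      simp only [hn, this]
    · have hn : ⌊p.1⌋ = n + 1 := by rw [h2]; simp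
      have h0 : fractI p.1 = 0 := Subtype.ext (by simp [fractI, h2])
      have h3 : Set.projIcc (0 : ℝ) 1 zero_le_one (p.1 - n) = 1 := by
        rw [h2]; simp
      have h4 : (π ^ (n + 1)) s = π ((π ^ n) s) := by
        rw [add_comm, zpow_add, zpow_one]; rfl
      simp only [hn, h0, h3, h4]
      exact (hπ _ _).symm

/-- The point at horizontal distance `x` from the left side of the square `s`, at height `y`, in the
row of squares through `s`. -/
def hline {g : ℕ} (s : Sq g) (x : ℝ) (y : unitInterval) : Surf g :=
  Surf.mk ((rightPerm g ^ ⌊x⌋) s) (fractI x) y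

/-- The point at vertical distance `y` from the lower side of the square `s`, at abscissa `x`, in
the column of squares through `s`. -/
def vline {g : ℕ} (s : Sq g) (x : unitInterval) (y : ℝ) : Surf g :=
  Surf.mk ((upPerm g ^ ⌊y⌋) s) x (fractI y)

theorem continuous_hline {g : ℕ} (s : Sq g) :
    Continuous fun p : ℝ × unitInterval => hline s p.1 p.2 :=
  continuous_strip (rightPerm g) Surf.mk (fun s => (squareMap s).continuous) Surf.mk_side s

theorem continuous_vline {g : ℕ} (s : Sq g) :
    Continuous fun p : ℝ × unitInterval => vline s p.2 p.1 :=
  continuous_strip (upPerm g) (fun s x y => Surf.mk s y x)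
    (fun s => (squareMap s).continuous.comp continuous_swap) Surf.mk_top s

theorem hline_add {g : ℕ} (s : Sq g) (x : ℝ) (y : unitInterval) (n : ℤ)
    (h : (rightPerm g ^ n) s = s) : hline s (x + n) y = hline s x y := by
  have h2 : fractI (x + n) = fractI x := Subtype.ext (Int.fract_add_intCast x n)
  rw [hline, hline, h2, Int.floor_add_intCast, zpow_add, Equiv.Perm.mul_apply, h]

theorem vline_add {g : ℕ} (s : Sq g) (x : unitInterval) (y : ℝ) (n : ℤ)
    (h : (upPerm g ^ n) s = s) : vline s x (y + n) = vline s x y := by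
  have h2 : fractI (y + n) = fractI y := Subtype.ext (Int.fract_add_intCast y n)
  rw [vline, vline, h2, Int.floor_add_intCast, zpow_add, Equiv.Perm.mul_apply, h]

open Classical in
/-- Separates the points of `S_g` that do not lie on horizontal sides of squares. -/
def hsep {g : ℕ} : Surf g → Option (Sq g × unitInterval × unitInterval) :=
  Quot.lift (fun p => if p.2.2 = 0 ∨ p.2.2 = 1 then none else
    if p.2.1 = 1 then some (rightPerm g p.1, 0, p.2.2) else some p) (by
    rintro _ _ (⟨s, y⟩ | ⟨s, x⟩) <;> simp)

open Classical in
/-- Separates the points of `S_g` that do not lie on vertical sides of squares. -/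
def vsep {g : ℕ} : Surf g → Option (Sq g × unitInterval × unitInterval) :=
  Quot.lift (fun p => if p.2.1 = 0 ∨ p.2.1 = 1 then none else
    if p.2.2 = 1 then some (upPerm g p.1, p.2.1, 0) else some p) (by
    rintro _ _ (⟨s, y⟩ | ⟨s, x⟩) <;> simp)

theorem fractI_ne_one (x : ℝ) : fractI x ≠ 1 := fun h =>
  (Int.fract_lt_one x).ne (congrArg Subtype.val h)

theorem hsep_hline {g : ℕ} (s : Sq g) (x : ℝ) (y : unitInterval) (h0 : y ≠ 0) (h1 : y ≠ 1) :
    hsep (hline s x y) = some ((rightPerm g ^ ⌊x⌋) s, fractI x, y) := by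
  change (if y = 0 ∨ y = 1 then none else if fractI x = 1 then _ else _) = _
  rw [if_neg (by tauto), if_neg (fractI_ne_one x)]

theorem vsep_vline {g : ℕ} (s : Sq g) (x : unitInterval) (y : ℝ) (h0 : x ≠ 0) (h1 : x ≠ 1) :
    vsep (vline s x y) = some ((upPerm g ^ ⌊y⌋) s, x, fractI y) := by
  change (if x = 0 ∨ x = 1 then none else if fractI y = 1 then _ else _) = _
  rw [if_neg (by tauto), if_neg (fractI_ne_one y)]

/-- The affine map of `[0, 1]` onto its middle third. -/
def midI (t : unitInterval) : unitInterval :=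
  ⟨(1 + t.1) / 3, by have := t.2.1; linarith, by have := t.2.2; linarith⟩

theorem midI_ne_zero (t : unitInterval) : midI t ≠ 0 := fun h => by
  have h1 : (1 + t.1) / 3 = 0 := congrArg Subtype.val h
  have := t.2.1
  linarith

theorem midI_ne_one (t : unitInterval) : midI t ≠ 1 := fun h => by
  have h1 : (1 + t.1) / 3 = 1 := congrArg Subtype.val h
  have := t.2.2
  linarith

theorem midI_injective : Function.Injective midI := fun t t' h => by
  have h1 : (1 + t.1) / 3 = (1 + t'.1) / 3 := congrArg Subtype.val h
  exact Subtype.ext (by linarith)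

theorem continuous_midI : Continuous midI :=
  Continuous.subtype_mk (by fun_prop) _

theorem eq_of_floor_fract {x x' : ℝ} (h : ⌊x⌋ = ⌊x'⌋) (h' : fractI x = fractI x') : x = x' := by
  have h1 : Int.fract x = Int.fract x' := congrArg Subtype.val h'
  rw [← Int.floor_add_fract x, ← Int.floor_add_fract x', h, h1]

theorem rightPerm_pow (g : ℕ) (i : Fin g) (n : ℤ) (h0 : 0 ≤ n) (h1 : n < 3) :
    (rightPerm g ^ n) (i, 0) =
      (i, if n = 0 then 0 else if (n = 1 ↔ Even i.val) then 1 else 2) := by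
  have hr : ∀ j, rightPerm g (i, j) = (i, if Even i.val then j + 1 else j - 1) := by
    intro j
    by_cases h : Even i.val <;> simp [rightPerm, Equiv.prodShear, h]
  have h2 : (rightPerm g ^ (2 : ℤ)) (i, 0) = rightPerm g (rightPerm g (i, 0)) := rfl
  interval_cases n
  · simp
  · rw [zpow_one, hr]
    by_cases h : Even i.val <;> simp [h] <;> decide
  · rw [h2, hr, hr]
    by_cases h : Even i.val <;> simp [h] <;> decide

theorem rightPerm_cube (g : ℕ) (i : Fin g) : (rightPerm g ^ (3 : ℤ)) (i, 0) = (i, 0) := by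
  have h2 : (rightPerm g ^ (3 : ℤ)) (i, 0) = rightPerm g ((rightPerm g ^ (2 : ℤ)) (i, 0)) := rfl
  rw [h2, rightPerm_pow g i 2 (by norm_num) (by norm_num)]
  by_cases h : Even i.val <;> simp [rightPerm, Equiv.prodShear, h]

/-- The annulus around the curve `b_i`, which runs to the right through the row `i`. Here `t`
increases downwards. -/
def annB {g : ℕ} (i : Fin g) : EmbAnnulus (Surf g) where
  map := ⟨fun p => hline (i, 0) (3 * p.1) (midI (unitInterval.symm p.2)),
    (continuous_hline (i, 0)).comp ((by fun_prop : Continuous fun p : ℝ × unitInterval =>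
      3 * p.1).prodMk (continuous_midI.comp (unitInterval.continuous_symm.comp continuous_snd)))⟩
  periodic θ t := by
    have h : 3 * (θ + 1) = 3 * θ + ((3 : ℤ) : ℝ) := by push_cast; ring
    change hline _ (3 * (θ + 1)) _ = hline _ (3 * θ) _
    rw [h, hline_add _ _ _ 3 (rightPerm_cube g i)]
  injOn := by
    rintro ⟨θ, t⟩ ⟨hθ, -⟩ ⟨θ', t'⟩ ⟨hθ', -⟩ h
    have h1 := congrArg hsep h
    change hsep (hline _ _ _) = hsep (hline _ _ _) at h1
    rw [hsep_hline _ _ _ (midI_ne_zero _) (midI_ne_one _),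
      hsep_hline _ _ _ (midI_ne_zero _) (midI_ne_one _)] at h1
    simp only [Option.some.injEq, Prod.mk.injEq] at h1
    obtain ⟨e1, e2, e3⟩ := h1
    obtain ⟨a0, a1⟩ : 0 ≤ θ ∧ θ < 1 := hθ
    obtain ⟨b0, b1⟩ : 0 ≤ θ' ∧ θ' < 1 := hθ'
    have n0 : 0 ≤ ⌊3 * θ⌋ := Int.floor_nonneg.2 (by linarith)
    have n1 : ⌊3 * θ⌋ < 3 := Int.floor_lt.2 (by push_cast; linarith)
    have m0 : 0 ≤ ⌊3 * θ'⌋ := Int.floor_nonneg.2 (by linarith)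
    have m1 : ⌊3 * θ'⌋ < 3 := Int.floor_lt.2 (by push_cast; linarith)
    have hf : ⌊3 * θ⌋ = ⌊3 * θ'⌋ := by
      rw [rightPerm_pow g i _ n0 n1, rightPerm_pow g i _ m0 m1] at e1
      generalize ⌊3 * θ⌋ = n at *
      generalize ⌊3 * θ'⌋ = m at *
      by_cases hi : Even i.val <;> interval_cases n <;> interval_cases m <;> simp [hi] at e1 ⊢
    have := eq_of_floor_fract hf e2
    exact Prod.ext (by change θ = θ'; linarith) (unitInterval.symm_bijective.1 (midI_injective e3))

/-- The vertical annulus through the square `s`, upwards, if the column through `s` consists of `n`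
squares. Here `t` increases to the right. -/
def annV {g : ℕ} (s : Sq g) (n : ℕ) (hn : 0 < n) (h0 : (upPerm g ^ (n : ℤ)) s = s)
    (h1 : ∀ a b : ℤ, 0 ≤ a → a < n → 0 ≤ b → b < n → (upPerm g ^ a) s = (upPerm g ^ b) s → a = b) :
    EmbAnnulus (Surf g) where
  map := ⟨fun p => vline s (midI p.2) (n * p.1),
    (continuous_vline s).comp ((by fun_prop : Continuous fun p : ℝ × unitInterval =>
      n * p.1).prodMk (continuous_midI.comp continuous_snd))⟩
  periodic θ t := by
    have h : n * (θ + 1) = n * θ + ((n : ℤ) : ℝ) := by push_cast; ring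
    change vline _ _ (n * (θ + 1)) = vline _ _ (n * θ)
    rw [h, vline_add _ _ _ n h0]
  injOn := by
    rintro ⟨θ, t⟩ ⟨hθ, -⟩ ⟨θ', t'⟩ ⟨hθ', -⟩ h
    have h2 := congrArg vsep h
    change vsep (vline _ _ _) = vsep (vline _ _ _) at h2
    rw [vsep_vline _ _ _ (midI_ne_zero _) (midI_ne_one _),
      vsep_vline _ _ _ (midI_ne_zero _) (midI_ne_one _)] at h2
    simp only [Option.some.injEq, Prod.mk.injEq] at h2
    obtain ⟨e1, e2, e3⟩ := h2
    obtain ⟨a0, a1⟩ : 0 ≤ θ ∧ θ < 1 := hθ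
    obtain ⟨b0, b1⟩ : 0 ≤ θ' ∧ θ' < 1 := hθ'
    have hn' : (0 : ℝ) < n := by exact_mod_cast hn
    have hf : ⌊n * θ⌋ = ⌊n * θ'⌋ := by
      refine h1 _ _ (Int.floor_nonneg.2 (by positivity)) (Int.floor_lt.2 ?_)
        (Int.floor_nonneg.2 (by positivity)) (Int.floor_lt.2 ?_) e1
      · push_cast; nlinarith
      · push_cast; nlinarith
    have h3 := mul_left_cancel₀ hn'.ne' (eq_of_floor_fract hf e3)
    exact Prod.ext h3 (midI_injective e2)

/-- The annulus around the curve `a_i`. -/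
def annA {g : ℕ} (i : Fin g) : EmbAnnulus (Surf g) :=
  annV (i, 1) 1 one_pos (by simp [upPerm, upFun]) (by intros; omega)

/-- The annulus around the curve `c_i`, which runs upwards through the square `(i, 2)` of the row
`i` and the square `(i + 1, 0)` of the row `i + 1`. -/
def annC {g : ℕ} (i : Fin g) (hi : i.val + 1 < g) : EmbAnnulus (Surf g) :=
  have h : upPerm g (i, 2) = (⟨i.val + 1, hi⟩, 0) := by simp [upPerm, upFun, hi]
  annV (i, 2) 2 two_pos
    (by
      change upFun g (upFun g (i, 2)) = (i, 2)
      exact upFun_involutive g _)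
    (by
      intro a b a0 a1 b0 b1 e
      push_cast at a1 b1
      interval_cases a <;> interval_cases b <;> simp [h] at e ⊢)

/-- The class of `a_i` in `H_1(S_g; R)`. The curves are oriented so that `c_i` is homologous to
`a_i - a_{i+1}`; this reverses the parametrization of `annA i` for odd `i`. -/
def classA (R : Type) [CommRing R] {g : ℕ} (i : Fin g) : SHom 1 R (Surf g) :=
  (-1 : ℤ) ^ i.val • loopClass R (annA i).core (annA i).core_closed

/-- The class of `b_i` in `H_1(S_g; R)`, with the same convention for orientations. -/
def classB (R : Type) [CommRing R] {g : ℕ} (i : Fin g) : SHom 1 R (Surf g) :=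
  (-1 : ℤ) ^ i.val • loopClass R (annB i).core (annB i).core_closed

/-- The mapping class `f` is the left-handed Dehn twist about the core curve of `A` (for `A` one of
the annuli above, all of which are compatible with the orientation). -/
def IsDehnTwist {g : ℕ} (A : EmbAnnulus (Surf g)) (f : ModS g) : Prop :=
  ∃ T : homeoPlus (fundamentalClass g), A.IsTwist T.1 ∧ (T : ModS g) = f

/-- The mapping classes `T_{a_2}, T_{b_2}, …, T_{a_g}, T_{b_g}, T_{c_1}, …, T_{c_{g-1}}` (in the
code, `a_1, b_1, c_1` have index `0`). -/
def twistSet (g : ℕ) : Set (ModS g) :=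
  {f | (∃ i : Fin g, 0 < i.val ∧ (IsDehnTwist (annA i) f ∨ IsDehnTwist (annB i) f)) ∨
    ∃ (i : Fin g) (hi : i.val + 1 < g), IsDehnTwist (annC i hi) f}

/-- `Mod_{p_k}(S_g, e_1)`: the stabilizer in `Mod(S_g)` of `e_1 = [a_1] ∈ H_1(S_g; ℤ/k)`. -/
def modE1 (g k : ℕ) [NeZero g] : Subgroup (ModS g) :=
  mcgStab (fundamentalClass g) (classA (ZMod k) (0 : Fin g))

/-! ### The embedding of `SL(2, ℤ)` -/

/-- `η_g : SL(2, ℤ) → Sp(2g, ℤ)`: the matrix acts on the span of `a_1, b_1`, and the other basis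
vectors are fixed. The index `inl i` stands for `a_{i+1}`, `inr i` for `b_{i+1}`. -/
def eta (g : ℕ) [NeZero g] (A : Matrix.SpecialLinearGroup (Fin 2) ℤ) :
    Matrix.symplecticGroup (Fin g) ℤ :=
  ⟨Matrix.fromBlocks
    (Matrix.diagonal (Function.update 1 0 (A 0 0))) (Matrix.diagonal (Pi.single 0 (A 0 1)))
    (Matrix.diagonal (Pi.single 0 (A 1 0))) (Matrix.diagonal (Function.update 1 0 (A 1 1))), by
    have hdet : A 0 0 * A 1 1 - A 0 1 * A 1 0 = 1 := by
      rw [← Matrix.det_fin_two]; exact A.det_coe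
    rw [SymplecticGroup.fromBlocks_mem_iff]
    simp only [Matrix.diagonal_transpose, Matrix.diagonal_mul_diagonal, Matrix.diagonal_sub]
    refine ⟨?_, ?_, ?_⟩
    · simp only [mul_comm]
    · simp only [mul_comm]
    · rw [← Matrix.diagonal_one]
      congr 1
      ext i
      by_cases h : i = 0
      · subst h; simp; linarith
      · simp [h]⟩

end

/-! The proof has a topological half, which turns mapping classes into integral matrices, and an
arithmetic half, which generates the group of matrices so obtained.

Topology. Homology embeds into chains modulo boundaries, where integral cocycles are just linear
maps to `ℤ`. The classes `a_i`, `b_i` span `H_1`: modulo their span the sides of the squares are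
differences of a potential on the corners (`exists_side_potential`), and then the class of any path
depends only on its end points, so every cycle dies (`homOpc_mem_of_potential`). They are
independent because winding numbers of maps to the circle give dual cocycles (`dualOpc_class`). The
cup products of these cocycles on the fundamental class form the standard matrix `J`; such a product
depends only on the values of the cocycles on homology (`cup_congr`), so a homeomorphism that
preserves the fundamental class acts by a symplectic matrix (`actMatrix_mem`). A Dehn twist acts on
homology as a map that is affine on a strip of squares, or as the inverse of such a map
(`homeoAct_hShear`, `homeoAct_vShear`). Affine maps can be computed on simplices: they preserve the
fundamental class, and the twist about a curve `c` becomes the transvection `u ↦ u + ω(u, c) c`.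
Finally, a mapping class fixes `a_1` modulo `k` exactly when the first column of its matrix is the
first unit vector modulo `k` (`mem_modE1_iff`).

Arithmetic. Let `M` fix all handles before the handle `j`, and `a_j` modulo `k`. Let `H` contain all
symplectic matrices that fix the handles up to `j`, the group `Γ_1(k)` acting on the handle `j`, and
the transvection along `a_j - a_{j+1}`. Then `M ∈ H` (`mem_of_fixesMod`). Indeed `H` contains the
Eichler maps `u ↦ u + ω(u, z) a_j + ω(u, a_j) z` for all `z` in the later handles (`eichler_mem`).
Multiplying `M` by these and by elements of `Γ_1(k)`, one makes the coordinates of `M a_j` in the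
handle `j` coprime, then equal to `(1, 0)`, and then achieves `M a_j = a_j`; a last correction fixes
`b_j` as well, and what is left fixes the handles up to `j`.

For `k = 1` the group `Γ_1(k)` is all of `SL(2, ℤ)`, which two transvections generate. A descent
over the handles therefore shows that the twists about `a_i`, `b_i`, `c_i` with `i ≥ 2` generate all
matrices that fix the first handle (`mem_of_fixesBelow`). One more application, with the given `k`
and the first handle, proves one inclusion. The other one needs only that `SL(2, ℤ)` in the first
handle is realized by the twists about `a_1` and `b_1`, and that the listed twists fix `a_1`. -/

noncomputable section

/-! ### Chains modulo boundaries -/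

section Chains

variable {X Y : Type} [TopologicalSpace X] [TopologicalSpace Y]

/-- The chain map induced by a continuous map. -/
abbrev chainMap (R : Type) [CommRing R] (f : C(X, Y)) : SChain R X ⟶ SChain R Y :=
  ((AlgebraicTopology.singularChainComplexFunctor (ModuleCat.{0} ℤ)).obj (ModuleCat.of ℤ R)).map
    (TopCat.ofHom f)

theorem simplexChain_map {n : ℕ} (R : Type) [CommRing R] (f : C(X, Y))
    (σ : C(stdSimplex ℝ (Fin (n + 1)), X)) :
    simplexChain R σ ≫ (chainMap R f).f n = simplexChain R (f.comp σ) :=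
  SSet.ι_chainComplexMap_f (TopCat.toSSet.obj (TopCat.of X)) (TopCat.toSSet.obj (TopCat.of Y))
    (TopCat.toSSet.map (TopCat.ofHom f)) (ModuleCat.of ℤ R)
    ((TopCat.toSSetObjEquiv (TopCat.of X) (Opposite.op (SimplexCategory.mk n))).symm σ)

theorem chain_hom_ext {n : ℕ} {R : Type} [CommRing R] {A : ModuleCat.{0} ℤ}
    {f g : (SChain R X).X n ⟶ A}
    (h : ∀ σ : C(stdSimplex ℝ (Fin (n + 1)), X), simplexChain R σ ≫ f = simplexChain R σ ≫ g) :
    f = g := by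
  refine SSet.chainComplex_hom_ext (X := TopCat.toSSet.obj (TopCat.of X))
    (R := ModuleCat.of ℤ R) fun x => ?_
  have := h ((TopCat.toSSetObjEquiv (TopCat.of X) (Opposite.op (SimplexCategory.mk n))) x)
  rw [simplexChain, Equiv.symm_apply_apply] at this
  exact this

/-- A family of morphisms, one for each simplex, as a morphism on chains. -/
def chainDesc {n : ℕ} (R : Type) [CommRing R] {A : ModuleCat.{0} ℤ}
    (φ : C(stdSimplex ℝ (Fin (n + 1)), X) → (ModuleCat.of ℤ R ⟶ A)) :
    (SChain R X).X n ⟶ A :=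
  Limits.Cofan.IsColimit.desc
    ((TopCat.toSSet.obj (TopCat.of X)).isColimitChainComplexXCofan (ModuleCat.of ℤ R) n)
    (fun x => φ (TopCat.toSSetObjEquiv (TopCat.of X) (Opposite.op (SimplexCategory.mk n)) x))

theorem simplexChain_desc {n : ℕ} (R : Type) [CommRing R] {A : ModuleCat.{0} ℤ}
    (φ : C(stdSimplex ℝ (Fin (n + 1)), X) → (ModuleCat.of ℤ R ⟶ A))
    (σ : C(stdSimplex ℝ (Fin (n + 1)), X)) :
    simplexChain R σ ≫ chainDesc R φ = φ σ := by
  have := Limits.Cofan.IsColimit.fac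
    ((TopCat.toSSet.obj (TopCat.of X)).isColimitChainComplexXCofan (ModuleCat.of ℤ R) n)
    (fun x => φ (TopCat.toSSetObjEquiv (TopCat.of X) (Opposite.op (SimplexCategory.mk n)) x))
    ((TopCat.toSSetObjEquiv (TopCat.of X) (Opposite.op (SimplexCategory.mk n))).symm σ)
  rw [Equiv.apply_symm_apply] at this
  exact this

/-- Chains modulo boundaries. -/
abbrev Opc (n : ℕ) (R : Type) [CommRing R] (X : Type) [TopologicalSpace X] : ModuleCat.{0} ℤ :=
  (SChain R X).opcycles n

/-- A simplex, with a coefficient, modulo boundaries. -/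
def simplexOpc {n : ℕ} (R : Type) [CommRing R] (σ : C(stdSimplex ℝ (Fin (n + 1)), X)) :
    R →ₗ[ℤ] Opc n R X :=
  (simplexChain R σ ≫ (SChain R X).pOpcycles n).hom

theorem simplexOpc_boundary {n : ℕ} (R : Type) [CommRing R]
    (σ : C(stdSimplex ℝ (Fin (n + 2)), X)) (r : R) :
    ∑ i : Fin (n + 2), (-1 : ℤ) ^ i.val • simplexOpc R (simplexFace σ i) r = 0 := by
  have h : simplexChain R σ ≫ (SChain R X).d (n + 1) n ≫ (SChain R X).pOpcycles n = 0 := by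
    rw [HomologicalComplex.d_pOpcycles, Limits.comp_zero]
  rw [← Category.assoc, simplexChain_d, Preadditive.sum_comp] at h
  have h2 := congrArg (fun f => f.hom r) h
  simpa [simplexOpc, ModuleCat.hom_sum, LinearMap.sum_apply] using h2

/-- A cocycle, as a linear map on chains modulo boundaries. -/
def opcDesc {n : ℕ} (R : Type) [CommRing R] {A : Type} [AddCommGroup A]
    (φ : C(stdSimplex ℝ (Fin (n + 1)), X) → (R →ₗ[ℤ] A))
    (h : ∀ (σ : C(stdSimplex ℝ (Fin (n + 2)), X)) (r : R),
      ∑ i : Fin (n + 2), (-1 : ℤ) ^ i.val • φ (simplexFace σ i) r = 0) : Opc n R X →ₗ[ℤ] A :=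
  ((SChain R X).descOpcycles (chainDesc R (A := ModuleCat.of ℤ A) fun σ => ModuleCat.ofHom (φ σ))
    (n + 1) (by simp) (by
      refine chain_hom_ext fun σ => ?_
      rw [← Category.assoc, simplexChain_d, Preadditive.sum_comp, Limits.comp_zero]
      simp_rw [Preadditive.zsmul_comp, simplexChain_desc]
      ext r
      simpa [ModuleCat.hom_sum, LinearMap.sum_apply] using h σ r)).hom

theorem opcDesc_simplexOpc {n : ℕ} (R : Type) [CommRing R] {A : Type} [AddCommGroup A]
    (φ : C(stdSimplex ℝ (Fin (n + 1)), X) → (R →ₗ[ℤ] A)) (h) (σ) (r : R) :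
    opcDesc R φ h (simplexOpc R σ r) = φ σ r := by
  have : (simplexChain R σ ≫ (SChain R X).pOpcycles n) ≫ (SChain R X).descOpcycles
      (chainDesc R (A := ModuleCat.of ℤ A) fun σ => ModuleCat.ofHom (φ σ)) (n + 1) (by simp)
      (by
        refine chain_hom_ext fun σ => ?_
        rw [← Category.assoc, simplexChain_d, Preadditive.sum_comp, Limits.comp_zero]
        simp_rw [Preadditive.zsmul_comp, simplexChain_desc]
        ext r
        simpa [ModuleCat.hom_sum, LinearMap.sum_apply] using h σ r) = ModuleCat.ofHom (φ σ) := by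
    rw [Category.assoc, HomologicalComplex.p_descOpcycles, simplexChain_desc]
  exact congrArg (fun f => f.hom r) this

theorem opc_lin_ext {n : ℕ} {R : Type} [CommRing R] {A : Type} [AddCommGroup A]
    {f g : Opc n R X →ₗ[ℤ] A} (h : ∀ σ r, f (simplexOpc R σ r) = g (simplexOpc R σ r)) :
    f = g := by
  have : ModuleCat.ofHom f = ModuleCat.ofHom g := by
    rw [← cancel_epi ((SChain R X).pOpcycles n)]
    refine chain_hom_ext fun σ => ?_
    ext r
    exact h σ r
  exact congrArg ModuleCat.Hom.hom this

/-- The map on chains modulo boundaries induced by a continuous map. -/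
def opcMap (n : ℕ) (R : Type) [CommRing R] (f : C(X, Y)) : Opc n R X →ₗ[ℤ] Opc n R Y :=
  (HomologicalComplex.opcyclesMap (chainMap R f) n).hom

theorem opcMap_simplexOpc {n : ℕ} (R : Type) [CommRing R] (f : C(X, Y))
    (σ : C(stdSimplex ℝ (Fin (n + 1)), X)) (r : R) :
    opcMap n R f (simplexOpc R σ r) = simplexOpc R (f.comp σ) r := by
  have : (simplexChain R σ ≫ (SChain R X).pOpcycles n) ≫
      HomologicalComplex.opcyclesMap (chainMap R f) n =
      simplexChain R (f.comp σ) ≫ (SChain R Y).pOpcycles n := by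
    rw [Category.assoc, HomologicalComplex.p_opcyclesMap, ← Category.assoc, simplexChain_map]
  exact congrArg (fun f => f.hom r) this

/-- Homology as a subgroup of chains modulo boundaries. -/
def homOpc (n : ℕ) (R : Type) [CommRing R] (X : Type) [TopologicalSpace X] :
    SHom n R X →ₗ[ℤ] Opc n R X :=
  ((SChain R X).homologyι n).hom

/-- Equality of homology classes is always tested after this embedding, where chains are sums of
explicit simplices. -/
theorem homOpc_injective (n : ℕ) (R : Type) [CommRing R] (X : Type) [TopologicalSpace X] :
    Function.Injective (homOpc n R X) :=
  (ModuleCat.mono_iff_injective ((SChain R X).homologyι n)).1 inferInstance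

theorem homOpc_homeoAct {n : ℕ} {R : Type} [CommRing R] (f : X ≃ₜ X) (x : SHom n R X) :
    homOpc n R X (homeoAct n R X f x) = opcMap n R (f : C(X, X)) (homOpc n R X x) :=
  congrArg (fun g => g.hom x) (HomologicalComplex.homologyι_naturality (chainMap R (f : C(X, X))) n)

theorem homOpc_cycleClass {n : ℕ} {R : Type} [CommRing R]
    (c : ModuleCat.of ℤ R ⟶ (SChain R X).X (n + 1)) (hc : c ≫ (SChain R X).d (n + 1) n = 0) :
    homOpc (n + 1) R X (cycleClass c hc) = (c ≫ (SChain R X).pOpcycles (n + 1)).hom (1 : R) := by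
  have : ((SChain R X).liftCycles c n (ChainComplex.next_nat_succ n) hc ≫
    (SChain R X).homologyπ (n + 1)) ≫ (SChain R X).homologyι (n + 1) =
      c ≫ (SChain R X).pOpcycles (n + 1) := by
    rw [Category.assoc, HomologicalComplex.homology_π_ι, HomologicalComplex.liftCycles_i_assoc]
  exact congrArg (fun g => g.hom (1 : R)) this

theorem homOpc_loopClass (R : Type) [CommRing R] (γ : C(unitInterval, X)) (h : γ 0 = γ 1) :
    homOpc 1 R X (loopClass R γ h) = simplexOpc R (pathSimplex γ) 1 :=
  homOpc_cycleClass _ _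

/-- The boundary map on chains modulo boundaries. -/
def opcBoundary (n : ℕ) (X : Type) [TopologicalSpace X] :
    Opc (n + 1) ℤ X →ₗ[ℤ] (SChain ℤ X).X n :=
  ((SChain ℤ X).fromOpcycles (n + 1) n).hom

theorem opcBoundary_homOpc (n : ℕ) (x : SHom (n + 1) ℤ X) :
    opcBoundary n X (homOpc (n + 1) ℤ X x) = 0 :=
  congrArg (fun g => g.hom x) ((SChain ℤ X).homologyι_comp_fromOpcycles (n + 1) n)

theorem opcBoundary_simplexOpc (n : ℕ) (σ : C(stdSimplex ℝ (Fin (n + 2)), X)) (r : ℤ) :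
    opcBoundary n X (simplexOpc ℤ σ r) =
      ∑ i : Fin (n + 2), (-1 : ℤ) ^ i.val • (simplexChain ℤ (simplexFace σ i)).hom r := by
  have : (simplexChain ℤ σ ≫ (SChain ℤ X).pOpcycles (n + 1)) ≫
      (SChain ℤ X).fromOpcycles (n + 1) n =
      ∑ i : Fin (n + 2), (-1 : ℤ) ^ i.val • simplexChain ℤ (simplexFace σ i) := by
    rw [Category.assoc, HomologicalComplex.p_fromOpcycles, simplexChain_d]
  refine (congrArg (fun g => g.hom r) this).trans ?_
  simp [ModuleCat.hom_sum, LinearMap.sum_apply]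

/-- The class of an integral simplex modulo boundaries. -/
abbrev scl {n : ℕ} (σ : C(stdSimplex ℝ (Fin (n + 1)), X)) : Opc n ℤ X := simplexOpc ℤ σ 1

theorem opc_ext_int {n : ℕ} {A : Type} [AddCommGroup A]
    {f g : Opc n ℤ X →ₗ[ℤ] A} (h : ∀ σ, f (scl σ) = g (scl σ)) : f = g := by
  refine opc_lin_ext fun σ r => ?_
  have : r = r • (1 : ℤ) := by simp
  rw [this, map_zsmul, map_zsmul, map_zsmul, h]

theorem opc_addHom_ext {n : ℕ} {A : Type} [AddCommGroup A]
    {f g : Opc n ℤ X →+ A} (h : ∀ σ, f (scl σ) = g (scl σ)) : f = g := by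
  let f' : Opc n ℤ X →ₗ[ℤ] A :=
    { f with map_smul' := fun m x => map_intCast_smul f ℤ ℤ m x }
  let g' : Opc n ℤ X →ₗ[ℤ] A :=
    { g with map_smul' := fun m x => map_intCast_smul g ℤ ℤ m x }
  have : f' = g' := opc_ext_int h
  ext x
  exact congrArg (fun k : Opc n ℤ X →ₗ[ℤ] A => k x) this

theorem scl_boundary_two (σ : C(stdSimplex ℝ (Fin 3), X)) :
    scl (simplexFace σ 0) - scl (simplexFace σ 1) + scl (simplexFace σ 2) = 0 := by
  have := simplexOpc_boundary ℤ σ 1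
  rw [Fin.sum_univ_three] at this
  simpa [sub_eq_add_neg] using this

theorem scl_boundary_three (σ : C(stdSimplex ℝ (Fin 4), X)) :
    scl (simplexFace σ 0) - scl (simplexFace σ 1) + scl (simplexFace σ 2) -
      scl (simplexFace σ 3) = 0 := by
  have := simplexOpc_boundary ℤ σ 1
  rw [Fin.sum_univ_four] at this
  simpa [sub_eq_add_neg, pow_succ] using this

end Chains

/-! ### Affine simplices -/

section Affine

variable {X Y : Type} [TopologicalSpace X] [TopologicalSpace Y]
variable {E : Type} [AddCommGroup E] [Module ℝ E] [TopologicalSpace E] [ContinuousAdd E]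
  [ContinuousSMul ℝ E]

/-- The affine simplex with given vertices. -/
def aff {n : ℕ} (v : Fin (n + 1) → E) : C(stdSimplex ℝ (Fin (n + 1)), E) where
  toFun p := ∑ i, p.1 i • v i
  continuous_toFun := by
    refine continuous_finsetSum _ fun i _ => ?_
    exact ((continuous_apply i).comp continuous_subtype_val).smul continuous_const

theorem aff_apply {n : ℕ} (v : Fin (n + 1) → E) (p : stdSimplex ℝ (Fin (n + 1))) :
    aff v p = ∑ i, p.1 i • v i := rfl

theorem aff_face {n : ℕ} (v : Fin (n + 2) → E) (i : Fin (n + 2)) :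
    simplexFace (aff v) i = aff (v ∘ i.succAbove) := by
  ext p
  change ∑ j, (stdSimplex.map i.succAbove p).1 j • v j = ∑ j, p.1 j • v (i.succAbove j)
  have key : ∀ j, (stdSimplex.map i.succAbove p).1 j =
      ∑ l, if i.succAbove l = j then p.1 l else 0 := by
    intro j
    refine (FunOnFinite.linearMap_apply_apply ..).trans ?_
    rw [Finset.sum_filter]
    rfl
  simp_rw [key, Finset.sum_smul]
  rw [Finset.sum_comm]
  refine Finset.sum_congr rfl fun l _ => ?_
  rw [Finset.sum_eq_single (i.succAbove l)]
  · simp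
  · intro b _ hb
    rw [if_neg (Ne.symm hb), zero_smul]
  · simp

/-- The class of the image of an affine segment. -/
def seg (Φ : C(E, X)) (v w : E) : Opc 1 ℤ X := scl (Φ.comp (aff ![v, w]))

/-- The three segments are the sides of the affine triangle `u, v, w`, whose image bounds. Linearity
of `E` supplies the triangle for free. -/
theorem seg_add (Φ : C(E, X)) (u v w : E) : seg Φ u v + seg Φ v w = seg Φ u w := by
  have h := scl_boundary_two (Φ.comp (aff ![u, v, w]))
  have e : ∀ i, simplexFace (Φ.comp (aff ![u, v, w])) i =
      Φ.comp (aff (![u, v, w] ∘ i.succAbove)) := fun i => congrArg Φ.comp (aff_face _ i)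
  rw [e, e, e] at h
  have h0 : ![u, v, w] ∘ Fin.succAbove 0 = ![v, w] := by ext i; fin_cases i <;> rfl
  have h1 : ![u, v, w] ∘ Fin.succAbove 1 = ![u, w] := by ext i; fin_cases i <;> rfl
  have h2 : ![u, v, w] ∘ Fin.succAbove 2 = ![u, v] := by ext i; fin_cases i <;> rfl
  rw [h0, h1, h2] at h
  rw [seg, seg, seg, ← sub_eq_zero, ← h]
  abel

theorem seg_self (Φ : C(E, X)) (v : E) : seg Φ v v = 0 := by
  have := seg_add Φ v v v
  simpa using this

theorem seg_symm (Φ : C(E, X)) (v w : E) : seg Φ v w = -seg Φ w v := by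
  rw [eq_neg_iff_add_eq_zero, seg_add, seg_self]

/-- Only the maps restricted to the segments matter, so a segment may be passed from one chart to
another; this is how sides of glued squares are identified. -/
theorem seg_congr {E' : Type} [AddCommGroup E'] [Module ℝ E'] [TopologicalSpace E']
    [ContinuousAdd E'] [ContinuousSMul ℝ E'] {Φ : C(E, X)} {Ψ : C(E', X)} {v w : E} {v' w' : E'}
    (h : ∀ a b : ℝ, 0 ≤ a → 0 ≤ b → a + b = 1 → Φ (a • v + b • w) = Ψ (a • v' + b • w')) :
    seg Φ v w = seg Ψ v' w' := by
  refine congrArg scl (ContinuousMap.ext fun p => ?_)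
  have h1 := p.2.2
  rw [Fin.sum_univ_two] at h1
  have := h (p.1 0) (p.1 1) (p.2.1 0) (p.2.1 1) h1
  simpa [aff_apply, Fin.sum_univ_two] using this

theorem seg_const {Φ : C(E, X)} {v w : E} {x : X}
    (h : ∀ a b : ℝ, 0 ≤ a → 0 ≤ b → a + b = 1 → Φ (a • v + b • w) = x) : seg Φ v w = 0 := by
  rw [← seg_self (ContinuousMap.const ℝ x) 0]
  exact seg_congr fun a b ha hb hab => by simp [h a b ha hb hab]

theorem opcMap_seg (f : C(X, Y)) (Φ : C(E, X)) (v w : E) :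
    opcMap 1 ℤ f (seg Φ v w) = seg (f.comp Φ) v w :=
  opcMap_simplexOpc ℤ f _ 1

/-- A path, extended by constants. -/
def pathExt (γ : C(unitInterval, X)) : C(ℝ, X) := γ.comp ⟨Set.projIcc 0 1 zero_le_one, by fun_prop⟩

theorem scl_pathSimplex (γ : C(unitInterval, X)) :
    scl (pathSimplex γ) = seg (pathExt γ) 0 1 := by
  refine congrArg scl (ContinuousMap.ext fun p => ?_)
  change γ (stdSimplexHomeomorphUnitInterval p) = γ (Set.projIcc 0 1 zero_le_one _)
  congr 1
  have : aff ![(0 : ℝ), 1] p = p.1 1 := by simp [aff_apply, Fin.sum_univ_two]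
  rw [this, Set.projIcc_of_mem zero_le_one (x := p.1 1) ⟨p.2.1 1, stdSimplex.le_one p 1⟩]
  rfl

end Affine

/-! ### Paths on the surface modulo boundaries -/

section Spanning

variable {g : ℕ}

/-- The projection of the plane onto the unit square. -/
def projSq : C(ℝ × ℝ, unitInterval × unitInterval) :=
  ⟨fun p => (Set.projIcc 0 1 zero_le_one p.1, Set.projIcc 0 1 zero_le_one p.2), by fun_prop⟩

/-- The square `s` as a map from the plane. -/
def sqExt (s : Sq g) : C(ℝ × ℝ, Surf g) := (squareMap s).comp projSq

theorem sqExt_coe (s : Sq g) (x y : unitInterval) : sqExt s (x.1, y.1) = Surf.mk s x y := by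
  change Surf.mk s (Set.projIcc 0 1 zero_le_one x.1) (Set.projIcc 0 1 zero_le_one y.1) = _
  rw [Set.projIcc_val, Set.projIcc_val]

theorem sqExt_right (s : Sq g) (y : ℝ) : sqExt s (1, y) = sqExt (rightPerm g s) (0, y) := by
  change Surf.mk s (Set.projIcc 0 1 zero_le_one 1) _ = Surf.mk _ (Set.projIcc 0 1 zero_le_one 0) _
  rw [Set.projIcc_right, Set.projIcc_left]
  exact Surf.mk_side s _

theorem sqExt_top (s : Sq g) (x : ℝ) : sqExt s (x, 1) = sqExt (upPerm g s) (x, 0) := by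
  change Surf.mk s _ (Set.projIcc 0 1 zero_le_one 1) = Surf.mk _ _ (Set.projIcc 0 1 zero_le_one 0)
  rw [Set.projIcc_right, Set.projIcc_left]
  exact Surf.mk_top s _

/-- The lower side of a square. -/
def hEdge (s : Sq g) : Opc 1 ℤ (Surf g) := seg (sqExt s) (0, 0) (1, 0)

/-- The left side of a square. -/
def vEdge (s : Sq g) : Opc 1 ℤ (Surf g) := seg (sqExt s) (0, 0) (0, 1)

theorem seg_right (s : Sq g) (a b : ℝ) :
    seg (sqExt s) (1, a) (1, b) = seg (sqExt (rightPerm g s)) (0, a) (0, b) := by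
  refine seg_congr fun t t' _ _ h => ?_
  have := sqExt_right s (t * a + t' * b)
  simpa [h] using this

theorem seg_top (s : Sq g) (a b : ℝ) :
    seg (sqExt s) (a, 1) (b, 1) = seg (sqExt (upPerm g s)) (a, 0) (b, 0) := by
  refine seg_congr fun t t' _ _ h => ?_
  have := sqExt_top s (t * a + t' * b)
  simpa [h] using this

/-- Both sides are homologous to the diagonal of the square. -/
theorem edge_square (s : Sq g) :
    vEdge s + hEdge (upPerm g s) = hEdge s + vEdge (rightPerm g s) := by
  rw [hEdge, vEdge, hEdge, vEdge, ← seg_right, ← seg_top, seg_add, seg_add]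

/-- A continuous map from a product with the surface can be checked on squares. -/
theorem Surf.continuous_prod {Y Z : Type} [TopologicalSpace Y] [LocallyCompactSpace Y]
    [TopologicalSpace Z] {f : Y × Surf g → Z}
    (h : Continuous fun p : Y × (Sq g × unitInterval × unitInterval) =>
      f (p.1, Surf.mk p.2.1 p.2.2.1 p.2.2.2)) : Continuous f :=
  (isQuotientMap_quot_mk (r := Glue g)).continuous_lift_prod_right h

theorem Surf.exists_mk (P : Surf g) : ∃ s x y, P = Surf.mk s x y := by
  obtain ⟨⟨s, x, y⟩, rfl⟩ := Quot.exists_rep P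
  exact ⟨s, x, y, rfl⟩

/-- The affine homotopy from the identity of the unit interval to `κ`. -/
def lerpI (κ : C(unitInterval, unitInterval)) (u x : unitInterval) : unitInterval :=
  ⟨(1 - u.1) * x.1 + u.1 * (κ x).1,
    (convex_Icc (0 : ℝ) 1) x.2 (κ x).2 (by linarith [u.2.2]) u.2.1 (by ring)⟩

theorem lerpI_fix {κ : C(unitInterval, unitInterval)} {x : unitInterval} (h : κ x = x)
    (u : unitInterval) : lerpI κ u x = x := by
  refine Subtype.ext ?_
  change (1 - u.1) * x.1 + u.1 * (κ x).1 = x.1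
  rw [h]; ring

theorem lerpI_one (κ : C(unitInterval, unitInterval)) (x : unitInterval) :
    lerpI κ 1 x = κ x := by
  refine Subtype.ext ?_
  change (1 - (1 : ℝ)) * x.1 + (1 : ℝ) * (κ x).1 = _
  ring

theorem lerpI_zero (κ : C(unitInterval, unitInterval)) (x : unitInterval) :
    lerpI κ 0 x = x := by
  refine Subtype.ext ?_
  change (1 - (0 : ℝ)) * x.1 + (0 : ℝ) * (κ x).1 = _
  ring

theorem continuous_lerpI (κ : C(unitInterval, unitInterval)) :
    Continuous fun p : unitInterval × unitInterval => lerpI κ p.1 p.2 := by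
  refine Continuous.subtype_mk ?_ _
  fun_prop

/-- The homotopy of the surface given by affine homotopies of the coordinates. -/
def surfLerp (κ κ' : C(unitInterval, unitInterval)) (h0 : κ 0 = 0) (h1 : κ 1 = 1)
    (h0' : κ' 0 = 0) (h1' : κ' 1 = 1) : C(unitInterval × Surf g, Surf g) where
  toFun p := Quot.lift (fun q => Surf.mk q.1 (lerpI κ p.1 q.2.1) (lerpI κ' p.1 q.2.2)) (by
    rintro _ _ (⟨s, y⟩ | ⟨s, x⟩)
    · simp only [lerpI_fix h0, lerpI_fix h1, Surf.mk_side]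
    · simp only [lerpI_fix h0', lerpI_fix h1', Surf.mk_top]) p.2
  continuous_toFun := by
    refine Surf.continuous_prod (Surf.continuous_mk.comp (f := fun p : unitInterval ×
      (Sq g × unitInterval × unitInterval) =>
        (p.2.1, lerpI κ p.1 p.2.2.1, lerpI κ' p.1 p.2.2.2)) ?_)
    exact (continuous_fst.comp continuous_snd).prodMk
      (((continuous_lerpI κ).comp (continuous_fst.prodMk (by fun_prop))).prodMk
        ((continuous_lerpI κ').comp (continuous_fst.prodMk (by fun_prop))))

/-- A map of the unit interval to itself that fixes the end points and is locally constant on a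
neighbourhood of a given point `c`, and of both end points if `c` is one of them. -/
theorem exists_contraction (c : unitInterval) :
    ∃ (κ : C(unitInterval, unitInterval)) (O : Set unitInterval), κ 0 = 0 ∧ κ 1 = 1 ∧ κ c = c ∧
      IsOpen O ∧ c ∈ O ∧ (0 ∈ O ↔ 1 ∈ O) ∧ ∀ x ∈ O, ∀ᶠ x' in nhds x, κ x' = κ x := by
  by_cases hc : c.1 = 0 ∨ c.1 = 1
  · let κ : C(unitInterval, unitInterval) :=
      ⟨fun x => Set.projIcc 0 1 zero_le_one (3 * x.1 - 1), by fun_prop⟩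
    have hl : ∀ x : unitInterval, x.1 < 1 / 3 → κ x = 0 := fun x hx =>
      Set.projIcc_of_le_left zero_le_one (by linarith)
    have hr : ∀ x : unitInterval, 2 / 3 < x.1 → κ x = 1 := fun x hx =>
      Set.projIcc_of_right_le zero_le_one (by linarith)
    have k0 : κ 0 = 0 := hl 0 (by simp)
    have k1 : κ 1 = 1 := hr 1 (by norm_num)
    have o1 : IsOpen {x : unitInterval | x.1 < 1 / 3} :=
      isOpen_lt continuous_subtype_val continuous_const
    have o2 : IsOpen {x : unitInterval | 2 / 3 < x.1} :=
      isOpen_lt continuous_const continuous_subtype_val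
    refine ⟨κ, {x | x.1 < 1 / 3} ∪ {x | 2 / 3 < x.1}, k0, k1, ?_, o1.union o2, ?_, ?_, ?_⟩
    · rcases hc with h | h
      · rw [show c = 0 from Subtype.ext h, k0]
      · rw [show c = 1 from Subtype.ext h, k1]
    · rcases hc with h | h
      · left; change c.1 < _; rw [h]; norm_num
      · right; change _ < c.1; rw [h]; norm_num
    · refine ⟨fun _ => Or.inr ?_, fun _ => Or.inl ?_⟩
      · change (2 / 3 : ℝ) < 1; norm_num
      · change (0 : ℝ) < 1 / 3; norm_num
    · rintro x (hx | hx)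
      · filter_upwards [o1.mem_nhds hx] with x' hx'
        rw [hl x hx, hl x' hx']
      · filter_upwards [o2.mem_nhds hx] with x' hx'
        rw [hr x hx, hr x' hx']
  · push Not at hc
    have c0 : 0 < c.1 := lt_of_le_of_ne c.2.1 (Ne.symm hc.1)
    have c1 : c.1 < 1 := lt_of_le_of_ne c.2.2 hc.2
    -- This rises with slope `2` to the value `c`, stays there from `c / 2` to `(1 + c) / 2`, and
    -- then rises with slope `2` to `1`.
    let κ : C(unitInterval, unitInterval) :=
      ⟨fun x => Set.projIcc 0 1 zero_le_one (max (2 * x.1 - 1) (min (2 * x.1) c.1)), by fun_prop⟩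
    have hk : ∀ x : unitInterval, c.1 / 2 < x.1 → x.1 < (1 + c.1) / 2 → κ x = c := by
      intro x hx hx'
      change Set.projIcc 0 1 zero_le_one (max (2 * x.1 - 1) (min (2 * x.1) c.1)) = c
      rw [min_eq_right (by linarith), max_eq_right (by linarith), Set.projIcc_val]
    have o : IsOpen ({x : unitInterval | c.1 / 2 < x.1} ∩ {x | x.1 < (1 + c.1) / 2}) :=
      (isOpen_lt continuous_const continuous_subtype_val).inter
        (isOpen_lt continuous_subtype_val continuous_const)
    refine ⟨κ, _, ?_, ?_, hk c (by linarith) (by linarith), o, ⟨?_, ?_⟩, ?_, ?_⟩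
    · change Set.projIcc 0 1 zero_le_one (max (2 * (0 : ℝ) - 1) (min (2 * 0) c.1)) = 0
      rw [mul_zero, min_eq_left c0.le, max_eq_right (by norm_num), Set.projIcc_left]
      rfl
    · change Set.projIcc 0 1 zero_le_one (max (2 * (1 : ℝ) - 1) (min (2 * 1) c.1)) = 1
      rw [min_eq_right (by linarith), max_eq_left (by linarith),
        show (2 : ℝ) * 1 - 1 = 1 by norm_num, Set.projIcc_right]
      rfl
    · change c.1 / 2 < c.1; linarith
    · change c.1 < (1 + c.1) / 2; linarith
    · refine ⟨fun h => absurd h.1 ?_, fun h => absurd h.2 ?_⟩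
      · change ¬ c.1 / 2 < 0; linarith
      · change ¬ (1 : ℝ) < (1 + c.1) / 2; linarith
    · intro x hx
      filter_upwards [o.mem_nhds hx] with x' hx'
      rw [hk x hx.1 hx.2, hk x' hx'.1 hx'.2]

/-- Under the homotopy a point never leaves its square and moves along a straight segment to `(κ x,
κ' y)`. The parameter runs from `1` to `0` here, so that segment is traversed backwards. -/
theorem seg_surfLerp (κ κ' : C(unitInterval, unitInterval)) (h0 h1 h0' h1') (γ : C(ℝ, Surf g))
    (t : ℝ) (s : Sq g) (x y : unitInterval) (h : γ t = Surf.mk s x y) :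
    seg ((surfLerp κ κ' h0 h1 h0' h1').comp
        ⟨fun p : ℝ × ℝ => (Set.projIcc 0 1 zero_le_one p.1, γ p.2), by fun_prop⟩) (1, t) (0, t) =
      seg (sqExt s) ((κ x).1, (κ' y).1) (x.1, y.1) := by
  refine seg_congr fun a b ha hb hab => ?_
  have ha1 : a ∈ Set.Icc (0 : ℝ) 1 := ⟨ha, by linarith⟩
  have e1 : a • ((1 : ℝ), t) + b • ((0 : ℝ), t) = (a, t) := by
    ext <;> simp
    rw [← add_mul, hab, one_mul]
  have e2 : a • ((κ x).1, (κ' y).1) + b • (x.1, y.1) =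
      ((lerpI κ ⟨a, ha1⟩ x).1, (lerpI κ' ⟨a, ha1⟩ y).1) := by
    have hb2 : b = 1 - a := by linarith
    subst hb2
    ext <;> simp [lerpI] <;> ring
  rw [e1, e2, sqExt_coe]
  change surfLerp κ κ' h0 h1 h0' h1' (Set.projIcc 0 1 zero_le_one a, γ t) = _
  rw [h, Set.projIcc_of_mem zero_le_one ha1]
  rfl

/-- Modulo a subgroup `F` for which there is a potential `p` for the sides of the squares, the class
of a path is a difference of a function at its end points. -/
theorem exists_potential (F : Submodule ℤ (Opc 1 ℤ (Surf g)))
    (p : Sq g → Opc 1 ℤ (Surf g) ⧸ F) (hr : ∀ s, p (rightPerm g s) = p s + F.mkQ (hEdge s))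
    (hu : ∀ s, p (upPerm g s) = p s + F.mkQ (vEdge s)) :
    ∃ D : Surf g → Opc 1 ℤ (Surf g) ⧸ F, ∀ γ : C(unitInterval, Surf g),
      F.mkQ (scl (pathSimplex γ)) = D (γ 0) - D (γ 1) := by
  -- `D` measures the straight path from a point to the lower left corner of its square, corrected
  -- by the potential of that corner. The hypotheses on `p` say precisely that the result does not
  -- depend on the square chosen for a point on a side.
  let D : Surf g → Opc 1 ℤ (Surf g) ⧸ F := Quot.lift
    (fun q => F.mkQ (seg (sqExt q.1) (q.2.1.1, q.2.2.1) (0, 0)) - p q.1) (by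
      rintro _ _ (⟨s, y⟩ | ⟨s, x⟩)
      · change F.mkQ (seg (sqExt s) (1, y.1) (0, 0)) - p s =
          F.mkQ (seg (sqExt (rightPerm g s)) (0, y.1) (0, 0)) - p (rightPerm g s)
        rw [hr, ← seg_right, ← seg_add _ _ (1, 0) _, seg_symm _ (1, 0), map_add, map_neg, hEdge]
        abel
      · change F.mkQ (seg (sqExt s) (x.1, 1) (0, 0)) - p s =
          F.mkQ (seg (sqExt (upPerm g s)) (x.1, 0) (0, 0)) - p (upPerm g s)
        rw [hu, ← seg_top, ← seg_add _ _ (0, 1) _, seg_symm _ (0, 1), map_add, map_neg, vEdge]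
        abel)
  have hD : ∀ s x y, D (Surf.mk s x y) = F.mkQ (seg (sqExt s) (x.1, y.1) (0, 0)) - p s :=
    fun _ _ _ => rfl
  refine ⟨D, fun γ₀ => ?_⟩
  set γ := pathExt γ₀
  -- A locally constant function on the line is constant, so it is enough to treat short pieces of
  -- the path. No subdivision of simplices is needed.
  have hlc : IsLocallyConstant fun t : ℝ => F.mkQ (seg γ 0 t) + D (γ t) := by
    rw [IsLocallyConstant.iff_eventually_eq]
    intro t₀
    obtain ⟨s₀, c, c', hP⟩ := Surf.exists_mk (γ t₀)
    obtain ⟨κ, O, h0, h1, hc, hO, hcO, hO01, hκ⟩ := exists_contraction c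
    obtain ⟨κ', O', h0', h1', hc', hO', hcO', hO01', hκ'⟩ := exists_contraction c'
    -- `V` is a neighbourhood of `γ t₀` that the final map of the homotopy collapses to `γ t₀`. It
    -- is well defined on the glued surface because `O` and `O'` contain both end points or neither,
    -- and open because `κ` and `κ'` are locally constant there.
    let V : Set (Surf g) := {P | Quot.lift (fun q : Sq g × unitInterval × unitInterval =>
      q.2.1 ∈ O ∧ q.2.2 ∈ O' ∧ Surf.mk q.1 (κ q.2.1) (κ' q.2.2) = γ t₀) (by
        rintro _ _ (⟨s, y⟩ | ⟨s, x⟩)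
        · simp only [h0, h1, Surf.mk_side, hO01]
        · simp only [h0', h1', Surf.mk_top, hO01']) P}
    have hVm : ∀ s x y, Surf.mk s x y ∈ V ↔
      x ∈ O ∧ y ∈ O' ∧ Surf.mk s (κ x) (κ' y) = γ t₀ := fun _ _ _ => Iff.rfl
    have hV : IsOpen V := by
      refine (isQuotientMap_quot_mk (r := Glue g)).isOpen_preimage.1 (isOpen_iff_mem_nhds.2 ?_)
      rintro ⟨s, x, y⟩ ⟨hx, hy, hxy⟩
      have c1 : Continuous fun q : Sq g × unitInterval × unitInterval => q.1 := by fun_prop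
      have c2 : Continuous fun q : Sq g × unitInterval × unitInterval => q.2.1 := by fun_prop
      have c3 : Continuous fun q : Sq g × unitInterval × unitInterval => q.2.2 := by fun_prop
      have b1 : ∀ᶠ t : Sq g in nhds s, t = s := (mem_nhds_discrete.2 rfl : {s} ∈ nhds s)
      have a1 := (c1.tendsto (s, x, y)).eventually b1
      have a2 := (c2.tendsto (s, x, y)).eventually ((hO.eventually_mem hx).and (hκ x hx))
      have a3 := (c3.tendsto (s, x, y)).eventually ((hO'.eventually_mem hy).and (hκ' y hy))
      filter_upwards [a1, a2, a3] with q q1 q2 q3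
      refine ⟨q2.1, q3.1, ?_⟩
      rw [q1, q2.2, q3.2]
      exact hxy
    have hmem : γ t₀ ∈ V := by
      rw [hP, hVm]
      exact ⟨hcO, hcO', by rw [hc, hc', hP]⟩
    obtain ⟨ε, hε, hball⟩ := Metric.isOpen_iff.1 (hV.preimage γ.continuous) t₀ hmem
    filter_upwards [Metric.ball_mem_nhds t₀ hε] with t ht
    obtain ⟨s, x, y, hs⟩ := Surf.exists_mk (γ t)
    have hst : γ t ∈ V := hball ht
    rw [hs, hVm] at hst
    -- Three sides of the rectangle with corners `(0, t₀)` and `(1, t)` are easy: the path `γ`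
    -- itself, the constant at `γ t₀` over `t₀`, and the collapsed path. Hence `γ` from `t₀` to `t`
    -- has the class of the fourth side, a straight segment in one square.
    let Φ : C(ℝ × ℝ, Surf g) := (surfLerp κ κ' h0 h1 h0' h1').comp
      ⟨fun p : ℝ × ℝ => (Set.projIcc 0 1 zero_le_one p.1, γ p.2), by fun_prop⟩
    have hΦ : ∀ u τ, Φ (u, τ) =
      surfLerp κ κ' h0 h1 h0' h1' (Set.projIcc 0 1 zero_le_one u, γ τ) := fun _ _ => rfl
    have e0 : seg γ t₀ t = seg Φ (0, t₀) (0, t) := by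
      refine seg_congr fun a b _ _ _ => ?_
      obtain ⟨s', x', y', h'⟩ := Surf.exists_mk (γ (a • t₀ + b • t))
      have e : a • ((0 : ℝ), t₀) + b • ((0 : ℝ), t) = (0, a • t₀ + b • t) := by ext <;> simp
      rw [e, hΦ, Set.projIcc_left, h']
      change Surf.mk s' x' y' = Surf.mk s' (lerpI κ 0 x') (lerpI κ' 0 y')
      rw [lerpI_zero, lerpI_zero]
    have e1 : seg Φ (0, t₀) (1, t₀) = 0 := by
      refine seg_const (x := γ t₀) fun a b _ _ hab => ?_
      have e : a • ((0 : ℝ), t₀) + b • ((1 : ℝ), t₀) = (b, t₀) := by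
        ext <;> simp
        rw [← add_mul, hab, one_mul]
      rw [e, hΦ, hP]
      change Surf.mk s₀ (lerpI κ _ c) (lerpI κ' _ c') = _
      rw [lerpI_fix hc, lerpI_fix hc']
    have e2 : seg Φ (1, t₀) (1, t) = 0 := by
      refine seg_const (x := γ t₀) fun a b ha hb hab => ?_
      have hV' : γ (a • t₀ + b • t) ∈ V :=
        hball (convex_ball t₀ ε (Metric.mem_ball_self hε) ht ha hb hab)
      obtain ⟨s', x', y', h'⟩ := Surf.exists_mk (γ (a • t₀ + b • t))
      have e : a • ((1 : ℝ), t₀) + b • ((1 : ℝ), t) = (1, a • t₀ + b • t) := by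
        ext <;> simp [hab]
      rw [h', hVm] at hV'
      rw [e, hΦ, h', Set.projIcc_right]
      change Surf.mk s' (lerpI κ 1 x') (lerpI κ' 1 y') = _
      rw [lerpI_one, lerpI_one, hV'.2.2]
    have e3 := seg_surfLerp κ κ' h0 h1 h0' h1' γ t s x y hs
    change seg Φ (1, t) (0, t) = _ at e3
    have e4 : seg γ t₀ t = seg (sqExt s) ((κ x).1, (κ' y).1) (x.1, y.1) := by
      rw [e0, ← seg_add Φ _ (1, t₀), ← seg_add Φ (1, t₀) (1, t), e1, e2, e3]
      abel
    rw [← seg_add γ 0 t₀ t, e4, hs, ← hst.2.2, hD, hD,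
      ← seg_add _ ((κ x).1, (κ' y).1) (x.1, y.1) (0, 0), map_add, map_add]
    abel
  have := hlc.apply_eq_of_preconnectedSpace 1 0
  simp only [seg_self, map_zero, zero_add] at this
  have g0 : γ 0 = γ₀ 0 := congrArg γ₀ (Set.projIcc_left (h := zero_le_one))
  have g1 : γ 1 = γ₀ 1 := congrArg γ₀ (Set.projIcc_right (h := zero_le_one))
  rw [scl_pathSimplex, ← g0, ← g1]
  exact eq_sub_of_add_eq this

/-- A `1`-cycle lies in every subgroup for which there is a potential. -/
theorem homOpc_mem_of_potential (F : Submodule ℤ (Opc 1 ℤ (Surf g)))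
    (p : Sq g → Opc 1 ℤ (Surf g) ⧸ F) (hr : ∀ s, p (rightPerm g s) = p s + F.mkQ (hEdge s))
    (hu : ∀ s, p (upPerm g s) = p s + F.mkQ (vEdge s)) (z : SHom 1 ℤ (Surf g)) :
    homOpc 1 ℤ _ z ∈ F := by
  obtain ⟨D, hD⟩ := exists_potential F p hr hu
  let D' : (SChain ℤ (Surf g)).X 0 →ₗ[ℤ] Opc 1 ℤ (Surf g) ⧸ F :=
    (chainDesc ℤ (A := ModuleCat.of ℤ _) fun σ =>
      ModuleCat.ofHom (LinearMap.toSpanSingleton ℤ _ (D (σ (stdSimplex.vertex 0))))).hom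
  have hD' : ∀ σ, D' ((simplexChain ℤ σ).hom 1) = D (σ (stdSimplex.vertex 0)) := by
    intro σ
    have := congrArg (fun f => f.hom 1) (simplexChain_desc ℤ (A := ModuleCat.of ℤ _)
      (fun σ : C(stdSimplex ℝ (Fin 1), Surf g) => ModuleCat.ofHom
        (LinearMap.toSpanSingleton ℤ _ (D (σ (stdSimplex.vertex 0))))) σ)
    exact this.trans (one_smul _ _)
  -- Modulo `F`, every one-chain is a function of its boundary, so cycles vanish.
  have key : F.mkQ.toAddMonoidHom =
      -(D'.toAddMonoidHom.comp (opcBoundary 0 (Surf g)).toAddMonoidHom) := by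
    refine opc_addHom_ext fun σ => ?_
    change F.mkQ (scl σ) = -D' (opcBoundary 0 (Surf g) (scl σ))
    let γ : C(unitInterval, Surf g) :=
      σ.comp (stdSimplexHomeomorphUnitInterval.symm : C(unitInterval, stdSimplex ℝ (Fin 2)))
    have hγ : σ = pathSimplex γ := by
      ext q
      change σ q = σ (stdSimplexHomeomorphUnitInterval.symm (stdSimplexHomeomorphUnitInterval q))
      rw [Homeomorph.symm_apply_apply]
    rw [hγ, hD γ, opcBoundary_simplexOpc, Fin.sum_univ_two, (pathSimplex_face γ).1,
      (pathSimplex_face γ).2, map_add, map_zsmul, map_zsmul, hD', hD']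
    simp [sub_eq_add_neg]
  have h0 : F.mkQ (homOpc 1 ℤ _ z) = -D' (opcBoundary 0 (Surf g) (homOpc 1 ℤ _ z)) :=
    congrArg (fun k : Opc 1 ℤ (Surf g) →+ _ => k (homOpc 1 ℤ _ z)) key
  rw [opcBoundary_homOpc, map_zero, neg_zero] at h0
  simpa using h0

end Spanning

/-! ### The combinatorics of the sides of the squares -/

section Sides

variable {g : ℕ}

theorem rightPerm_even {i : Fin g} (h : Even i.val) (j : Fin 3) :
    rightPerm g (i, j) = (i, j + 1) := by
  simp [rightPerm, Equiv.prodShear, h]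

theorem rightPerm_odd {i : Fin g} (h : ¬ Even i.val) (j : Fin 3) :
    rightPerm g (i, j) = (i, j - 1) := by
  simp [rightPerm, Equiv.prodShear, h]

theorem upPerm_one (i : Fin g) : upPerm g (i, 1) = (i, 1) := by
  simp [upPerm, upFun]

theorem upPerm_two {i : Fin g} (hi : i.val + 1 < g) :
    upPerm g (i, 2) = (⟨i.val + 1, hi⟩, 0) := by
  simp [upPerm, upFun, hi]

theorem upPerm_zero {i : Fin g} (hi : i.val + 1 < g) :
    upPerm g (⟨i.val + 1, hi⟩, 0) = (i, 2) := by
  simp [upPerm, upFun]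

theorem upPerm_two_last {i : Fin g} (hi : ¬ i.val + 1 < g) : upPerm g (i, 2) = (i, 2) := by
  simp [upPerm, upFun, hi]

theorem upPerm_zero_first {i : Fin g} (hi : i.val = 0) : upPerm g (i, 0) = (i, 0) := by
  simp [upPerm, upFun, hi]

variable {A : Type} [AddCommGroup A] {h v : Sq g → A}

/-- The square `(i, 1)` is glued to itself vertically, so its left side and that of its right
neighbour have the same class. That neighbour is `(i, 2)` in even rows and `(i, 0)` in odd rows; the
remaining square gives the corrected relation. -/
theorem side_two (hsq : ∀ s, v s + h (upPerm g s) = h s + v (rightPerm g s)) (i : Fin g) :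
    v (i, 2) = v (i, 1) + if Even i.val then 0 else h (i, 2) - h (upPerm g (i, 2)) := by
  split_ifs with hi
  · have := hsq (i, 1)
    rw [upPerm_one, rightPerm_even hi, add_comm] at this
    rw [add_zero]
    exact (add_left_cancel this).symm
  · have := hsq (i, 2)
    rw [rightPerm_odd hi] at this
    change _ = _ + v (i, 1) at this
    rw [eq_sub_of_add_eq this]
    abel

theorem side_zero (hsq : ∀ s, v s + h (upPerm g s) = h s + v (rightPerm g s)) (i : Fin g) :
    v (i, 0) = v (i, 1) + if Even i.val then h (i, 0) - h (upPerm g (i, 0)) else 0 := by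
  split_ifs with hi
  · have := hsq (i, 0)
    rw [rightPerm_even hi] at this
    change _ = _ + v (i, 1) at this
    rw [eq_sub_of_add_eq this]
    abel
  · have := hsq (i, 1)
    rw [upPerm_one, rightPerm_odd hi, add_comm] at this
    rw [add_zero]
    exact (add_left_cancel this).symm

/-- This is the source of the relation between `c_i`, `a_i` and `a_{i+1}`. For even `i` neither
summand has a correction; for odd `i` both have, and the corrections cancel. The directions of
adjacent rows must be opposite for this. -/
theorem side_column (hsq : ∀ s, v s + h (upPerm g s) = h s + v (rightPerm g s)) (i : Fin g)
    (hi : i.val + 1 < g) :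
    v (i, 2) + v (⟨i.val + 1, hi⟩, 0) = v (i, 1) + v (⟨i.val + 1, hi⟩, 1) := by
  rw [side_two hsq, side_zero hsq, upPerm_two hi, upPerm_zero hi]
  by_cases h : Even i.val
  · have : ¬ Even (i.val + 1) := by simpa [Nat.even_add_one] using h
    simp [h, this]
  · have : Even (i.val + 1) := by simpa [Nat.even_add_one] using h
    simp only [h, this, if_true, if_false]
    abel

/-- If the columns and rows of squares are trivial, there is a potential. -/
theorem exists_side_potential (hsq : ∀ s, v s + h (upPerm g s) = h s + v (rightPerm g s))
    (hv : ∀ i, v (i, 1) = 0) (hh : ∀ i, h (i, 0) + h (i, 1) + h (i, 2) = 0) :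
    ∃ p : Sq g → A, (∀ s, p (rightPerm g s) = p s + h s) ∧ ∀ s, p (upPerm g s) = p s + v s := by
  have hcol : ∀ (i : Fin g) (hi : i.val + 1 < g), v (⟨i.val + 1, hi⟩, 0) = -v (i, 2) := by
    intro i hi
    have := side_column hsq i hi
    rw [hv, hv, add_zero, add_comm] at this
    exact eq_neg_of_add_eq_zero_left this
  -- `t i` is the difference of the potential between `(i, 2)` and `(i, 0)`, adjacent in the cyclic
  -- row. Following the left side of `(i, 2)` upwards leads to `(i + 1, 0)`, whence the recursion
  -- for `q`, the potential of `(i, 0)`.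
  let t : Fin g → A := fun i => if Even i.val then -h (i, 2) else h (i, 0)
  let q : ℕ → A := fun n => ∑ m ∈ Finset.range n,
    if hm : m < g then t ⟨m, hm⟩ + v (⟨m, hm⟩, 2) else 0
  have hq : ∀ i : Fin g, q (i.val + 1) = q i.val + (t i + v (i, 2)) := by
    intro i
    simp only [q, Finset.sum_range_succ, i.2, dif_pos]
  let p : Sq g → A := fun s => q s.1.val +
    if s.2 = 0 then 0 else if s.2 = 2 then t s.1 else
      if Even s.1.val then h (s.1, 0) else -h (s.1, 1)
  have p0 : ∀ i, p (i, 0) = q i.val := fun i => by simp [p]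
  have p1 : ∀ i, p (i, 1) = q i.val + if Even i.val then h (i, 0) else -h (i, 1) :=
    fun i => by simp [p]
  have p2 : ∀ i, p (i, 2) = q i.val + t i := fun i => by simp [p]
  have h2 : ∀ i, h (i, 2) = -(h (i, 0) + h (i, 1)) := fun i => by
    rw [eq_neg_iff_add_eq_zero, ← hh i]; abel
  refine ⟨p, ?_, ?_⟩
  · rintro ⟨i, j⟩
    by_cases hi : Even i.val
    · rw [rightPerm_even hi]
      fin_cases j
      · change p (i, 1) = p (i, 0) + h (i, 0)
        rw [p0, p1, if_pos hi]
      · change p (i, 2) = p (i, 1) + h (i, 1)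
        simp only [p1, p2, t, if_pos hi, h2]
        abel
      · change p (i, 0) = p (i, 2) + h (i, 2)
        simp only [p0, p2, t, if_pos hi]
        abel
    · rw [rightPerm_odd hi]
      fin_cases j
      · change p (i, 2) = p (i, 0) + h (i, 0)
        simp only [p0, p2, t, if_neg hi]
      · change p (i, 0) = p (i, 1) + h (i, 1)
        simp only [p0, p1, if_neg hi]
        abel
      · change p (i, 1) = p (i, 2) + h (i, 2)
        simp only [p1, p2, t, if_neg hi, h2]
        abel
  · rintro ⟨i, j⟩
    fin_cases j
    · change p (upPerm g (i, 0)) = p (i, 0) + v (i, 0)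
      rcases i with ⟨_ | m, hm⟩
      · have := side_zero hsq ⟨0, hm⟩
        rw [upPerm_zero_first rfl, hv] at this
        rw [upPerm_zero_first rfl, this]
        simp
      · have e := upPerm_zero (i := ⟨m, by omega⟩) hm
        have c := hcol ⟨m, by omega⟩ hm
        change upPerm g (⟨m + 1, hm⟩, 0) = _ at e
        change v (⟨m + 1, hm⟩, 0) = _ at c
        have q' := hq ⟨m, by omega⟩
        change q (m + 1) = _ at q'
        rw [e, c, p0, p2]
        change _ = q (m + 1) + _
        rw [q']
        abel
    · change p (upPerm g (i, 1)) = p (i, 1) + v (i, 1)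
      rw [upPerm_one, hv, add_zero]
    · change p (upPerm g (i, 2)) = p (i, 2) + v (i, 2)
      by_cases hi : i.val + 1 < g
      · rw [upPerm_two hi, p0, p2]
        change q (i.val + 1) = _
        rw [hq]
        abel
      · have := side_two hsq i
        rw [upPerm_two_last hi, hv] at this
        rw [upPerm_two_last hi, this]
        simp

/-- The left side of the square `(i, 1)`, which is parallel to `a_i`. -/
def aCyc (i : Fin g) : Opc 1 ℤ (Surf g) := vEdge (i, 1)

/-- The lower side of the row `i`, which is parallel to `b_i`. -/
def bCyc (i : Fin g) : Opc 1 ℤ (Surf g) := hEdge (i, 0) + hEdge (i, 1) + hEdge (i, 2)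

theorem vEdge_column (i : Fin g) (hi : i.val + 1 < g) :
    vEdge (i, 2) + vEdge (⟨i.val + 1, hi⟩, 0) = aCyc i + aCyc ⟨i.val + 1, hi⟩ :=
  side_column edge_square i hi

/-- Modulo the span of the `a_i` and `b_i` the middle columns and the rows are trivial, so the sides
of the squares have a potential there. -/
theorem homOpc_mem_span (z : SHom 1 ℤ (Surf g)) :
    homOpc 1 ℤ _ z ∈ Submodule.span ℤ (Set.range (Sum.elim (aCyc (g := g)) bCyc)) := by
  set F := Submodule.span ℤ (Set.range (Sum.elim (aCyc (g := g)) bCyc))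
  have hmem : ∀ i, Sum.elim (aCyc (g := g)) bCyc i ∈ F := fun i =>
    Submodule.subset_span ⟨i, rfl⟩
  obtain ⟨p, hr, hu⟩ := exists_side_potential (g := g) (A := Opc 1 ℤ (Surf g) ⧸ F)
    (h := fun s => F.mkQ (hEdge s)) (v := fun s => F.mkQ (vEdge s))
    (fun s => by rw [← map_add, ← map_add, edge_square])
    (fun i => (Submodule.Quotient.mk_eq_zero F).2 (hmem (Sum.inl i)))
    (fun i => by
      rw [← map_add, ← map_add]
      exact (Submodule.Quotient.mk_eq_zero F).2 (hmem (Sum.inr i)))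
  exact homOpc_mem_of_potential F p hr hu z

theorem pathExt_apply {X : Type} [TopologicalSpace X] (γ : C(unitInterval, X)) {t : ℝ}
    (ht : t ∈ Set.Icc (0 : ℝ) 1) : pathExt γ t = γ ⟨t, ht⟩ :=
  congrArg γ (Set.projIcc_of_mem zero_le_one ht)

end Sides

/-! ### Surfaces glued from squares, with a preferred direction -/

/-- A space glued from squares, together with the choice of one of the two directions. -/
structure Strips (S X : Type) [TopologicalSpace X] where
  /-- the next square along the strip -/
  along : Equiv.Perm S
  /-- the next square across the strip -/
  across : Equiv.Perm S
  /-- the squares -/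
  sq : S → C(unitInterval × unitInterval, X)
  side : ∀ s y, sq s (1, y) = sq (along s) (0, y)
  exists_sq : ∀ P, ∃ s x y, P = sq s (x, y)
  exists_lift : ∀ f : S → unitInterval → unitInterval → X, (∀ s y, f s 1 y = f (along s) 0 y) →
    (∀ s x, f s x 1 = f (across s) x 0) → ∃ F : X → X, ∀ s x y, F (sq s (x, y)) = f s x y
  top : ∀ s x, sq s (x, 1) = sq (across s) (x, 0)
  continuous_prod : ∀ {Y : Type} [TopologicalSpace Y] [LocallyCompactSpace Y] (f : Y × X → X),
    (∀ s, Continuous fun p : Y × (unitInterval × unitInterval) => f (p.1, sq s p.2)) → Continuous f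

namespace Strips

variable {S X : Type} [TopologicalSpace X] (D : Strips S X)

/-- The strip through the square `s`, as a map from the plane. -/
def strip (s : S) : C(ℝ × ℝ, X) :=
  ⟨fun p => D.sq ((D.along ^ ⌊p.1⌋) s) (fractI p.1, Set.projIcc 0 1 zero_le_one p.2),
    (continuous_strip D.along (fun s x y => D.sq s (x, y)) (fun s => (D.sq s).continuous)
      D.side s).comp (f := fun p : ℝ × ℝ => (p.1, Set.projIcc 0 1 zero_le_one p.2)) (by fun_prop)⟩

theorem strip_apply (s : S) (x y : ℝ) : D.strip s (x, y) =
    D.sq ((D.along ^ ⌊x⌋) s) (fractI x, Set.projIcc 0 1 zero_le_one y) := rfl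

theorem strip_coe (s : S) (x y : unitInterval) : D.strip s (x.1, y.1) = D.sq s (x, y) := by
  rw [strip_apply, Set.projIcc_val]
  by_cases hx : x = 1
  · subst hx
    have h1 : ⌊((1 : unitInterval) : ℝ)⌋ = 1 := by simp
    have h2 : fractI ((1 : unitInterval) : ℝ) = 0 := Subtype.ext (by simp [fractI])
    rw [h1, h2, zpow_one, D.side]
  · have hx1 : x.1 < 1 := lt_of_le_of_ne x.2.2 fun h => hx (Subtype.ext h)
    have h1 : ⌊x.1⌋ = 0 := Int.floor_eq_zero_iff.2 ⟨x.2.1, hx1⟩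
    have h2 : fractI x.1 = x := Subtype.ext (Int.fract_eq_self.2 ⟨x.2.1, hx1⟩)
    rw [h1, h2, zpow_zero, Equiv.Perm.one_apply]

theorem strip_add (s : S) (x y : ℝ) (n : ℤ) :
    D.strip s (x + n, y) = D.strip ((D.along ^ n) s) (x, y) := by
  have h2 : fractI (x + n) = fractI x := Subtype.ext (Int.fract_add_intCast x n)
  rw [strip_apply, strip_apply, h2, Int.floor_add_intCast, zpow_add, Equiv.Perm.mul_apply]

theorem strip_add_period {s : S} {n : ℤ} (h : (D.along ^ n) s = s) (x y : ℝ) (k : ℤ) :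
    D.strip s (x + n * k, y) = D.strip s (x, y) := by
  have := D.strip_add s x y (n * k)
  push_cast at this
  rw [this, zpow_mul, Equiv.Perm.zpow_apply_eq_self_of_apply_eq_self h]

variable {D}

/-- The data of a twist along the strip through `s₀`, which consists of `n` squares. -/
structure Shear (D : Strips S X) (s₀ : S) (n : ℤ) where
  /-- the translation as a function of the coordinate across the strip, in multiples of `n` -/
  ρ : C(unitInterval, ℝ)
  zero : ∃ k : ℤ, ρ 0 = k
  one : ∃ k : ℤ, ρ 1 = k

variable {s₀ : S} {n : ℤ}

theorem zpow_period (hn : (D.along ^ n) s₀ = s₀) {s : S} (hs : D.along.SameCycle s₀ s) :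
    (D.along ^ n) s = s := by
  obtain ⟨j, rfl⟩ := hs
  rw [← Equiv.Perm.mul_apply, ← zpow_add, add_comm, zpow_add, Equiv.Perm.mul_apply, hn]

open Classical in
-- The translation at the two ends of `ρ` is by a multiple of the period, so the map is the identity
-- on the two boundary sides of the strip and matches the identity on the squares outside.
theorem exists_shear (hn : (D.along ^ n) s₀ = s₀) (r : D.Shear s₀ n) :
    ∃ F : X → X, ∀ s x y, F (D.sq s (x, y)) =
      if D.along.SameCycle s₀ s then D.strip s (x.1 + n * r.ρ y, y.1) else D.sq s (x, y) := by
  obtain ⟨k, hk⟩ := r.zero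
  obtain ⟨l, hl⟩ := r.one
  refine D.exists_lift (fun s x y => if D.along.SameCycle s₀ s then
    D.strip s (x.1 + n * r.ρ y, y.1) else D.sq s (x, y)) (fun s y => ?_) (fun s x => ?_)
  · simp only [Equiv.Perm.sameCycle_apply_right]
    split_ifs with hs
    · have := D.strip_add s (n * r.ρ y) y.1 1
      rw [zpow_one] at this
      simp only [Set.Icc.coe_one, Set.Icc.coe_zero, zero_add]
      rw [← this, add_comm]
      simp
    · exact D.side s y
  · have h1 : ∀ s, (if D.along.SameCycle s₀ s then D.strip s (x.1 + n * r.ρ 1,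
        ((1 : unitInterval) : ℝ)) else D.sq s (x, 1)) = D.sq s (x, 1) := by
      intro s
      split_ifs with hs
      · rw [hl, D.strip_add_period (zpow_period hn hs), strip_coe]
      · rfl
    have h0 : ∀ s, (if D.along.SameCycle s₀ s then D.strip s (x.1 + n * r.ρ 0,
        ((0 : unitInterval) : ℝ)) else D.sq s (x, 0)) = D.sq s (x, 0) := by
      intro s
      split_ifs with hs
      · rw [hk, D.strip_add_period (zpow_period hn hs), strip_coe]
      · rfl
    rw [h1, h0]
    exact D.top s x

/-- The map of a twist. -/
def shearFun (hn : (D.along ^ n) s₀ = s₀) (r : D.Shear s₀ n) : X → X := (exists_shear hn r).choose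

theorem shearFun_of_mem (hn : (D.along ^ n) s₀ = s₀) (r : D.Shear s₀ n) {s : S}
    (hs : D.along.SameCycle s₀ s) (x : ℝ) (y : unitInterval) :
    shearFun hn r (D.strip s (x, y.1)) = D.strip s (x + n * r.ρ y, y.1) := by
  rw [strip_apply, Set.projIcc_val]
  refine ((exists_shear hn r).choose_spec _ _ _).trans ?_
  rw [if_pos ((Equiv.Perm.sameCycle_zpow_right).2 hs), ← strip_add]
  congr 2
  change Int.fract x + n * r.ρ y + ⌊x⌋ = _
  rw [← Int.self_sub_floor]
  ring

theorem shearFun_of_notMem (hn : (D.along ^ n) s₀ = s₀) (r : D.Shear s₀ n) {s : S}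
    (hs : ¬ D.along.SameCycle s₀ s) (p : unitInterval × unitInterval) :
    shearFun hn r (D.sq s p) = D.sq s p :=
  ((exists_shear hn r).choose_spec s p.1 p.2).trans (if_neg hs)

theorem shear_ext {f f' : X → X}
    (h : ∀ s, D.along.SameCycle s₀ s → ∀ (x : ℝ) (y : unitInterval),
      f (D.strip s (x, y.1)) = f' (D.strip s (x, y.1)))
    (h' : ∀ s, ¬ D.along.SameCycle s₀ s → ∀ p, f (D.sq s p) = f' (D.sq s p)) : f = f' := by
  funext P
  obtain ⟨s, x, y, rfl⟩ := D.exists_sq P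
  by_cases hs : D.along.SameCycle s₀ s
  · rw [← strip_coe]
    exact h s hs _ _
  · exact h' s hs _

instance : Add (D.Shear s₀ n) where
  add r r' := ⟨r.ρ + r'.ρ, by
    obtain ⟨k, hk⟩ := r.zero
    obtain ⟨l, hl⟩ := r'.zero
    exact ⟨k + l, by simp [hk, hl]⟩, by
    obtain ⟨k, hk⟩ := r.one
    obtain ⟨l, hl⟩ := r'.one
    exact ⟨k + l, by simp [hk, hl]⟩⟩

instance : Neg (D.Shear s₀ n) where
  neg r := ⟨-r.ρ, by
    obtain ⟨k, hk⟩ := r.zero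
    exact ⟨-k, by simp [hk]⟩, by
    obtain ⟨k, hk⟩ := r.one
    exact ⟨-k, by simp [hk]⟩⟩

theorem add_ρ (r r' : D.Shear s₀ n) : (r + r').ρ = r.ρ + r'.ρ := rfl

theorem neg_ρ (r : D.Shear s₀ n) : (-r).ρ = -r.ρ := rfl

theorem shearFun_comp (hn : (D.along ^ n) s₀ = s₀) (r r' : D.Shear s₀ n) :
    shearFun hn r ∘ shearFun hn r' = shearFun hn (r' + r) := by
  refine shear_ext (D := D) (s₀ := s₀) (fun s hs x y => ?_) (fun s hs p => ?_)
  · rw [Function.comp_apply, shearFun_of_mem hn r' hs, shearFun_of_mem hn r hs,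
      shearFun_of_mem hn _ hs, add_ρ, ContinuousMap.add_apply]
    congr 2
    ring
  · rw [Function.comp_apply, shearFun_of_notMem hn _ hs, shearFun_of_notMem hn _ hs,
      shearFun_of_notMem hn _ hs]

/-- A twist does not change if the translation changes by integers. -/
theorem shearFun_congr (hn : (D.along ^ n) s₀ = s₀) (r r' : D.Shear s₀ n) (k : ℤ)
    (h : ∀ y, r.ρ y = r'.ρ y + k) : shearFun hn r = shearFun hn r' := by
  refine shear_ext (D := D) (s₀ := s₀) (fun s hs x y => ?_) (fun s hs p => ?_)
  · rw [shearFun_of_mem hn _ hs, shearFun_of_mem hn _ hs, h, mul_add, ← add_assoc,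
      D.strip_add_period (zpow_period hn hs)]
  · rw [shearFun_of_notMem hn _ hs, shearFun_of_notMem hn _ hs]

theorem shearFun_eq_id (hn : (D.along ^ n) s₀ = s₀) (r : D.Shear s₀ n)
    (h : ∀ y, r.ρ y = 0) : shearFun hn r = id := by
  refine shear_ext (D := D) (s₀ := s₀) (fun s hs x y => ?_) (fun s hs p => ?_)
  · rw [shearFun_of_mem hn _ hs, h, mul_zero, add_zero, id]
  · rw [shearFun_of_notMem hn _ hs, id]

/-- The parameter space allows the same statement to give both continuity of one twist and
continuity of an isotopy of twists. -/
theorem continuous_shearFun {Y : Type} [TopologicalSpace Y] [LocallyCompactSpace Y]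
    (hn : (D.along ^ n) s₀ = s₀) (r : Y → D.Shear s₀ n)
    (hr : Continuous fun p : Y × unitInterval => (r p.1).ρ p.2) :
    Continuous fun p : Y × X => shearFun hn (r p.1) p.2 := by
  refine D.continuous_prod _ fun s => ?_
  by_cases hs : D.along.SameCycle s₀ s
  · have : ∀ p : Y × (unitInterval × unitInterval), shearFun hn (r p.1) (D.sq s p.2) =
        D.strip s (p.2.1.1 + n * (r p.1).ρ p.2.2, p.2.2.1) := by
      rintro ⟨u, x, y⟩
      rw [← strip_coe, shearFun_of_mem hn _ hs]
    simp_rw [this]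
    have h2 : Continuous fun p : Y × (unitInterval × unitInterval) => (r p.1).ρ p.2.2 :=
      hr.comp (f := fun p : Y × (unitInterval × unitInterval) => (p.1, p.2.2)) (by fun_prop)
    exact (D.strip s).continuous.comp (by fun_prop)
  · have : ∀ p : Y × (unitInterval × unitInterval), shearFun hn (r p.1) (D.sq s p.2) =
        D.sq s p.2 := fun p => shearFun_of_notMem hn _ hs _
    simp_rw [this]
    fun_prop

/-- A twist, as a homeomorphism. -/
def shear (hn : (D.along ^ n) s₀ = s₀) (r : D.Shear s₀ n) : X ≃ₜ X where
  toFun := shearFun hn r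
  invFun := shearFun hn (-r)
  left_inv P := by
    have := (shearFun_comp hn (-r) r).trans (shearFun_eq_id hn _ fun y => by simp [add_ρ, neg_ρ])
    exact congrFun this P
  right_inv P := by
    have := (shearFun_comp hn r (-r)).trans (shearFun_eq_id hn _ fun y => by simp [add_ρ, neg_ρ])
    exact congrFun this P
  continuous_toFun := (continuous_shearFun (Y := Unit) hn (fun _ => r) (by fun_prop)).comp
    (f := fun x => ((), x)) (by fun_prop)
  continuous_invFun := (continuous_shearFun (Y := Unit) hn (fun _ => -r) (by fun_prop)).comp
    (f := fun x => ((), x)) (by fun_prop)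

/-- Scaling `ρ` by `u` keeps the values `0` at both ends, hence gives a family of twists. -/
theorem isotopicToId_shear (hn : (D.along ^ n) s₀ = s₀) (r : D.Shear s₀ n) (h0 : r.ρ 0 = 0)
    (h1 : r.ρ 1 = 0) : IsotopicToId (shear hn r) := by
  let R : unitInterval → D.Shear s₀ n := fun u =>
    ⟨⟨fun y => u.1 * r.ρ y, by fun_prop⟩, ⟨0, by simp [h0]⟩, ⟨0, by simp [h1]⟩⟩
  refine ⟨fun u => shear hn (R u), ?_, ?_, ?_⟩
  · refine continuous_shearFun hn R ?_
    change Continuous fun p : unitInterval × unitInterval => p.1.1 * r.ρ p.2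
    fun_prop
  · refine Homeomorph.ext fun P => congrFun (shearFun_eq_id hn _ fun y => ?_) P
    change (0 : ℝ) * _ = 0
    rw [zero_mul]
  · refine Homeomorph.ext fun P => congrFun (shearFun_congr hn _ r 0 fun y => ?_) P
    change (1 : ℝ) * _ = _
    simp

/-- A constant integer translation is a full period and has no effect, and the quotient of the two
twists has, after such a correction, a translation that vanishes at both ends. Thus a twist about an
annulus may be replaced by a linear one over the whole strip. -/
theorem homeoAct_shear_congr (hn : (D.along ^ n) s₀ = s₀) (r r' : D.Shear s₀ n) (k : ℤ)
    (h0 : r.ρ 0 = r'.ρ 0 + k) (h1 : r.ρ 1 = r'.ρ 1 + k) (m : ℕ) (R : Type) [CommRing R] :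
    homeoAct m R X (shear hn r) = homeoAct m R X (shear hn r') := by
  let c : D.Shear s₀ n := ⟨ContinuousMap.const _ (-k : ℝ), ⟨-k, by simp⟩, ⟨-k, by simp⟩⟩
  have e : shear hn r = shear hn (r + (-r' + c)) * shear hn r' := by
    refine Homeomorph.ext fun P => ?_
    have := (shearFun_comp hn (r + (-r' + c)) r').trans
      (shearFun_congr hn _ r (-k) fun y => by simp [add_ρ, neg_ρ, c]; ring)
    exact (congrFun this P).symm
  rw [e, map_mul, homeoAct_eq_one _ (isotopicToId_shear hn _ _ _), one_mul]
  · simp [add_ρ, neg_ρ, c, h0]; ring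
  · simp [add_ρ, neg_ρ, c, h1]; ring

/-! ### The action of a twist on homology -/

/-- The linear twist. -/
def linShear (D : Strips S X) (s₀ : S) (n : ℤ) : D.Shear s₀ n :=
  ⟨⟨fun y => 1 - y.1, by fun_prop⟩, ⟨1, by simp⟩, ⟨0, by simp⟩⟩

/-- The linear twist is the affine map `(x, y) ↦ (x + n (1 - y), y)`, and affine maps act on affine
simplices through their vertices. The heights must lie in the unit interval because `strip` clamps
them. -/
theorem shear_comp_strip_aff (hn : (D.along ^ n) s₀ = s₀) {s : S} (hs : D.along.SameCycle s₀ s)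
    {m : ℕ} (v w : Fin (m + 1) → ℝ × ℝ) (hv : ∀ i, (v i).2 ∈ Set.Icc (0 : ℝ) 1)
    (hw : ∀ i, w i = ((v i).1 + n * (1 - (v i).2), (v i).2)) :
    ((shear hn (linShear D s₀ n) : X ≃ₜ X) : C(X, X)).comp ((D.strip s).comp (aff v)) =
      (D.strip s).comp (aff w) := by
  refine ContinuousMap.ext fun p => ?_
  have hp := p.2.2
  have e1 : (aff v p).2 = ∑ i, p.1 i * (v i).2 := by simp [aff_apply, Prod.snd_sum]
  have e2 : (aff v p).1 = ∑ i, p.1 i * (v i).1 := by simp [aff_apply, Prod.fst_sum]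
  have hy : (aff v p).2 ∈ Set.Icc (0 : ℝ) 1 := by
    have : aff v p ∈ convexHull ℝ (Set.range v) := by
      rw [aff_apply]
      exact (convex_convexHull ℝ _).sum_mem (fun i _ => p.2.1 i) hp
        fun i _ => subset_convexHull _ _ ⟨i, rfl⟩
    have h2 : convexHull ℝ (Set.range v) ⊆ Prod.snd ⁻¹' Set.Icc (0 : ℝ) 1 :=
      convexHull_min (by rintro _ ⟨i, rfl⟩; exact hv i)
        ((convex_Icc (0 : ℝ) 1).is_linear_preimage ⟨fun _ _ => rfl, fun _ _ => rfl⟩)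
    exact h2 this
  change shearFun hn (linShear D s₀ n) (D.strip s (aff v p)) = D.strip s (aff w p)
  have := shearFun_of_mem hn (linShear D s₀ n) hs (aff v p).1 ⟨_, hy⟩
  refine this.trans (congrArg (D.strip s) ?_)
  have e3 : aff w p = (∑ i, p.1 i * ((v i).1 + n * (1 - (v i).2)), ∑ i, p.1 i * (v i).2) := by
    refine Prod.ext ?_ ?_
    · simp [aff_apply, Prod.fst_sum, hw]
    · simp [aff_apply, Prod.snd_sum, hw]
  rw [e3, ← e1]
  refine Prod.ext ?_ rfl
  change (aff v p).1 + n * (1 - (aff v p).2) = _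
  have e4 : ∑ i, p.1 i * ((v i).1 + n * (1 - (v i).2)) =
      ∑ i, p.1 i * (v i).1 + n * (∑ i, p.1 i - ∑ i, p.1 i * (v i).2) := by
    rw [mul_sub, Finset.mul_sum, Finset.mul_sum, ← Finset.sum_sub_distrib,
      ← Finset.sum_add_distrib]
    exact Finset.sum_congr rfl fun i _ => by ring
  rw [e1, e2, e4, hp]

theorem strip_aff_shift (D : Strips S X) (s : S) {m : ℕ} (v w : Fin (m + 1) → ℝ × ℝ)
    (h : ∀ i, v i = w i + (1, 0)) :
    (D.strip s).comp (aff v) = (D.strip (D.along s)).comp (aff w) := by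
  refine ContinuousMap.ext fun p => ?_
  have e : aff v p = ((aff w p).1 + ((1 : ℤ) : ℝ), (aff w p).2) := by
    have hp := p.2.2
    simp only [aff_apply, h, smul_add, Finset.sum_add_distrib, ← Finset.sum_smul]
    change _ + (∑ i, p.1 i) • ((1 : ℝ), (0 : ℝ)) = _
    rw [hp]
    refine Prod.ext ?_ ?_ <;> simp
  change D.strip s (aff v p) = _
  rw [e, strip_add, zpow_one]
  rfl

theorem sq_comp_lowerTri (D : Strips S X) (s : S) :
    (D.sq s).comp lowerTri = (D.strip s).comp (aff ![(0, 0), (1, 0), (1, 1)]) := by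
  refine ContinuousMap.ext fun p => ?_
  have e : aff ![((0 : ℝ), (0 : ℝ)), (1, 0), (1, 1)] p =
      ((lowerTri p).1.1, (lowerTri p).2.1) := by
    refine Prod.ext ?_ ?_ <;> simp [aff_apply, Fin.sum_univ_three, lowerTri]
  change _ = D.strip s (aff _ p)
  rw [e, strip_coe]
  rfl

theorem sq_comp_upperTri (D : Strips S X) (s : S) :
    (D.sq s).comp upperTri = (D.strip s).comp (aff ![(0, 0), (0, 1), (1, 1)]) := by
  refine ContinuousMap.ext fun p => ?_
  have e : aff ![((0 : ℝ), (0 : ℝ)), (0, 1), (1, 1)] p =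
      ((upperTri p).1.1, (upperTri p).2.1) := by
    refine Prod.ext ?_ ?_ <;>
      simp [aff_apply, Fin.sum_univ_three, lowerTri, upperTri]
  change _ = D.strip s (aff _ p)
  rw [e, strip_coe]
  rfl

/-- The two-chain of the square `s`, with the upper side moved to the left by `m` squares. -/
def slanted (D : Strips S X) (m : ℤ) (s : S) : Opc 2 ℤ X :=
  scl ((D.strip s).comp (aff ![(0, 0), (1, 0), (1 - m, 1)])) -
    scl ((D.strip s).comp (aff ![(0, 0), (-m, 1), (1 - m, 1)]))

/-- The flat tetrahedron on the corners of a parallelogram says that changing the diagonal does not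
change the class. After the change, one of the two triangles can be moved by one square along the
strip, and the sum over whole strips absorbs this shift. -/
theorem sum_slanted_succ (D : Strips S X) (m : ℤ) (O : Finset S)
    (hO : ∀ s, D.along s ∈ O ↔ s ∈ O) :
    ∑ s ∈ O, D.slanted m s = ∑ s ∈ O, D.slanted (m + 1) s := by
  let a (s : S) := scl ((D.strip s).comp (aff ![((1 : ℝ), (0 : ℝ)), (-m, 1), (1 - m, 1)]))
  have h3 : ∀ s, a s - scl ((D.strip s).comp (aff ![(0, 0), (-m, 1), (1 - m, 1)])) +
      scl ((D.strip s).comp (aff ![(0, 0), (1, 0), (1 - m, 1)])) -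
      scl ((D.strip s).comp (aff ![(0, 0), (1, 0), (-m, 1)])) = 0 := by
    intro s
    have h := scl_boundary_three
      ((D.strip s).comp (aff ![((0 : ℝ), (0 : ℝ)), (1, 0), (-m, 1), (1 - m, 1)]))
    have e : ∀ i, simplexFace ((D.strip s).comp (aff ![((0 : ℝ), (0 : ℝ)), (1, 0), (-m, 1),
      (1 - m, 1)])) i = (D.strip s).comp (aff (![((0 : ℝ), (0 : ℝ)), (1, 0), (-m, 1),
      (1 - m, 1)] ∘ i.succAbove)) := fun i => congrArg (D.strip s).comp (aff_face _ i)
    have f0 : ![((0 : ℝ), (0 : ℝ)), (1, 0), (-(m : ℝ), 1), (1 - (m : ℝ), 1)] ∘ Fin.succAbove 0 =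
      ![(1, 0), (-(m : ℝ), 1), (1 - (m : ℝ), 1)] := by ext i <;> fin_cases i <;> rfl
    have f1 : ![((0 : ℝ), (0 : ℝ)), (1, 0), (-(m : ℝ), 1), (1 - (m : ℝ), 1)] ∘ Fin.succAbove 1 =
      ![(0, 0), (-(m : ℝ), 1), (1 - (m : ℝ), 1)] := by ext i <;> fin_cases i <;> rfl
    have f2 : ![((0 : ℝ), (0 : ℝ)), (1, 0), (-(m : ℝ), 1), (1 - (m : ℝ), 1)] ∘ Fin.succAbove 2 =
      ![(0, 0), (1, 0), (1 - (m : ℝ), 1)] := by ext i <;> fin_cases i <;> rfl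
    have f3 : ![((0 : ℝ), (0 : ℝ)), (1, 0), (-(m : ℝ), 1), (1 - (m : ℝ), 1)] ∘ Fin.succAbove 3 =
      ![(0, 0), (1, 0), (-(m : ℝ), 1)] := by ext i <;> fin_cases i <;> rfl
    rw [e, e, e, e, f0, f1, f2, f3] at h
    exact h
  let b (s : S) := scl ((D.strip s).comp
    (aff ![((0 : ℝ), (0 : ℝ)), (-((m + 1 : ℤ) : ℝ), 1), (1 - ((m + 1 : ℤ) : ℝ), 1)]))
  have hab : ∀ s, a s = b (D.along s) := by
    intro s
    refine congrArg scl (D.strip_aff_shift s _ _ fun i => ?_)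
    fin_cases i
    · simp
    · simp
    · simp only [Fin.reduceFinMk, Matrix.cons_val, Int.cast_add, Int.cast_one, Prod.mk_add_mk,
        add_zero]
      congr 1
      ring
  have hsum : ∑ s ∈ O, a s = ∑ s ∈ O, b s := by
    simp_rw [hab]
    exact Finset.sum_equiv D.along (fun s => (hO s).symm) fun _ _ => rfl
  have e1 : ∀ s, D.slanted m s =
      scl ((D.strip s).comp (aff ![(0, 0), (1, 0), (-m, 1)])) - a s := by
    intro s
    rw [← sub_eq_zero, ← h3 s, slanted]
    abel
  have e2 : ∀ s, D.slanted (m + 1) s =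
      scl ((D.strip s).comp (aff ![(0, 0), (1, 0), (-m, 1)])) - b s := by
    intro s
    have : (1 : ℝ) - ((m + 1 : ℤ) : ℝ) = -m := by push_cast; ring
    simp only [slanted, b, this]
  simp_rw [e1, e2, Finset.sum_sub_distrib, hsum]

theorem sum_slanted (D : Strips S X) (m : ℕ) (O : Finset S) (hO : ∀ s, D.along s ∈ O ↔ s ∈ O) :
    ∑ s ∈ O, D.slanted m s = ∑ s ∈ O, D.slanted 0 s := by
  induction m with
  | zero => rfl
  | succ m ih => rw [← ih, sum_slanted_succ D m O hO]; push_cast; rfl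

/-- The linear twist turns the two triangles of a square into those of the parallelogram slanted by
`n`, up to a shift by the period; `sum_slanted` undoes the slant. Strips other than the twisted one
do not move. -/
theorem opcMap_linShear_fundamental [Fintype S] {n : ℕ} (hn : (D.along ^ (n : ℤ)) s₀ = s₀) :
    opcMap 2 ℤ ((shear hn (linShear D s₀ n) : X ≃ₜ X) : C(X, X))
      (∑ s, (scl ((D.sq s).comp lowerTri) - scl ((D.sq s).comp upperTri))) =
      ∑ s, (scl ((D.sq s).comp lowerTri) - scl ((D.sq s).comp upperTri)) := by
  classical
  have h0 : ∀ s, scl ((D.sq s).comp lowerTri) - scl ((D.sq s).comp upperTri) = D.slanted 0 s := by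
    intro s
    rw [sq_comp_lowerTri, sq_comp_upperTri, slanted]
    norm_num
  set T : C(X, X) := ((shear hn (linShear D s₀ n) : X ≃ₜ X) : C(X, X))
  have h1 : ∀ s, D.along.SameCycle s₀ s → opcMap 2 ℤ T (D.slanted 0 s) = D.slanted n s := by
    intro s hs
    have a1 : T.comp ((D.strip s).comp (aff ![(0, 0), (1, 0), (1 - ((0 : ℤ) : ℝ), 1)])) =
        (D.strip s).comp (aff ![((n : ℝ), 0), (1 + n, 0), (1, 1)]) := by
      refine shear_comp_strip_aff hn hs _ _ (fun i => ?_) (fun i => ?_) <;> fin_cases i <;> simp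
    have a2 : T.comp ((D.strip s).comp (aff ![(0, 0), (-((0 : ℤ) : ℝ), 1),
        (1 - ((0 : ℤ) : ℝ), 1)])) = (D.strip s).comp (aff ![((n : ℝ), 0), (0, 1), (1, 1)]) := by
      refine shear_comp_strip_aff hn hs _ _ (fun i => ?_) (fun i => ?_) <;> fin_cases i <;> simp
    have sh : ∀ (j : ℕ) (v w : Fin 3 → ℝ × ℝ), (∀ i, v i = w i + ((j : ℝ), 0)) →
        (D.strip s).comp (aff v) = (D.strip ((D.along ^ j) s)).comp (aff w) := by
      intro j
      induction j with
      | zero =>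
        intro v w h
        have : v = w := by ext i <;> simp [h]
        rw [this]; rfl
      | succ j ih =>
        intro v w h
        rw [ih v (fun i => w i + (1, 0)) fun i => by rw [h, add_assoc]; congr 1; ext <;> simp; ring,
          strip_aff_shift D _ _ w fun _ => rfl, pow_succ']
        rfl
    have hper : (D.along ^ n) s = s := zpow_period hn hs
    rw [slanted, map_sub, opcMap_simplexOpc, opcMap_simplexOpc, a1, a2, slanted,
      sh n _ ![((0 : ℝ), (0 : ℝ)), (1, 0), (1 - n, 1)] fun i => by fin_cases i <;> simp,
      sh n _ ![((0 : ℝ), (0 : ℝ)), (-n, 1), (1 - n, 1)] fun i => by fin_cases i <;> simp, hper]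
    simp
  have h2 : ∀ s, ¬ D.along.SameCycle s₀ s → opcMap 2 ℤ T (D.slanted 0 s) = D.slanted 0 s := by
    intro s hs
    have : ∀ v : Fin 3 → ℝ × ℝ, T.comp ((D.strip s).comp (aff v)) = (D.strip s).comp (aff v) := by
      intro v
      refine ContinuousMap.ext fun p => ?_
      exact shearFun_of_notMem hn _ (by rwa [Equiv.Perm.sameCycle_zpow_right]) _
    rw [slanted, map_sub, opcMap_simplexOpc, opcMap_simplexOpc, this, this]
  simp_rw [h0]
  let O : Finset S := Finset.univ.filter fun s => D.along.SameCycle s₀ s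
  rw [map_sum, ← Finset.sum_filter_add_sum_filter_not Finset.univ (D.along.SameCycle s₀),
    ← Finset.sum_filter_add_sum_filter_not Finset.univ (D.along.SameCycle s₀)
      (fun s => D.slanted 0 s)]
  congr 1
  · rw [Finset.sum_congr rfl fun s hs => h1 s (Finset.mem_filter.1 hs).2]
    exact sum_slanted D n _ fun s => by simp
  · exact Finset.sum_congr rfl fun s hs => h2 s (Finset.mem_filter.1 hs).2

/-- The lower side of a square. -/
def bot (D : Strips S X) (s : S) : Opc 1 ℤ X := seg (D.strip s) (0, 0) (1, 0)

/-- The left side of a square. -/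
def lft (D : Strips S X) (s : S) : Opc 1 ℤ X := seg (D.strip s) (0, 0) (0, 1)

theorem seg_shift (D : Strips S X) (s : S) (j : ℤ) (a b c d : ℝ) :
    seg (D.strip s) (a + j, b) (c + j, d) = seg (D.strip ((D.along ^ j) s)) (a, b) (c, d) := by
  refine seg_congr fun t t' _ _ h => ?_
  rw [show t • (a + (j : ℝ), b) + t' • (c + (j : ℝ), d) = ((t * a + t' * c) + j, t * b + t' * d) by
    ext
    · simp only [Prod.fst_add, Prod.smul_fst, smul_eq_mul]
      linear_combination (j : ℝ) * h
    · simp, strip_add]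
  congr 1

theorem seg_strip_sum (D : Strips S X) (s : S) (n : ℕ) :
    seg (D.strip s) (0, 0) (n, 0) = ∑ j ∈ Finset.range n, D.bot ((D.along ^ j) s) := by
  induction n with
  | zero => simp [seg_self]
  | succ n ih =>
    rw [Finset.sum_range_succ, ← ih, ← seg_add _ _ ((n : ℝ), 0)]
    congr 1
    have := D.seg_shift s n 0 0 1 0
    rw [zpow_natCast] at this
    rw [bot, ← this]
    congr 2 <;> push_cast <;> ring

/-- The rectangle between height `0` and height `y` has two vertical sides that coincide after `n`
squares and cancel, so the loop may be pushed to the lower sides of the strip. -/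
theorem scl_strip_loop {n : ℕ} (hn : (D.along ^ (n : ℤ)) s₀ = s₀) (γ : C(unitInterval, X)) (y : ℝ)
    (hγ : ∀ θ : unitInterval, γ θ = D.strip s₀ (n * θ, y)) :
    scl (pathSimplex γ) = ∑ j ∈ Finset.range n, D.bot ((D.along ^ j) s₀) := by
  have e : scl (pathSimplex γ) = seg (D.strip s₀) (0, y) (n, y) := by
    rw [scl_pathSimplex]
    refine seg_congr fun a b ha hb hab => ?_
    rw [pathExt_apply γ (t := a • (0 : ℝ) + b • 1) ⟨by simp [hb], by simp; linarith⟩, hγ]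
    congr 1
    ext
    · simp [mul_comm]
    · simp only [Prod.snd_add, Prod.smul_snd, smul_eq_mul]
      linear_combination -y * hab
  have sh := D.seg_shift s₀ n 0 0 0 y
  rw [hn, zero_add, Int.cast_natCast] at sh
  rw [e, ← seg_strip_sum, ← seg_add _ (0, y) (0, 0), ← seg_add _ (0, 0) ((n : ℝ), 0) ((n : ℝ), y),
    sh, seg_symm _ (0, y)]
  abel

/-- On the twisted strip the lower side is moved by a full period. -/
theorem opcMap_linShear_bot {n : ℕ} (hn : (D.along ^ (n : ℤ)) s₀ = s₀) (s : S) :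
    opcMap 1 ℤ ((shear hn (linShear D s₀ n) : X ≃ₜ X) : C(X, X)) (D.bot s) = D.bot s := by
  by_cases hs : D.along.SameCycle s₀ s
  · have h := shear_comp_strip_aff hn hs ![(0, 0), (1, 0)] ![((n : ℝ), 0), (1 + n, 0)]
      (fun i => by fin_cases i <;> simp) (fun i => by fin_cases i <;> simp)
    have := D.seg_shift s n 0 0 1 0
    rw [zpow_period hn hs, zero_add, Int.cast_natCast] at this
    rw [bot, seg, opcMap_simplexOpc, h]
    exact this
  · rw [bot, opcMap_seg]
    refine seg_congr fun a b _ _ _ => ?_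
    exact shearFun_of_notMem hn _ (by rwa [Equiv.Perm.sameCycle_zpow_right]) _

/-- The lower end of the left side is moved once around the strip while the upper end stays. The
image runs from `(n, 0)` to `(0, 1)`, that is, back along the strip and then up. -/
theorem opcMap_linShear_lft {n : ℕ} (hn : (D.along ^ (n : ℤ)) s₀ = s₀) {s : S}
    (hs : D.along.SameCycle s₀ s) :
    opcMap 1 ℤ ((shear hn (linShear D s₀ n) : X ≃ₜ X) : C(X, X)) (D.lft s) =
      D.lft s - ∑ j ∈ Finset.range n, D.bot ((D.along ^ j) s) := by
  have h := shear_comp_strip_aff hn hs ![(0, 0), (0, 1)] ![((n : ℝ), 0), (0, 1)]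
    (fun i => by fin_cases i <;> simp) (fun i => by fin_cases i <;> simp)
  rw [lft, seg, opcMap_simplexOpc, h, ← seg_strip_sum]
  change seg (D.strip s) (n, 0) (0, 1) = seg (D.strip s) (0, 0) (0, 1) - _
  rw [← seg_add _ ((n : ℝ), (0 : ℝ)) (0, 0), seg_symm _ ((n : ℝ), (0 : ℝ))]
  abel

theorem opcMap_linShear_lft' {n : ℕ} (hn : (D.along ^ (n : ℤ)) s₀ = s₀) {s : S}
    (hs : ¬ D.along.SameCycle s₀ s) :
    opcMap 1 ℤ ((shear hn (linShear D s₀ n) : X ≃ₜ X) : C(X, X)) (D.lft s) = D.lft s := by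
  rw [lft, opcMap_seg]
  refine seg_congr fun a b _ _ _ => ?_
  exact shearFun_of_notMem hn _ (by rwa [Equiv.Perm.sameCycle_zpow_right]) _

/-! ### Twists on annuli -/

/-- On the annulus the translation is `t` periods. In the part of the strip outside it the
translation is an integral number of periods, so nothing moves. -/
theorem isTwist_shear {A : EmbAnnulus X} {n : ℕ} (hn0 : 0 < n)
    (hn : (D.along ^ (n : ℤ)) s₀ = s₀) (r : D.Shear s₀ n) (m : unitInterval → unitInterval)
    (hA : ∀ θ t, A.map (θ, t) = D.strip s₀ (n * θ, (m t).1)) (hm : ∀ t, r.ρ (m t) = t.1)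
    (hm' : ∀ y, (¬ ∃ t, m t = y) → ∃ k : ℤ, r.ρ y = k) : A.IsTwist (shear hn r) := by
  refine ⟨fun θ t => ?_, fun P hP => ?_⟩
  · rw [hA, hA]
    refine (shearFun_of_mem hn r (Equiv.Perm.SameCycle.refl _ _) _ _).trans ?_
    rw [hm, mul_add]
    rfl
  · obtain ⟨s, x, y, rfl⟩ := D.exists_sq P
    by_cases hs : D.along.SameCycle s₀ s
    · by_cases hy : ∃ t, m t = y
      · obtain ⟨t, rfl⟩ := hy
        obtain ⟨j, rfl⟩ := hs
        refine absurd ⟨((x.1 + j) / n, t), ?_⟩ hP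
        have : (n : ℝ) ≠ 0 := by exact_mod_cast hn0.ne'
        rw [hA, mul_div_cancel₀ _ this, strip_add, strip_coe]
      · obtain ⟨k, hk⟩ := hm' y hy
        rw [← strip_coe]
        refine (shearFun_of_mem hn r hs _ _).trans ?_
        rw [hk, D.strip_add_period (zpow_period hn hs)]
    · exact shearFun_of_notMem hn r hs _

end Strips

/-- Hence `IsDehnTwist` singles out one mapping class once a twist has been constructed. -/
theorem EmbAnnulus.IsTwist.unique {X : Type} [TopologicalSpace X] {A : EmbAnnulus X}
    {T T' : X ≃ₜ X} (h : A.IsTwist T) (h' : A.IsTwist T') : T = T' := by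
  refine Homeomorph.ext fun P => ?_
  by_cases hP : P ∈ Set.range A.map
  · obtain ⟨⟨θ, t⟩, rfl⟩ := hP
    rw [h.1, h'.1]
  · rw [h.2 P hP, h'.2 P hP]

/-! ### The two directions of `S_g` -/

section Directions

variable {g : ℕ}

/-- The surface `S_g` with the horizontal direction. -/
def hStrips (g : ℕ) : Strips (Sq g) (Surf g) where
  along := rightPerm g
  across := upPerm g
  sq := squareMap
  side := Surf.mk_side
  top := Surf.mk_top
  exists_sq := Surf.exists_mk
  exists_lift f hs ht := ⟨Quot.lift (fun q => f q.1 q.2.1 q.2.2) (by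
    rintro _ _ (⟨s, y⟩ | ⟨s, x⟩)
    exacts [hs s y, ht s x]), fun _ _ _ => rfl⟩
  continuous_prod f h := Surf.continuous_prod (by
    have : Continuous fun p : Sq g × (_ × (unitInterval × unitInterval)) =>
        f (p.2.1, squareMap p.1 p.2.2) := continuous_prod_of_discrete_left.2 h
    exact this.comp (f := fun p : _ × (Sq g × (unitInterval × unitInterval)) =>
      (p.2.1, (p.1, p.2.2))) (by fun_prop))

/-- The surface `S_g` with the vertical direction. -/
def vStrips (g : ℕ) : Strips (Sq g) (Surf g) where
  along := upPerm g
  across := rightPerm g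
  sq s := (squareMap s).comp ContinuousMap.prodSwap
  side := Surf.mk_top
  top := Surf.mk_side
  exists_sq P := by
    obtain ⟨s, x, y, rfl⟩ := Surf.exists_mk P
    exact ⟨s, y, x, rfl⟩
  exists_lift f hs ht := ⟨Quot.lift (fun q => f q.1 q.2.2 q.2.1) (by
    rintro _ _ (⟨s, y⟩ | ⟨s, x⟩)
    exacts [ht s y, hs s x]), fun _ _ _ => rfl⟩
  continuous_prod f h := (hStrips g).continuous_prod f fun s =>
    (h s).comp (f := fun p : _ × (unitInterval × unitInterval) => (p.1, p.2.swap)) (by fun_prop)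

theorem Strips.seg_strip {S X : Type} [TopologicalSpace X] (D : Strips S X) (s : S)
    {v w : ℝ × ℝ} (hv : v ∈ Set.Icc (0 : ℝ) 1 ×ˢ Set.Icc (0 : ℝ) 1)
    (hw : w ∈ Set.Icc (0 : ℝ) 1 ×ˢ Set.Icc (0 : ℝ) 1) :
    seg (D.strip s) v w = seg ((D.sq s).comp projSq) v w := by
  refine seg_congr fun a b ha hb hab => ?_
  have h := ((convex_Icc (0 : ℝ) 1).prod (convex_Icc 0 1)) hv hw ha hb hab
  have := D.strip_coe s ⟨_, h.1⟩ ⟨_, h.2⟩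
  refine this.trans (congrArg (D.sq s) (Prod.ext ?_ ?_))
  · exact (Set.projIcc_of_mem zero_le_one h.1).symm
  · exact (Set.projIcc_of_mem zero_le_one h.2).symm

theorem hStrips_bot (s : Sq g) : (hStrips g).bot s = hEdge s :=
  (hStrips g).seg_strip s (by simp) (by simp)

theorem hStrips_lft (s : Sq g) : (hStrips g).lft s = vEdge s :=
  (hStrips g).seg_strip s (by simp) (by simp)

theorem seg_swap (s : Sq g) (a b c d : ℝ) :
    seg (((vStrips g).sq s).comp projSq) (a, b) (c, d) = seg (sqExt s) (b, a) (d, c) :=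
  seg_congr fun _ _ _ _ _ => rfl

theorem vStrips_bot (s : Sq g) : (vStrips g).bot s = vEdge s :=
  ((vStrips g).seg_strip s (by simp) (by simp)).trans (seg_swap s _ _ _ _)

theorem vStrips_lft (s : Sq g) : (vStrips g).lft s = hEdge s :=
  ((vStrips g).seg_strip s (by simp) (by simp)).trans (seg_swap s _ _ _ _)

theorem homOpc_fundamentalClass : homOpc 2 ℤ _ (fundamentalClass g) =
    ∑ s, (scl (((hStrips g).sq s).comp lowerTri) - scl (((hStrips g).sq s).comp upperTri)) := by
  refine (homOpc_cycleClass _ _).trans ?_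
  rw [fundamentalChain, Preadditive.sum_comp]
  simp only [Preadditive.sub_comp, ModuleCat.hom_sum, LinearMap.sum_apply]
  rfl

/-- Swapping the coordinates exchanges the two triangles of each square. The sign is harmless, since
only invariance of the class is wanted. -/
theorem homOpc_fundamentalClass_neg : homOpc 2 ℤ _ (fundamentalClass g) =
    -∑ s, (scl (((vStrips g).sq s).comp lowerTri) - scl (((vStrips g).sq s).comp upperTri)) := by
  rw [homOpc_fundamentalClass, ← Finset.sum_neg_distrib]
  refine Finset.sum_congr rfl fun s _ => ?_
  rw [neg_sub]
  rfl

theorem hLin_fundamentalClass {s₀ : Sq g} {n : ℕ}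
    (hn : ((hStrips g).along ^ (n : ℤ)) s₀ = s₀) :
    homeoAct 2 ℤ (Surf g) (Strips.shear hn (Strips.linShear _ s₀ n)) (fundamentalClass g) =
      fundamentalClass g := by
  apply homOpc_injective
  rw [homOpc_homeoAct, homOpc_fundamentalClass, Strips.opcMap_linShear_fundamental]

theorem vLin_fundamentalClass {s₀ : Sq g} {n : ℕ}
    (hn : ((vStrips g).along ^ (n : ℤ)) s₀ = s₀) :
    homeoAct 2 ℤ (Surf g) (Strips.shear hn (Strips.linShear _ s₀ n)) (fundamentalClass g) =
      fundamentalClass g := by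
  apply homOpc_injective
  rw [homOpc_homeoAct, homOpc_fundamentalClass_neg, map_neg, Strips.opcMap_linShear_fundamental]

theorem homOpc_coreA (i : Fin g) :
    homOpc 1 ℤ _ (loopClass ℤ (annA i).core (annA i).core_closed) = aCyc i := by
  have hn : ((vStrips g).along ^ ((1 : ℕ) : ℤ)) (i, 1) = (i, 1) := upPerm_one i
  rw [homOpc_loopClass]
  refine (Strips.scl_strip_loop hn (annA i).core (midI halfI).1 fun θ => ?_).trans ?_
  · rw [Strips.strip_apply, Set.projIcc_val]
    rfl
  · rw [Finset.sum_range_one, vStrips_bot]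
    rfl

theorem sum_hEdge_row (i : Fin g) (j : Fin 3) :
    ∑ k ∈ Finset.range 3, (hStrips g).bot (((hStrips g).along ^ k) (i, j)) = bCyc i := by
  simp_rw [hStrips_bot]
  change ∑ k ∈ Finset.range 3, hEdge ((rightPerm g ^ k) (i, j)) = _
  rw [Finset.sum_range_succ, Finset.sum_range_succ, Finset.sum_range_one, pow_two, pow_one,
    pow_zero, Equiv.Perm.mul_apply, Equiv.Perm.one_apply, bCyc]
  by_cases h : Even i.val
  · simp only [rightPerm_even h]
    fin_cases j
    · rfl
    · change hEdge (i, 1) + hEdge (i, 2) + hEdge (i, 0) = _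
      abel
    · change hEdge (i, 2) + hEdge (i, 0) + hEdge (i, 1) = _
      abel
  · simp only [rightPerm_odd h]
    fin_cases j
    · change hEdge (i, 0) + hEdge (i, 2) + hEdge (i, 1) = _
      abel
    · change hEdge (i, 1) + hEdge (i, 0) + hEdge (i, 2) = _
      abel
    · change hEdge (i, 2) + hEdge (i, 1) + hEdge (i, 0) = _
      abel

theorem hStrips_period (i : Fin g) :
    ((hStrips g).along ^ ((3 : ℕ) : ℤ)) (i, 0) = (i, 0) := rightPerm_cube g i

theorem homOpc_coreB (i : Fin g) :
    homOpc 1 ℤ _ (loopClass ℤ (annB i).core (annB i).core_closed) = bCyc i := by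
  rw [homOpc_loopClass]
  refine (Strips.scl_strip_loop (hStrips_period i) (annB i).core
    (midI (unitInterval.symm halfI)).1 fun θ => ?_).trans (sum_hEdge_row i 0)
  rw [Strips.strip_apply, Set.projIcc_val]
  rfl

/-! ### The twists about the curves -/

theorem eq_midI_of_mem {y : unitInterval} (h1 : 1 / 3 ≤ y.1) (h2 : y.1 ≤ 2 / 3) :
    midI ⟨3 * y.1 - 1, by linarith, by linarith⟩ = y :=
  Subtype.ext (by change (1 + (3 * y.1 - 1)) / 3 = _; ring)

/-- The translation function of the twist about a vertical annulus. -/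
def vShear {s₀ : Sq g} {n : ℤ} : (vStrips g).Shear s₀ n :=
  ⟨⟨fun x => (Set.projIcc (0 : ℝ) 1 zero_le_one (3 * x.1 - 1)).1, by fun_prop⟩,
    ⟨0, by simp [Set.projIcc]⟩, ⟨1, by simp [Set.projIcc]; norm_num⟩⟩

/-- The translation function of the twist about a horizontal annulus. -/
def hShear {s₀ : Sq g} {n : ℤ} : (hStrips g).Shear s₀ n :=
  ⟨⟨fun y => (Set.projIcc (0 : ℝ) 1 zero_le_one (2 - 3 * y.1)).1, by fun_prop⟩,
    ⟨1, by simp [Set.projIcc]⟩, ⟨0, by simp [Set.projIcc]; norm_num⟩⟩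

theorem isTwist_annB (i : Fin g) :
    (annB i).IsTwist (Strips.shear (hStrips_period i) hShear) := by
  refine Strips.isTwist_shear (by norm_num) (hStrips_period i) hShear
    (fun t => midI (unitInterval.symm t)) (fun θ t => ?_) (fun t => ?_) (fun y hy => ?_)
  · rw [Strips.strip_apply, Set.projIcc_val]
    rfl
  · change (Set.projIcc (0 : ℝ) 1 zero_le_one (2 - 3 * ((1 + (1 - t.1)) / 3))).1 = t.1
    rw [show 2 - 3 * ((1 + (1 - t.1)) / 3) = t.1 by ring, Set.projIcc_val]
  · by_cases h1 : 1 / 3 ≤ y.1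
    · by_cases h2 : y.1 ≤ 2 / 3
      · refine absurd ⟨unitInterval.symm ⟨3 * y.1 - 1, by linarith, by linarith⟩, ?_⟩ hy
        rw [unitInterval.symm_symm, eq_midI_of_mem h1 h2]
      · refine ⟨0, ?_⟩
        change (Set.projIcc (0 : ℝ) 1 zero_le_one (2 - 3 * y.1)).1 = _
        rw [Set.projIcc_of_le_left _ (by linarith)]
        simp
    · refine ⟨1, ?_⟩
      change (Set.projIcc (0 : ℝ) 1 zero_le_one (2 - 3 * y.1)).1 = _
      rw [Set.projIcc_of_right_le _ (by linarith)]
      simp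

theorem isTwist_annV {s : Sq g} {n : ℕ} {hn : 0 < n} (h0 : (upPerm g ^ (n : ℤ)) s = s) {h1} :
    (annV s n hn h0 h1).IsTwist (Strips.shear (D := vStrips g) h0 vShear) := by
  refine Strips.isTwist_shear hn (D := vStrips g) h0 vShear midI (fun θ t => ?_) (fun t => ?_)
    (fun y hy => ?_)
  · rw [Strips.strip_apply, Set.projIcc_val]
    rfl
  · change (Set.projIcc (0 : ℝ) 1 zero_le_one (3 * ((1 + t.1) / 3) - 1)).1 = t.1
    rw [show 3 * ((1 + t.1) / 3) - 1 = t.1 by ring, Set.projIcc_val]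
  · by_cases h1 : 1 / 3 ≤ y.1
    · by_cases h2 : y.1 ≤ 2 / 3
      · exact absurd ⟨⟨3 * y.1 - 1, by linarith, by linarith⟩, eq_midI_of_mem h1 h2⟩ hy
      · refine ⟨1, ?_⟩
        change (Set.projIcc (0 : ℝ) 1 zero_le_one (3 * y.1 - 1)).1 = _
        rw [Set.projIcc_of_right_le _ (by linarith)]
        simp
    · refine ⟨0, ?_⟩
      change (Set.projIcc (0 : ℝ) 1 zero_le_one (3 * y.1 - 1)).1 = _
      rw [Set.projIcc_of_le_left _ (by linarith)]
      simp

theorem homeoAct_hShear {s₀ : Sq g} {n : ℕ} (hn : ((hStrips g).along ^ (n : ℤ)) s₀ = s₀) (m : ℕ)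
    (R : Type) [CommRing R] : homeoAct m R (Surf g) (Strips.shear hn hShear) =
      homeoAct m R (Surf g) (Strips.shear hn (Strips.linShear _ s₀ n)) := by
  refine Strips.homeoAct_shear_congr hn _ _ 0 ?_ ?_ m R
  · change (Set.projIcc (0 : ℝ) 1 zero_le_one (2 - 3 * (0 : ℝ))).1 = 1 - (0 : ℝ) + _
    rw [Set.projIcc_of_right_le _ (by norm_num)]
    simp
  · change (Set.projIcc (0 : ℝ) 1 zero_le_one (2 - 3 * (1 : ℝ))).1 = 1 - (1 : ℝ) + _
    rw [Set.projIcc_of_le_left _ (by norm_num)]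
    simp

/-- Here the translation grows from `0` to `1`, while that of the linear twist falls from `1` to
`0`. Up to a full period the former is the negative of the latter. -/
theorem homeoAct_vShear {s₀ : Sq g} {n : ℕ} (hn : ((vStrips g).along ^ (n : ℤ)) s₀ = s₀) (m : ℕ)
    (R : Type) [CommRing R] : homeoAct m R (Surf g) (Strips.shear hn vShear) =
      homeoAct m R (Surf g) (Strips.shear hn (Strips.linShear _ s₀ n))⁻¹ := by
  refine Strips.homeoAct_shear_congr hn _ (-(Strips.linShear _ s₀ n)) 1 ?_ ?_ m R
  · change (Set.projIcc (0 : ℝ) 1 zero_le_one (3 * (0 : ℝ) - 1)).1 = -(1 - (0 : ℝ)) + _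
    rw [Set.projIcc_of_le_left _ (by norm_num)]
    simp
  · change (Set.projIcc (0 : ℝ) 1 zero_le_one (3 * (1 : ℝ) - 1)).1 = -(1 - (1 : ℝ)) + _
    rw [Set.projIcc_of_right_le _ (by norm_num)]
    simp

/-- The twist about a horizontal annulus, as an orientation preserving homeomorphism. -/
def twistH {s₀ : Sq g} {n : ℕ} (hn : ((hStrips g).along ^ (n : ℤ)) s₀ = s₀) :
    homeoPlus (fundamentalClass g) :=
  ⟨Strips.shear hn hShear, by
    change homeoAct 2 ℤ (Surf g) _ _ = _
    rw [homeoAct_hShear, hLin_fundamentalClass]⟩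

/-- The twist about a vertical annulus, as an orientation preserving homeomorphism. -/
def twistV {s₀ : Sq g} {n : ℕ} (hn : ((vStrips g).along ^ (n : ℤ)) s₀ = s₀) :
    homeoPlus (fundamentalClass g) :=
  ⟨Strips.shear hn vShear, by
    change homeoAct 2 ℤ (Surf g) _ _ = _
    rw [homeoAct_vShear]
    have h := hn
    exact (homeoPlus (fundamentalClass g)).inv_mem (x := Strips.shear hn (Strips.linShear _ s₀ n))
      (vLin_fundamentalClass hn)⟩

theorem isDehnTwist_iff {A : EmbAnnulus (Surf g)} {T : homeoPlus (fundamentalClass g)}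
    (hT : A.IsTwist T.1) (f : ModS g) : IsDehnTwist A f ↔ f = (T : ModS g) := by
  constructor
  · rintro ⟨T', h, rfl⟩
    rw [Subtype.ext (h.unique hT)]
  · rintro rfl
    exact ⟨T, hT, rfl⟩

theorem vStrips_period_one (i : Fin g) :
    ((vStrips g).along ^ ((1 : ℕ) : ℤ)) (i, 1) = (i, 1) := upPerm_one i

theorem vStrips_period_two (i : Fin g) (hi : i.val + 1 < g) :
    ((vStrips g).along ^ ((2 : ℕ) : ℤ)) (i, 2) = (i, 2) := by
  change upPerm g (upPerm g (i, 2)) = (i, 2)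
  rw [upPerm_two hi, upPerm_zero hi]

theorem isDehnTwist_annB (i : Fin g) (f : ModS g) :
    IsDehnTwist (annB i) f ↔ f = (twistH (hStrips_period i) : ModS g) :=
  isDehnTwist_iff (T := twistH (hStrips_period i)) (isTwist_annB i) f

theorem isDehnTwist_annA (i : Fin g) (f : ModS g) :
    IsDehnTwist (annA i) f ↔ f = (twistV (vStrips_period_one i) : ModS g) :=
  isDehnTwist_iff (T := twistV (vStrips_period_one i)) (isTwist_annV (vStrips_period_one i)) f

theorem isDehnTwist_annC (i : Fin g) (hi : i.val + 1 < g) (f : ModS g) :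
    IsDehnTwist (annC i hi) f ↔ f = (twistV (vStrips_period_two i hi) : ModS g) := by
  have h : (annC i hi).IsTwist (twistV (vStrips_period_two i hi)).1 := by
    unfold annC
    exact isTwist_annV (vStrips_period_two i hi)
  exact isDehnTwist_iff h f

theorem mcgAct_coe (T : homeoPlus (fundamentalClass g)) (m : ℕ) (R : Type) [CommRing R] :
    mcgAct (fundamentalClass g) m R (T : ModS g) = homeoAct m R (Surf g) T.1 := rfl

theorem homOpc_twistH {s₀ : Sq g} {n : ℕ} (hn : ((hStrips g).along ^ (n : ℤ)) s₀ = s₀)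
    (z : SHom 1 ℤ (Surf g)) :
    homOpc 1 ℤ _ (mcgAct (fundamentalClass g) 1 ℤ (twistH hn : ModS g) z) =
      opcMap 1 ℤ ((Strips.shear hn (Strips.linShear _ s₀ n) : Surf g ≃ₜ Surf g) :
        C(Surf g, Surf g)) (homOpc 1 ℤ _ z) := by
  rw [mcgAct_coe, ← homOpc_homeoAct, ← homeoAct_hShear]
  rfl

/-- A vertical twist acts as the inverse of the linear twist, so its value `w` on `z` is verified by
applying the linear twist to `w`. -/
theorem homOpc_twistV {s₀ : Sq g} {n : ℕ} (hn : ((vStrips g).along ^ (n : ℤ)) s₀ = s₀)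
    (z w : SHom 1 ℤ (Surf g))
    (h : opcMap 1 ℤ ((Strips.shear hn (Strips.linShear _ s₀ n) : Surf g ≃ₜ Surf g) :
        C(Surf g, Surf g)) (homOpc 1 ℤ _ w) = homOpc 1 ℤ _ z) :
    mcgAct (fundamentalClass g) 1 ℤ (twistV hn : ModS g) z = w := by
  have e : mcgAct (fundamentalClass g) 1 ℤ (twistV hn : ModS g) =
    homeoAct 1 ℤ (Surf g) (Strips.shear hn (Strips.linShear _ s₀ n))⁻¹ := homeoAct_vShear hn 1 ℤ
  rw [← homOpc_homeoAct] at h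
  rw [e, ← homOpc_injective _ _ _ h, ← Module.End.mul_apply, ← map_mul, inv_mul_cancel, map_one,
    Module.End.one_apply]

theorem classA_eq (i : Fin g) : homOpc 1 ℤ _ (classA ℤ i) = (-1 : ℤ) ^ i.val • aCyc i := by
  rw [classA, map_zsmul, homOpc_coreA]

theorem classB_eq (i : Fin g) : homOpc 1 ℤ _ (classB ℤ i) = (-1 : ℤ) ^ i.val • bCyc i := by
  rw [classB, map_zsmul, homOpc_coreB]

theorem twistB_classB (i j : Fin g) :
    mcgAct (fundamentalClass g) 1 ℤ (twistH (hStrips_period i) : ModS g) (classB ℤ j) =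
      classB ℤ j := by
  apply homOpc_injective
  rw [homOpc_twistH, classB_eq, map_zsmul, bCyc]
  simp only [← hStrips_bot, map_add, Strips.opcMap_linShear_bot]

theorem sameCycle_row {i : Fin g} {s : Sq g} :
    (hStrips g).along.SameCycle (i, 0) s ↔ s.1 = i := by
  have h : ∀ s : Sq g, ((rightPerm g) s).1 = s.1 := fun s => rfl
  constructor
  · rintro ⟨n, rfl⟩
    change ((rightPerm g ^ n) (i, 0)).1 = i
    induction n with
    | zero => rfl
    | succ n ih => rwa [add_comm, zpow_one_add, Equiv.Perm.mul_apply, h]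
    | pred n ih =>
      have := h ((rightPerm g ^ (-(n : ℤ) - 1)) (i, 0))
      rw [← Equiv.Perm.mul_apply, ← zpow_one_add, add_sub_cancel, ih] at this
      exact this.symm
  · rintro rfl
    obtain ⟨i, j⟩ := s
    by_cases hi : Even i.val
    · fin_cases j
      · exact Equiv.Perm.SameCycle.refl _ _
      · exact ⟨1, rightPerm_even hi 0⟩
      · refine ⟨2, ?_⟩
        change rightPerm g (rightPerm g (i, 0)) = _
        rw [rightPerm_even hi, rightPerm_even hi]
        rfl
    · fin_cases j
      · exact Equiv.Perm.SameCycle.refl _ _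
      · refine ⟨2, ?_⟩
        change rightPerm g (rightPerm g (i, 0)) = _
        rw [rightPerm_odd hi, rightPerm_odd hi]
        rfl
      · exact ⟨1, rightPerm_odd hi 0⟩

theorem twistB_classA (i j : Fin g) :
    mcgAct (fundamentalClass g) 1 ℤ (twistH (hStrips_period i) : ModS g) (classA ℤ j) =
      classA ℤ j - if j = i then classB ℤ i else 0 := by
  apply homOpc_injective
  rw [homOpc_twistH, map_sub, classA_eq, map_zsmul, aCyc, ← hStrips_lft]
  split_ifs with h
  · subst h
    rw [Strips.opcMap_linShear_lft _ ((sameCycle_row (i := j) (s := (j, 1))).2 rfl), sum_hEdge_row, classB_eq, zsmul_sub]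
  · rw [Strips.opcMap_linShear_lft' _ (fun h' => h ((sameCycle_row (i := i) (s := (j, 1))).1 h')), map_zero, sub_zero]

theorem sameCycle_up {s₀ s : Sq g} (hs : (vStrips g).along.SameCycle s₀ s) :
    s = s₀ ∨ s = upPerm g s₀ := by
  obtain ⟨n, rfl⟩ := hs
  change (upPerm g ^ n) s₀ = s₀ ∨ (upPerm g ^ n) s₀ = upPerm g s₀
  have h2 : upPerm g (upPerm g s₀) = s₀ := upFun_involutive g s₀
  have h2' : (upPerm g ^ (2 : ℤ)) s₀ = s₀ := h2
  obtain ⟨k, rfl | rfl⟩ := Int.even_or_odd' n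
  · left
    rw [zpow_mul, Equiv.Perm.zpow_apply_eq_self_of_apply_eq_self h2']
  · right
    rw [add_comm, zpow_add, zpow_one, Equiv.Perm.mul_apply, zpow_mul,
      Equiv.Perm.zpow_apply_eq_self_of_apply_eq_self h2']

theorem twistV_classA {s₀ : Sq g} {n : ℕ} (hn : ((vStrips g).along ^ (n : ℤ)) s₀ = s₀)
    (j : Fin g) :
    mcgAct (fundamentalClass g) 1 ℤ (twistV hn : ModS g) (classA ℤ j) = classA ℤ j := by
  refine homOpc_twistV hn _ _ ?_
  rw [classA_eq, map_zsmul, aCyc, ← vStrips_bot, Strips.opcMap_linShear_bot]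

theorem linV_hEdge {s₀ : Sq g} {n : ℕ} (hn : ((vStrips g).along ^ (n : ℤ)) s₀ = s₀) (s : Sq g) :
    opcMap 1 ℤ ((Strips.shear hn (Strips.linShear _ s₀ n) : Surf g ≃ₜ Surf g) :
      C(Surf g, Surf g)) (hEdge s) = hEdge s - if s = s₀ ∨ s = upPerm g s₀ then
        ∑ j ∈ Finset.range n, vEdge ((upPerm g ^ j) s) else 0 := by
  rw [← vStrips_lft]
  split_ifs with h
  · have hs : (vStrips g).along.SameCycle s₀ s := by
      rcases h with rfl | rfl
      · exact Equiv.Perm.SameCycle.refl _ _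
      · exact ⟨1, rfl⟩
    rw [Strips.opcMap_linShear_lft hn hs]
    simp_rw [vStrips_bot]
    rfl
  · rw [Strips.opcMap_linShear_lft' hn fun hs => h (sameCycle_up hs), sub_zero]

theorem linA_bCyc (i j : Fin g) :
    opcMap 1 ℤ ((Strips.shear (vStrips_period_one i) (Strips.linShear _ _ ((1 : ℕ) : ℤ)) :
      Surf g ≃ₜ Surf g) : C(Surf g, Surf g)) (bCyc j) =
      bCyc j - if j = i then aCyc i else 0 := by
  rw [bCyc, map_add, map_add, linV_hEdge, linV_hEdge, linV_hEdge, upPerm_one]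
  by_cases h : j = i
  · subst h
    simp [aCyc]
    abel
  · simp [h]

/-- The column of `c_i` meets exactly the rows `i` and `i + 1`, in one square each, and its class is
computed by `vEdge_column`. -/
theorem linC_bCyc (i j : Fin g) (hi : i.val + 1 < g) :
    opcMap 1 ℤ ((Strips.shear (vStrips_period_two i hi) (Strips.linShear _ _ ((2 : ℕ) : ℤ)) :
      Surf g ≃ₜ Surf g) : C(Surf g, Surf g)) (bCyc j) =
      bCyc j - if j = i ∨ j = ⟨i.val + 1, hi⟩ then aCyc i + aCyc ⟨i.val + 1, hi⟩ else 0 := by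
  have hne : (⟨i.val + 1, hi⟩ : Fin g) ≠ i := fun h => by
    have := congrArg Fin.val h
    simp at this
  rw [bCyc, map_add, map_add, linV_hEdge, linV_hEdge, linV_hEdge, upPerm_two hi]
  rw [← vEdge_column]
  by_cases h : j = i
  · subst h
    simp [Finset.sum_range_succ, upPerm_two hi, Ne.symm hne]
    abel
  · by_cases h' : j = ⟨i.val + 1, hi⟩
    · subst h'
      simp [Finset.sum_range_succ, upPerm_zero hi, hne]
      abel
    · simp [h, h']

theorem twistA_classB (i j : Fin g) :
    mcgAct (fundamentalClass g) 1 ℤ (twistV (vStrips_period_one i) : ModS g) (classB ℤ j) =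
      classB ℤ j + if j = i then classA ℤ i else 0 := by
  refine homOpc_twistV _ _ _ ?_
  rw [map_add, map_add, classB_eq, map_zsmul, linA_bCyc]
  split_ifs with h
  · subst h
    rw [classA_eq, map_zsmul, aCyc, ← vStrips_bot, Strips.opcMap_linShear_bot, zsmul_sub,
      sub_add_cancel]
  · simp

/-- In the parametrized orientations the column is the sum of `aCyc i` and its successor. The signs
`(-1) ^ i` in `classA` make this a difference, and the sign of `classB` makes the two rows
contribute oppositely. -/
theorem twistC_classB (i j : Fin g) (hi : i.val + 1 < g) :
    mcgAct (fundamentalClass g) 1 ℤ (twistV (vStrips_period_two i hi) : ModS g) (classB ℤ j) =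
      classB ℤ j + if j = i then classA ℤ i - classA ℤ ⟨i.val + 1, hi⟩ else
        if j = ⟨i.val + 1, hi⟩ then -(classA ℤ i - classA ℤ ⟨i.val + 1, hi⟩) else 0 := by
  have hne : (⟨i.val + 1, hi⟩ : Fin g) ≠ i := fun h => by
    have := congrArg Fin.val h
    simp at this
  have hA : ∀ l : Fin g, opcMap 1 ℤ ((Strips.shear (vStrips_period_two i hi)
      (Strips.linShear _ _ ((2 : ℕ) : ℤ)) : Surf g ≃ₜ Surf g) : C(Surf g, Surf g))
      (homOpc 1 ℤ _ (classA ℤ l)) = (-1 : ℤ) ^ l.val • aCyc l := by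
    intro l
    rw [classA_eq, map_zsmul, aCyc, ← vStrips_bot, Strips.opcMap_linShear_bot]
  refine homOpc_twistV (vStrips_period_two i hi) _ _ ?_
  rw [map_add, map_add, classB_eq, map_zsmul, linC_bCyc i j hi]
  by_cases h : j = i
  · subst h
    rw [if_pos rfl, map_sub, map_sub, hA, hA, if_pos (Or.inl rfl)]
    simp only [pow_succ, zsmul_sub, zsmul_add, mul_neg, mul_one, neg_zsmul]
    abel_nf
  · by_cases h' : j = ⟨i.val + 1, hi⟩
    · subst h'
      rw [if_neg hne, if_pos rfl, map_neg, map_neg, map_sub, map_sub, hA, hA,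
        if_pos (Or.inr rfl)]
      simp only [pow_succ, zsmul_sub, zsmul_add, mul_neg, mul_one, neg_zsmul]
      abel_nf
    · simp [h, h']

end Directions

/-! ### Winding numbers -/

section Winding

variable {X : Type} [TopologicalSpace X]

theorem exists_simplex_lift {n : ℕ} (F : C(stdSimplex ℝ (Fin (n + 1)), AddCircle (1 : ℝ))) :
    ∃ L : C(stdSimplex ℝ (Fin (n + 1)), ℝ), ∀ p, (L p : AddCircle (1 : ℝ)) = F p := by
  have hne : (stdSimplex ℝ (Fin (n + 1))).Nonempty := ⟨_, (stdSimplex.vertex (S := ℝ) 0).2⟩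
  have h1 := (convex_stdSimplex ℝ (Fin (n + 1))).contractibleSpace hne
  have h2 := (convex_stdSimplex ℝ (Fin (n + 1))).locallyPathConnectedSpace
  obtain ⟨x, hx⟩ := QuotientAddGroup.mk_surjective (F (stdSimplex.vertex 0))
  obtain ⟨L, ⟨-, hL⟩, -⟩ := (AddCircle.isCoveringMap_coe (1 : ℝ)).existsUnique_continuousMap_lifts F
    (stdSimplex.vertex 0) x hx
  exact ⟨L, fun p => congrFun hL p⟩

theorem simplex_lift_unique {n : ℕ} {L L' : C(stdSimplex ℝ (Fin (n + 1)), ℝ)}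
    (h : ∀ p, (L p : AddCircle (1 : ℝ)) = L' p) : ∃ k : ℤ, ∀ p, L p = L' p + k := by
  have hne : (stdSimplex ℝ (Fin (n + 1))).Nonempty := ⟨_, (stdSimplex.vertex (S := ℝ) 0).2⟩
  have h1 := (convex_stdSimplex ℝ (Fin (n + 1))).contractibleSpace hne
  have h0 : ∀ p, ((L p - L' p : ℝ) : AddCircle (1 : ℝ)) = 0 := fun p => by
    rw [AddCircle.coe_sub, h, sub_self]
  have hc := (AddCircle.isCoveringMap_coe (1 : ℝ)).const_of_comp
    (g := fun p => L p - L' p) (by fun_prop) fun a a' => (h0 a).trans (h0 a').symm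
  obtain ⟨k, hk⟩ := (AddCircle.coe_eq_zero_iff (1 : ℝ)).1 (h0 (stdSimplex.vertex 0))
  refine ⟨k, fun p => ?_⟩
  have := hc p (stdSimplex.vertex 0)
  rw [← hk] at this
  simp only [zsmul_eq_mul, mul_one] at this
  linarith

/-- The winding number of a path, with respect to a map to the circle: the number of integers
that a lift to the real line passes. -/
def wind (F : C(X, AddCircle (1 : ℝ))) (σ : C(stdSimplex ℝ (Fin 2), X)) : ℤ :=
  ⌊(exists_simplex_lift (F.comp σ)).choose (stdSimplex.vertex 1)⌋ -
    ⌊(exists_simplex_lift (F.comp σ)).choose (stdSimplex.vertex 0)⌋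

/-- Two lifts differ by a constant integer, which cancels in the difference of the floors. -/
theorem wind_eq {F : C(X, AddCircle (1 : ℝ))} {σ : C(stdSimplex ℝ (Fin 2), X)}
    {L : C(stdSimplex ℝ (Fin 2), ℝ)} (hL : ∀ p, (L p : AddCircle (1 : ℝ)) = F (σ p)) :
    wind F σ = ⌊L (stdSimplex.vertex 1)⌋ - ⌊L (stdSimplex.vertex 0)⌋ := by
  obtain ⟨k, hk⟩ := simplex_lift_unique (L := (exists_simplex_lift (F.comp σ)).choose) (L' := L)
    fun p => ((exists_simplex_lift (F.comp σ)).choose_spec p).trans (hL p).symm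
  rw [wind, hk, hk, Int.floor_add_intCast, Int.floor_add_intCast]
  ring

theorem simplexFace_vertex {n : ℕ} (σ : C(stdSimplex ℝ (Fin (n + 2)), X)) (i : Fin (n + 2))
    (j : Fin (n + 1)) :
    simplexFace σ i (stdSimplex.vertex j) = σ (stdSimplex.vertex (i.succAbove j)) := by
  change σ (stdSimplex.map _ _) = _
  rw [stdSimplex.map_vertex]

/-- A lift over the whole triangle restricts to lifts over its sides, and the floors at the vertices
telescope. The floors are what makes the cocycle integral on paths that are not closed. -/
theorem wind_boundary (F : C(X, AddCircle (1 : ℝ))) (σ : C(stdSimplex ℝ (Fin 3), X)) :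
    ∑ i : Fin 3, (-1 : ℤ) ^ i.val • wind F (simplexFace σ i) = 0 := by
  obtain ⟨L, hL⟩ := exists_simplex_lift (F.comp σ)
  have h : ∀ i, wind F (simplexFace σ i) =
      ⌊L (stdSimplex.vertex (i.succAbove 1))⌋ - ⌊L (stdSimplex.vertex (i.succAbove 0))⌋ := by
    intro i
    rw [wind_eq (σ := simplexFace σ i) (L := simplexFace L i) fun p => hL _, simplexFace_vertex, simplexFace_vertex]
  have h0 : (0 : Fin 3).succAbove 1 = 2 := rfl
  have h1 : (0 : Fin 3).succAbove 0 = 1 := rfl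
  have h2 : (1 : Fin 3).succAbove 1 = 2 := rfl
  have h3 : (1 : Fin 3).succAbove 0 = 0 := rfl
  have h4 : (2 : Fin 3).succAbove 1 = 1 := rfl
  have h5 : (2 : Fin 3).succAbove 0 = 0 := rfl
  rw [Fin.sum_univ_three, h, h, h, h0, h1, h2, h3, h4, h5]
  simp

/-- The winding number as a linear map on chains modulo boundaries. -/
def windOpc (R : Type) [CommRing R] (F : C(X, AddCircle (1 : ℝ))) : Opc 1 R X →ₗ[ℤ] R :=
  opcDesc R (fun σ => wind F σ • LinearMap.id) fun σ r => by
    have := congrArg (fun m : ℤ => m • r) (wind_boundary F σ)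
    simpa [Finset.sum_smul, mul_smul] using this

theorem windOpc_simplexOpc (R : Type) [CommRing R] (F : C(X, AddCircle (1 : ℝ)))
    (σ : C(stdSimplex ℝ (Fin 2), X)) (r : R) :
    windOpc R F (simplexOpc R σ r) = wind F σ • r :=
  opcDesc_simplexOpc R _ _ σ r

theorem windOpc_seg {E : Type} [AddCommGroup E] [Module ℝ E] [TopologicalSpace E]
    [ContinuousAdd E] [ContinuousSMul ℝ E] (F : C(X, AddCircle (1 : ℝ))) (Φ : C(E, X))
    (L : C(E, ℝ)) (hL : ∀ e, (L e : AddCircle (1 : ℝ)) = F (Φ e)) (v w : E) :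
    windOpc ℤ F (seg Φ v w) = ⌊L w⌋ - ⌊L v⌋ := by
  rw [seg, windOpc_simplexOpc, wind_eq (L := L.comp (aff ![v, w])) fun p => hL _]
  have h1 : aff ![v, w] (stdSimplex.vertex 1) = w := by
    rw [aff_apply, Fin.sum_univ_two]
    simp
  have h0 : aff ![v, w] (stdSimplex.vertex 0) = v := by
    rw [aff_apply, Fin.sum_univ_two]
    simp
  simp [h0, h1]

end Winding

/-! ### Winding numbers as coordinates on the homology of the surface -/

section Coordinates

variable {g : ℕ}

/-- The map to the circle that measures crossings with `b_i`. -/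
def circB (i : Fin g) : C(Surf g, AddCircle (1 : ℝ)) where
  toFun := Quot.lift (fun q => if q.1.1 = i then ((q.2.2 : ℝ) : AddCircle (1 : ℝ)) else 0) (by
    rintro _ _ (⟨s, y⟩ | ⟨s, x⟩)
    · rfl
    · have h1 : (((1 : unitInterval) : ℝ) : AddCircle (1 : ℝ)) = 0 := AddCircle.coe_period 1
      have h0 : (((0 : unitInterval) : ℝ) : AddCircle (1 : ℝ)) = 0 := rfl
      simp only [h0, h1, ite_self])
  continuous_toFun := by
    refine continuous_quot_lift _ (continuous_prod_of_discrete_left.2 fun s => ?_)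
    by_cases h : s.1 = i
    · simp only [h, if_true]
      exact (AddCircle.continuous_mk' 1).comp (by fun_prop)
    · simp only [h, if_false]
      exact continuous_const

/-- The map to the circle that measures crossings with `a_i`. -/
def circA (i : Fin g) : C(Surf g, AddCircle (1 : ℝ)) where
  toFun := Quot.lift (fun q => if q.1 = (i, 1) then ((q.2.1 : ℝ) : AddCircle (1 : ℝ)) else 0) (by
    rintro _ _ (⟨s, y⟩ | ⟨s, x⟩)
    · have h1 : (((1 : unitInterval) : ℝ) : AddCircle (1 : ℝ)) = 0 := AddCircle.coe_period 1
      have h0 : (((0 : unitInterval) : ℝ) : AddCircle (1 : ℝ)) = 0 := rfl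
      simp only [h0, h1, ite_self]
    · have : upPerm g s = (i, 1) ↔ s = (i, 1) := by
        rw [← upPerm_one, (upPerm g).apply_eq_iff_eq, upPerm_one]
      simp only [this])
  continuous_toFun := by
    refine continuous_quot_lift _ (continuous_prod_of_discrete_left.2 fun s => ?_)
    by_cases h : s = (i, 1)
    · simp only [h, if_true]
      exact (AddCircle.continuous_mk' 1).comp (by fun_prop)
    · simp only [h, if_false]
      exact continuous_const

theorem windOpc_circB (i : Fin g) (s : Sq g) (v w : ℝ × ℝ) :
    windOpc ℤ (circB i) (seg (sqExt s) v w) =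
      if s.1 = i then ⌊(Set.projIcc (0 : ℝ) 1 zero_le_one w.2).1⌋ -
        ⌊(Set.projIcc (0 : ℝ) 1 zero_le_one v.2).1⌋ else 0 := by
  split_ifs with h
  · refine windOpc_seg _ _ ⟨fun e : ℝ × ℝ => (Set.projIcc (0 : ℝ) 1 zero_le_one e.2).1,
      by fun_prop⟩ (fun e => ?_) v w
    exact (if_pos h).symm
  · refine (windOpc_seg _ _ (0 : C(ℝ × ℝ, ℝ)) (fun e => ?_) v w).trans (by simp)
    exact (if_neg h).symm

theorem windOpc_circA (i : Fin g) (s : Sq g) (v w : ℝ × ℝ) :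
    windOpc ℤ (circA i) (seg (sqExt s) v w) =
      if s = (i, 1) then ⌊(Set.projIcc (0 : ℝ) 1 zero_le_one w.1).1⌋ -
        ⌊(Set.projIcc (0 : ℝ) 1 zero_le_one v.1).1⌋ else 0 := by
  split_ifs with h
  · refine windOpc_seg _ _ ⟨fun e : ℝ × ℝ => (Set.projIcc (0 : ℝ) 1 zero_le_one e.1).1,
      by fun_prop⟩ (fun e => ?_) v w
    exact (if_pos h).symm
  · refine (windOpc_seg _ _ (0 : C(ℝ × ℝ, ℝ)) (fun e => ?_) v w).trans (by simp)
    exact (if_neg h).symm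

theorem circB_vEdge (i : Fin g) (s : Sq g) :
    windOpc ℤ (circB i) (vEdge s) = if s.1 = i then 1 else 0 := by
  rw [vEdge, windOpc_circB]
  simp

theorem circB_hEdge (i : Fin g) (s : Sq g) : windOpc ℤ (circB i) (hEdge s) = 0 := by
  rw [hEdge, windOpc_circB]
  simp

theorem circA_hEdge (i : Fin g) (s : Sq g) :
    windOpc ℤ (circA i) (hEdge s) = if s = (i, 1) then 1 else 0 := by
  rw [hEdge, windOpc_circA]
  simp

theorem circA_vEdge (i : Fin g) (s : Sq g) : windOpc ℤ (circA i) (vEdge s) = 0 := by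
  rw [vEdge, windOpc_circA]
  simp

end Coordinates

/-! ### Cup products -/

section Cup

variable {X : Type} [TopologicalSpace X]

theorem simplexFace_simplexFace {n : ℕ} (σ : C(stdSimplex ℝ (Fin (n + 3)), X)) {i i' : Fin (n + 3)}
    {j j' : Fin (n + 2)} (h : i.succAbove ∘ j.succAbove = i'.succAbove ∘ j'.succAbove) :
    simplexFace (simplexFace σ i) j = simplexFace (simplexFace σ i') j' := by
  refine ContinuousMap.ext fun p => ?_
  change σ (stdSimplex.map _ (stdSimplex.map _ p)) = σ (stdSimplex.map _ (stdSimplex.map _ p))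
  rw [stdSimplex.map_comp_apply, stdSimplex.map_comp_apply, h]

theorem cocycle_face (α : Opc 1 ℤ X →ₗ[ℤ] ℤ) (σ : C(stdSimplex ℝ (Fin 3), X)) :
    α (scl (simplexFace σ 1)) = α (scl (simplexFace σ 0)) + α (scl (simplexFace σ 2)) := by
  have := congrArg α (scl_boundary_two σ)
  rw [map_add, map_sub, map_zero] at this
  linarith

/-- The cup product of two cocycles. -/
def cup (α β : Opc 1 ℤ X →ₗ[ℤ] ℤ) : Opc 2 ℤ X →ₗ[ℤ] ℤ :=
  opcDesc ℤ (fun σ => (α (scl (simplexFace σ 2)) * β (scl (simplexFace σ 0))) • LinearMap.id)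
    fun τ r => by
      have e1 : simplexFace (simplexFace τ 0) 0 = simplexFace (simplexFace τ 1) 0 :=
        simplexFace_simplexFace τ (by decide)
      have e2 : simplexFace (simplexFace τ 2) 2 = simplexFace (simplexFace τ 3) 2 :=
        simplexFace_simplexFace τ (by decide)
      have e3 : simplexFace (simplexFace τ 1) 2 = simplexFace (simplexFace τ 3) 1 :=
        simplexFace_simplexFace τ (by decide)
      have e4 : simplexFace (simplexFace τ 2) 0 = simplexFace (simplexFace τ 0) 1 :=
        simplexFace_simplexFace τ (by decide)
      have e5 : simplexFace (simplexFace τ 3) 0 = simplexFace (simplexFace τ 0) 2 :=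
        simplexFace_simplexFace τ (by decide)
      have a := cocycle_face α (simplexFace τ 3)
      have b := cocycle_face β (simplexFace τ 0)
      rw [Fin.sum_univ_four, ← e1, e2, e3, e4, a, b, e5]
      simp [pow_succ]
      ring

theorem cup_scl (α β : Opc 1 ℤ X →ₗ[ℤ] ℤ) (σ : C(stdSimplex ℝ (Fin 3), X)) :
    cup α β (scl σ) = α (scl (simplexFace σ 2)) * β (scl (simplexFace σ 0)) := by
  refine (opcDesc_simplexOpc ℤ _ _ σ 1).trans ?_
  simp

theorem cup_opcMap (f : C(X, X)) (α β : Opc 1 ℤ X →ₗ[ℤ] ℤ) :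
    cup (α ∘ₗ opcMap 1 ℤ f) (β ∘ₗ opcMap 1 ℤ f) = cup α β ∘ₗ opcMap 2 ℤ f := by
  refine opc_ext_int fun σ => ?_
  rw [LinearMap.comp_apply, opcMap_simplexOpc, cup_scl, cup_scl, LinearMap.comp_apply,
    LinearMap.comp_apply, opcMap_simplexOpc, opcMap_simplexOpc]
  rfl

/-- Homology is the kernel of the boundary map on chains modulo boundaries. -/
theorem exists_homOpc {n : ℕ} {x : Opc (n + 1) ℤ X} (h : opcBoundary n X x = 0) :
    ∃ z, homOpc (n + 1) ℤ X z = x := by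
  let m : ModuleCat.of ℤ ℤ ⟶ (SChain ℤ X).opcycles (n + 1) :=
    ModuleCat.ofHom (LinearMap.toSpanSingleton ℤ _ x)
  have hm1 : m.hom (1 : ℤ) = x := LinearMap.toSpanSingleton_apply_one ℤ _ x
  have hm : m ≫ (SChain ℤ X).fromOpcycles (n + 1) n = 0 := by
    ext
    change opcBoundary n X (m.hom (1 : ℤ)) = 0
    rw [hm1, h]
  let l := Limits.KernelFork.IsLimit.lift'
    ((SChain ℤ X).homologyIsKernel (n + 1) n (ChainComplex.next_nat_succ n)) m hm
  refine ⟨l.1.hom 1, ?_⟩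
  have := congrArg (fun k => k.hom (1 : ℤ)) l.2
  exact this.trans hm1

/-- The point `x` as a chain. -/
def ptChain (x : X) : (SChain ℤ X).X 0 := (simplexChain ℤ (ContinuousMap.const _ x)).hom (1 : ℤ)

theorem opcBoundary_scl (σ : C(stdSimplex ℝ (Fin 2), X)) :
    opcBoundary 0 X (scl σ) = ptChain (σ (stdSimplex.vertex 1)) - ptChain (σ (stdSimplex.vertex 0)) := by
  have h : ∀ i, simplexFace σ i = ContinuousMap.const _ (σ (stdSimplex.vertex (i.succAbove 0))) := by
    intro i
    ext p
    rw [Subsingleton.elim p (stdSimplex.vertex 0), simplexFace_vertex]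
    rfl
  rw [opcBoundary_simplexOpc, Fin.sum_univ_two, h, h]
  simp [ptChain, sub_eq_add_neg]

/-- A cocycle that vanishes on homology is a coboundary. -/
theorem exists_primitive (α : Opc 1 ℤ X →ₗ[ℤ] ℤ) (h : ∀ z, α (homOpc 1 ℤ X z) = 0) :
    ∃ f : X → ℤ, ∀ σ, α (scl σ) = f (σ (stdSimplex.vertex 1)) - f (σ (stdSimplex.vertex 0)) := by
  let o : X → X := fun x => Quotient.out (Quotient.mk (pathSetoid X) x)
  have ho : ∀ x, Joined (o x) x := fun x => Quotient.mk_out (s := pathSetoid X) x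
  let p : ∀ x, C(stdSimplex ℝ (Fin 2), X) := fun x => pathSimplex (ho x).somePath.toContinuousMap
  have p0 : ∀ x, p x (stdSimplex.vertex 0) = o x := fun x => by
    change (ho x).somePath (stdSimplexHomeomorphUnitInterval _) = _
    rw [stdSimplexHomeomorphUnitInterval_zero, Path.source]
  have p1 : ∀ x, p x (stdSimplex.vertex 1) = x := fun x => by
    change (ho x).somePath (stdSimplexHomeomorphUnitInterval _) = _
    rw [stdSimplexHomeomorphUnitInterval_one, Path.target]
  -- The primitive integrates `α` from a base point chosen in each path component. The ends of `σ`
  -- share a component, so `p x`, `σ` and the reverse of `p y` close up to a cycle, on which `α`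
  -- vanishes.
  refine ⟨fun x => α (scl (p x)), fun σ => ?_⟩
  set x := σ (stdSimplex.vertex 0)
  set y := σ (stdSimplex.vertex 1)
  have hxy : Joined x y := by
    let γ : C(unitInterval, X) :=
      σ.comp (stdSimplexHomeomorphUnitInterval.symm : C(unitInterval, stdSimplex ℝ (Fin 2)))
    refine ⟨⟨γ, ?_, ?_⟩⟩
    · change σ (stdSimplexHomeomorphUnitInterval.symm 0) = _
      rw [← stdSimplexHomeomorphUnitInterval_zero, Homeomorph.symm_apply_apply]
    · change σ (stdSimplexHomeomorphUnitInterval.symm 1) = _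
      rw [← stdSimplexHomeomorphUnitInterval_one, Homeomorph.symm_apply_apply]
  have hoxy : o x = o y := congrArg Quotient.out (Quotient.sound (s := pathSetoid X) hxy)
  obtain ⟨z, hz⟩ := exists_homOpc (n := 0) (x := scl (p x) + scl σ - scl (p y)) (by
    rw [map_sub, map_add, opcBoundary_scl, opcBoundary_scl, opcBoundary_scl, p0, p1, p0, p1, hoxy]
    abel)
  have := h z
  rw [hz, map_sub, map_add] at this
  linarith

/-- A function on simplices, as a linear map on chains. -/
theorem exists_chainMap {n : ℕ} (φ : C(stdSimplex ℝ (Fin (n + 1)), X) → ℤ) :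
    ∃ ψ : (SChain ℤ X).X n →ₗ[ℤ] ℤ, ∀ σ, ψ ((simplexChain ℤ σ).hom (1 : ℤ)) = φ σ := by
  refine ⟨(chainDesc ℤ (A := ModuleCat.of ℤ ℤ) fun σ =>
    ModuleCat.ofHom (LinearMap.toSpanSingleton ℤ _ (φ σ))).hom, fun σ => ?_⟩
  have := congrArg (fun f => f.hom (1 : ℤ)) (simplexChain_desc ℤ (A := ModuleCat.of ℤ ℤ)
    (fun σ : C(stdSimplex ℝ (Fin (n + 1)), X) => ModuleCat.ofHom
      (LinearMap.toSpanSingleton ℤ _ (φ σ))) σ)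
  exact this.trans (one_smul _ _)

theorem cup_eq_zero_of_boundary {α β : Opc 1 ℤ X →ₗ[ℤ] ℤ}
    (φ : C(stdSimplex ℝ (Fin 2), X) → ℤ)
    (h : ∀ σ, α (scl (simplexFace σ 2)) * β (scl (simplexFace σ 0)) =
      φ (simplexFace σ 0) - φ (simplexFace σ 1) + φ (simplexFace σ 2)) (z : SHom 2 ℤ X) :
    cup α β (homOpc 2 ℤ X z) = 0 := by
  obtain ⟨ψ, hψ⟩ := exists_chainMap φ
  have : cup α β = ψ ∘ₗ opcBoundary 1 X := by
    refine opc_ext_int fun σ => ?_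
    rw [cup_scl, h, LinearMap.comp_apply, opcBoundary_simplexOpc, Fin.sum_univ_three, map_add,
      map_add, map_zsmul, map_zsmul, map_zsmul, hψ, hψ, hψ]
    simp [sub_eq_add_neg]
  rw [this, LinearMap.comp_apply, opcBoundary_homOpc, map_zero]

/-- If `α` is the coboundary of a function `f`, then `cup α β` is the coboundary of the product of
`f` at the initial point with `β`. -/
theorem cup_left_eq_zero {α : Opc 1 ℤ X →ₗ[ℤ] ℤ} (h : ∀ z, α (homOpc 1 ℤ X z) = 0)
    (β : Opc 1 ℤ X →ₗ[ℤ] ℤ) (z : SHom 2 ℤ X) : cup α β (homOpc 2 ℤ X z) = 0 := by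
  obtain ⟨f, hf⟩ := exists_primitive α h
  refine cup_eq_zero_of_boundary (fun τ => f (τ (stdSimplex.vertex 0)) * β (scl τ)) (fun σ => ?_) z
  rw [hf, cocycle_face β]
  simp only [simplexFace_vertex]
  change (f (σ (stdSimplex.vertex 1)) - f (σ (stdSimplex.vertex 0))) * _ =
    f (σ (stdSimplex.vertex 1)) * _ - f (σ (stdSimplex.vertex 0)) * _ +
      f (σ (stdSimplex.vertex 0)) * _
  ring

/-- Symmetrically, the product of `α` with `f` at the final point is a primitive up to sign. -/
theorem cup_right_eq_zero {β : Opc 1 ℤ X →ₗ[ℤ] ℤ} (h : ∀ z, β (homOpc 1 ℤ X z) = 0)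
    (α : Opc 1 ℤ X →ₗ[ℤ] ℤ) (z : SHom 2 ℤ X) : cup α β (homOpc 2 ℤ X z) = 0 := by
  obtain ⟨f, hf⟩ := exists_primitive β h
  refine cup_eq_zero_of_boundary (fun τ => -(f (τ (stdSimplex.vertex 1)) * α (scl τ)))
    (fun σ => ?_) z
  rw [hf, cocycle_face α]
  simp only [simplexFace_vertex]
  change _ * (f (σ (stdSimplex.vertex 2)) - f (σ (stdSimplex.vertex 1))) =
    -(f (σ (stdSimplex.vertex 2)) * _) - -(f (σ (stdSimplex.vertex 2)) * _) +
      -(f (σ (stdSimplex.vertex 1)) * _)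
  ring

theorem cup_sub_left (α α' β : Opc 1 ℤ X →ₗ[ℤ] ℤ) : cup (α - α') β = cup α β - cup α' β := by
  refine opc_ext_int fun σ => ?_
  simp only [cup_scl, LinearMap.sub_apply, sub_mul]

theorem cup_sub_right (α β β' : Opc 1 ℤ X →ₗ[ℤ] ℤ) : cup α (β - β') = cup α β - cup α β' := by
  refine opc_ext_int fun σ => ?_
  simp only [cup_scl, LinearMap.sub_apply, mul_sub]

/-- The cup product depends only on the values on homology. -/
theorem cup_congr {α α' β β' : Opc 1 ℤ X →ₗ[ℤ] ℤ}
    (h : ∀ z, α (homOpc 1 ℤ X z) = α' (homOpc 1 ℤ X z))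
    (h' : ∀ z, β (homOpc 1 ℤ X z) = β' (homOpc 1 ℤ X z)) (z : SHom 2 ℤ X) :
    cup α β (homOpc 2 ℤ X z) = cup α' β' (homOpc 2 ℤ X z) := by
  have h1 := cup_left_eq_zero (α := α - α') (fun z => by rw [LinearMap.sub_apply, h, sub_self]) β z
  have h2 := cup_right_eq_zero (β := β - β') (fun z => by rw [LinearMap.sub_apply, h', sub_self])
    α' z
  rw [cup_sub_left, LinearMap.sub_apply] at h1
  rw [cup_sub_right, LinearMap.sub_apply] at h2
  linarith

end Cup

/-- The cup product, evaluated on the fundamental class. -/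
def cupForm (g : ℕ) : (Opc 1 ℤ (Surf g) →ₗ[ℤ] ℤ) →ₗ[ℤ] (Opc 1 ℤ (Surf g) →ₗ[ℤ] ℤ) →ₗ[ℤ] ℤ :=
  ∑ s : Sq g, ((LinearMap.mul ℤ ℤ).compl₁₂ (LinearMap.applyₗ (hEdge s))
      (LinearMap.applyₗ (vEdge (rightPerm g s))) -
    (LinearMap.mul ℤ ℤ).compl₁₂ (LinearMap.applyₗ (vEdge s))
      (LinearMap.applyₗ (hEdge (upPerm g s))))

theorem cupForm_apply {g : ℕ} (α β : Opc 1 ℤ (Surf g) →ₗ[ℤ] ℤ) : cupForm g α β =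
    ∑ s : Sq g, (α (hEdge s) * β (vEdge (rightPerm g s)) -
      α (vEdge s) * β (hEdge (upPerm g s))) := by
  simp [cupForm]

theorem scl_pathSimplex_square {g : ℕ} (s : Sq g) (c : C(unitInterval, unitInterval × unitInterval))
    (v w : ℝ × ℝ) (h : ∀ t : unitInterval, ((c t).1.1, (c t).2.1) = (1 - t.1) • v + t.1 • w) :
    scl (pathSimplex ((squareMap s).comp c)) = seg (sqExt s) v w := by
  rw [scl_pathSimplex]
  refine seg_congr fun a b ha hb hab => ?_
  have hb1 : b ∈ Set.Icc (0 : ℝ) 1 := ⟨hb, by linarith⟩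
  have e : a • (0 : ℝ) + b • (1 : ℝ) = b := by simp
  rw [e, pathExt_apply _ hb1, show a = 1 - b by linarith, ← h ⟨b, hb1⟩, sqExt_coe]
  rfl

/-- Each triangle contributes the product over its front and back sides: lower and right for the
lower triangle, left and upper, with a minus sign, for the upper one. The right and upper sides are
rewritten as sides of the neighbouring squares. -/
theorem cup_fundamentalClass {g : ℕ} (α β : Opc 1 ℤ (Surf g) →ₗ[ℤ] ℤ) :
    cup α β (homOpc 2 ℤ _ (fundamentalClass g)) = cupForm g α β := by
  obtain ⟨f0, f1, f2⟩ := lowerTri_face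
  rw [homOpc_fundamentalClass, map_sum, cupForm_apply]
  refine Finset.sum_congr rfl fun s => fun _ => ?_
  have a1 : scl (simplexFace (((hStrips g).sq s).comp lowerTri) 2) = hEdge s := by
    refine (congrArg (fun k => scl ((squareMap s).comp k)) f2).trans ?_
    exact scl_pathSimplex_square s ⟨fun t => (t, 0), by fun_prop⟩ _ _ fun t => by ext <;> simp
  have a2 : scl (simplexFace (((hStrips g).sq s).comp lowerTri) 0) = vEdge (rightPerm g s) := by
    refine (congrArg (fun k => scl ((squareMap s).comp k)) f0).trans ?_
    rw [vEdge, ← seg_right]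
    exact scl_pathSimplex_square s ⟨fun t => (1, t), by fun_prop⟩ _ _ fun t => by ext <;> simp
  have a3 : scl (simplexFace (((hStrips g).sq s).comp upperTri) 2) = vEdge s := by
    refine (congrArg (fun k => scl ((squareMap s).comp (ContinuousMap.prodSwap.comp k))) f2).trans ?_
    exact scl_pathSimplex_square s ⟨fun t => (0, t), by fun_prop⟩ _ _ fun t => by ext <;> simp
  have a4 : scl (simplexFace (((hStrips g).sq s).comp upperTri) 0) = hEdge (upPerm g s) := by
    refine (congrArg (fun k => scl ((squareMap s).comp (ContinuousMap.prodSwap.comp k))) f0).trans ?_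
    rw [hEdge, ← seg_top]
    exact scl_pathSimplex_square s ⟨fun t => (t, 1), by fun_prop⟩ _ _ fun t => by ext <;> simp
  rw [map_sub, cup_scl, cup_scl, a1, a2, a3, a4]

/-! ### The symplectic basis -/

section Basis

variable {g : ℕ}

/-- The classes of the curves `a_i` and `b_i`. -/
def classAB (R : Type) [CommRing R] : Fin g ⊕ Fin g → SHom 1 R (Surf g) :=
  Sum.elim (classA R) (classB R)

/-- The cocycles dual to the curves `a_i` and `b_i`. -/
def dualOpc (R : Type) [CommRing R] : Fin g ⊕ Fin g → Opc 1 R (Surf g) →ₗ[ℤ] R :=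
  Sum.elim (fun i => (-1 : ℤ) ^ i.val • windOpc R (circB i))
    (fun i => (-1 : ℤ) ^ i.val • windOpc R (circA i))

theorem neg_one_pow_smul_self (n : ℕ) (m : ℤ) : (-1 : ℤ) ^ n * ((-1 : ℤ) ^ n * m) = m := by
  rw [← mul_assoc, ← mul_pow]
  simp

/-- `circB i` counts the vertical passages through the row `i`, and `circA i` the horizontal
passages through the square `(i, 1)`. The signs in the classes and in the cocycles cancel. -/
theorem dualOpc_class (p q : Fin g ⊕ Fin g) :
    dualOpc ℤ p (homOpc 1 ℤ _ (classAB ℤ q)) = if p = q then 1 else 0 := by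
  rcases p with i | i <;> rcases q with j | j
  · simp only [dualOpc, classAB, Sum.elim_inl, classA_eq, LinearMap.smul_apply, map_zsmul, aCyc,
      circB_vEdge, smul_eq_mul, Sum.inl.injEq]
    by_cases h : i = j
    · subst h
      simp only [if_true, mul_one]
      rw [← mul_pow]
      simp
    · simp [h, Ne.symm h]
  · simp only [dualOpc, classAB, Sum.elim_inl, Sum.elim_inr, classB_eq, LinearMap.smul_apply,
      map_zsmul, bCyc, map_add, circB_hEdge]
    simp
  · simp only [dualOpc, classAB, Sum.elim_inl, Sum.elim_inr, classA_eq, LinearMap.smul_apply,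
      map_zsmul, aCyc, circA_vEdge]
    simp
  · simp only [dualOpc, classAB, Sum.elim_inr, classB_eq, LinearMap.smul_apply,
      map_zsmul, bCyc, map_add, circA_hEdge, smul_eq_mul, Sum.inr.injEq]
    by_cases h : i = j
    · subst h
      simp [← mul_pow]
    · simp [h, Ne.symm h]

/-- The only squares that can contribute are the `(i, 1)`, where the curves `a_i` and `b_i` cross.
-/
theorem cupForm_dualOpc (p q : Fin g ⊕ Fin g) :
    cupForm g (dualOpc ℤ p) (dualOpc ℤ q) = Matrix.J (Fin g) ℤ p q := by
  have hu : ∀ (s : Sq g) (j : Fin g), upPerm g s = (j, 1) ↔ s = (j, 1) := fun s j => by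
    rw [← upPerm_one, (upPerm g).apply_eq_iff_eq, upPerm_one]
  have hr : ∀ s : Sq g, (rightPerm g s).1 = s.1 := fun _ => rfl
  rw [cupForm_apply]
  rcases p with i | i <;> rcases q with j | j
  · simp [dualOpc, circB_hEdge, Matrix.J]
  · simp only [dualOpc, Sum.elim_inl, Sum.elim_inr, LinearMap.smul_apply, circB_hEdge, circB_vEdge,
      circA_hEdge, circA_vEdge, hu, Matrix.J, Matrix.fromBlocks_apply₁₂, smul_eq_mul, mul_zero,
      zero_sub, Matrix.neg_apply]
    rw [Finset.sum_neg_distrib, Finset.sum_eq_single (j, 1)]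
    · by_cases h : i = j
      · subst h
        simp only [if_true, Matrix.one_apply_eq]
        rw [mul_assoc, one_mul, neg_one_pow_smul_self]
      · simp [h, Ne.symm h]
    · intro s _ hs
      simp [hs]
    · simp
  · simp only [dualOpc, Sum.elim_inl, Sum.elim_inr, LinearMap.smul_apply, circB_hEdge, circB_vEdge,
      circA_hEdge, circA_vEdge, hr, Matrix.J, Matrix.fromBlocks_apply₂₁, smul_eq_mul, mul_zero,
      sub_zero]
    rw [Finset.sum_eq_single (i, 1)]
    · by_cases h : i = j
      · subst h
        simp only [if_true, Matrix.one_apply_eq]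
        rw [mul_assoc, one_mul, neg_one_pow_smul_self]
      · simp [h]
    · intro s _ hs
      simp [hs]
    · simp
  · simp [dualOpc, circA_vEdge, Matrix.J]

/-- The basis of `H_1(S_g; ℤ)` given by the curves `a_i` and `b_i`. -/
def surfBasis (g : ℕ) : Module.Basis (Fin g ⊕ Fin g) ℤ (SHom 1 ℤ (Surf g)) :=
  Module.Basis.mk (v := classAB ℤ) (by
    rw [Fintype.linearIndependent_iff]
    intro c hc p
    have := congrArg (fun z => dualOpc ℤ p (homOpc 1 ℤ _ z)) hc
    simpa [-Fintype.sum_sum_type, dualOpc_class] using this) (by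
    intro z _
    have hz := homOpc_mem_span z
    have hr : Set.range (Sum.elim (aCyc (g := g)) bCyc) ⊆
        (Submodule.span ℤ (Set.range (classAB (g := g) ℤ))).map (homOpc 1 ℤ (Surf g)) := by
      rintro _ ⟨i | i, rfl⟩
      · refine ⟨loopClass ℤ (annA i).core (annA i).core_closed, ?_, homOpc_coreA i⟩
        have h : classA ℤ i ∈ Submodule.span ℤ (Set.range (classAB (g := g) ℤ)) :=
          Submodule.subset_span ⟨Sum.inl i, rfl⟩
        have h2 := zsmul_mem h ((-1) ^ i.val)
        rw [classA, ← mul_zsmul, ← mul_pow] at h2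
        simpa using h2
      · refine ⟨loopClass ℤ (annB i).core (annB i).core_closed, ?_, homOpc_coreB i⟩
        have h : classB ℤ i ∈ Submodule.span ℤ (Set.range (classAB (g := g) ℤ)) :=
          Submodule.subset_span ⟨Sum.inr i, rfl⟩
        have h2 := zsmul_mem h ((-1) ^ i.val)
        rw [classB, ← mul_zsmul, ← mul_pow] at h2
        simpa using h2
    obtain ⟨w, hw, hwz⟩ := Submodule.span_le.2 hr hz
    rwa [← homOpc_injective _ _ _ hwz])

theorem surfBasis_apply (p : Fin g ⊕ Fin g) : surfBasis g p = classAB ℤ p := by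
  rw [surfBasis, Module.Basis.mk_apply]

theorem surfBasis_repr (z : SHom 1 ℤ (Surf g)) (p : Fin g ⊕ Fin g) :
    (surfBasis g).repr z p = dualOpc ℤ p (homOpc 1 ℤ _ z) := by
  conv_rhs => rw [← (surfBasis g).sum_repr z]
  simp [-Fintype.sum_sum_type, surfBasis_apply, dualOpc_class, -Module.Basis.sum_repr]

/-- The matrix of the action of a mapping class. -/
def actMatrix (f : ModS g) : Matrix (Fin g ⊕ Fin g) (Fin g ⊕ Fin g) ℤ :=
  LinearMap.toMatrix (surfBasis g) (surfBasis g) (mcgAct (fundamentalClass g) 1 ℤ f)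

theorem actMatrix_apply (f : ModS g) (p q : Fin g ⊕ Fin g) : actMatrix f p q =
    (surfBasis g).repr (mcgAct (fundamentalClass g) 1 ℤ f (classAB ℤ q)) p := by
  rw [actMatrix, LinearMap.toMatrix_apply, surfBasis_apply]

/-- Pulling back the dual cocycle with index `p` along the homeomorphism gives, on homology, the
combination of dual cocycles with the entries of row `p` as coefficients. Naturality of the cup
product and invariance of the fundamental class then yield `M J Mᵀ = J`. -/
theorem actMatrix_mem (f : ModS g) : actMatrix f ∈ Matrix.symplecticGroup (Fin g) ℤ := by
  obtain ⟨T, rfl⟩ := QuotientGroup.mk_surjective f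
  set M := actMatrix (T : ModS g)
  rw [SymplecticGroup.mem_iff]
  have h1 : ∀ p z, (dualOpc ℤ p ∘ₗ opcMap 1 ℤ (T.1 : C(Surf g, Surf g))) (homOpc 1 ℤ _ z) =
      (∑ r, M p r • dualOpc ℤ r) (homOpc 1 ℤ _ z) := by
    intro p z
    rw [LinearMap.comp_apply, ← homOpc_homeoAct, ← surfBasis_repr, LinearMap.sum_apply]
    have := congrFun (LinearMap.toMatrix_mulVec_repr (surfBasis g) (surfBasis g)
      (mcgAct (fundamentalClass g) 1 ℤ (T : ModS g)) z) p
    rw [mcgAct_coe] at this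
    rw [← this]
    simp only [Matrix.mulVec, dotProduct, LinearMap.smul_apply, ← surfBasis_repr, smul_eq_mul]
    rfl
  ext p q
  have e : cup (dualOpc ℤ p) (dualOpc ℤ q) (homOpc 2 ℤ _ (fundamentalClass g)) =
      cup (∑ r, M p r • dualOpc ℤ r) (∑ r, M q r • dualOpc ℤ r)
        (homOpc 2 ℤ _ (fundamentalClass g)) := by
    rw [← cup_congr (h1 p) (h1 q), cup_opcMap, LinearMap.comp_apply, ← homOpc_homeoAct]
    congr 2
    exact T.2.symm
  rw [cup_fundamentalClass, cup_fundamentalClass, cupForm_dualOpc] at e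
  rw [e]
  simp only [map_sum, LinearMap.sum_apply, map_smul, LinearMap.smul_apply, cupForm_dualOpc,
    Matrix.mul_apply, Matrix.transpose_apply, smul_eq_mul, Finset.sum_mul, Finset.mul_sum]
  refine Finset.sum_congr rfl fun r _ => Finset.sum_congr rfl fun s _ => ?_
  ring

/-- The symplectic representation. -/
def sympRep (g : ℕ) : ModS g →* Matrix.symplecticGroup (Fin g) ℤ :=
  MonoidHom.codRestrict (((LinearMap.toMatrixAlgEquiv (surfBasis g) :
    Module.End ℤ (SHom 1 ℤ (Surf g)) →* Matrix (Fin g ⊕ Fin g) (Fin g ⊕ Fin g) ℤ)).comp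
      (mcgAct (fundamentalClass g) 1 ℤ)) _ actMatrix_mem

theorem coe_sympRep (f : ModS g) : (sympRep g f : Matrix _ _ ℤ) = actMatrix f := rfl

theorem sympRep_mulVec_single (f : ModS g) (q : Fin g ⊕ Fin g) :
    (sympRep g f : Matrix _ _ ℤ).mulVec (Pi.single q 1) =
      (surfBasis g).repr (mcgAct (fundamentalClass g) 1 ℤ f (classAB ℤ q)) := by
  ext p
  rw [Matrix.mulVec_single_one, coe_sympRep, Matrix.col_apply, actMatrix_apply]

theorem repr_classAB (q : Fin g ⊕ Fin g) :
    ⇑((surfBasis g).repr (classAB ℤ q)) = Pi.single q 1 := by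
  rw [← surfBasis_apply, Module.Basis.repr_self, Finsupp.single_eq_pi_single]

/-! ### Reduction of coefficients -/

/-- Reduction of coefficients modulo `k`. -/
def redOpc (k : ℕ) (X : Type) [TopologicalSpace X] : Opc 1 ℤ X →+ Opc 1 (ZMod k) X :=
  LinearMap.toAddMonoidHom <| opcDesc ℤ (X := X) (n := 1)
    (fun σ => AddMonoidHom.toIntLinearMap (zmultiplesHom _ (simplexOpc (ZMod k) σ 1))) fun σ r => by
    rw [← map_zero (zsmulAddGroupHom (α := Opc 1 (ZMod k) X) r), ← simplexOpc_boundary _ σ 1,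
      map_sum]
    refine Finset.sum_congr rfl fun i _ => ?_
    rw [map_zsmul]
    rfl

theorem redOpc_scl (k : ℕ) {X : Type} [TopologicalSpace X] (σ : C(stdSimplex ℝ (Fin 2), X)) :
    redOpc k X (scl (n := 1) σ) = simplexOpc (ZMod k) (n := 1) σ 1 :=
  (opcDesc_simplexOpc ℤ _ _ σ 1).trans (one_zsmul _)

theorem redOpc_opcMap (k : ℕ) {X : Type} [TopologicalSpace X] (f : C(X, X)) (x : Opc 1 ℤ X) :
    opcMap 1 (ZMod k) f (redOpc k X x) = redOpc k X (opcMap 1 ℤ f x) := by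
  have : (opcMap 1 (ZMod k) f).toAddMonoidHom.comp (redOpc k X) =
      (redOpc k X).comp (opcMap 1 ℤ f).toAddMonoidHom := by
    refine opc_addHom_ext fun σ => ?_
    change opcMap 1 (ZMod k) f (redOpc k X (scl σ)) = redOpc k X (opcMap 1 ℤ f (scl σ))
    rw [redOpc_scl, opcMap_simplexOpc, opcMap_simplexOpc, redOpc_scl]
  exact congrArg (fun h : Opc 1 ℤ X →+ Opc 1 (ZMod k) X => h x) this

theorem redOpc_smul (k : ℕ) {X : Type} [TopologicalSpace X] (x : Opc 1 ℤ X) :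
    redOpc k X ((k : ℤ) • x) = 0 := by
  have : (redOpc k X).comp ((k : ℤ) • AddMonoidHom.id _) = 0 := by
    refine opc_addHom_ext fun σ => ?_
    change redOpc k X ((k : ℤ) • scl σ) = 0
    rw [map_zsmul, redOpc_scl, ← map_zsmul]
    simp
  exact congrArg (fun h : Opc 1 ℤ X →+ Opc 1 (ZMod k) X => h x) this

theorem dualOpc_redOpc (k : ℕ) (p : Fin g ⊕ Fin g) (x : Opc 1 ℤ (Surf g)) :
    dualOpc (ZMod k) p (redOpc k _ x) = (dualOpc ℤ p x : ZMod k) := by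
  have : (dualOpc (ZMod k) p).toAddMonoidHom.comp (redOpc k _) =
      (Int.castAddHom (ZMod k)).comp (dualOpc (g := g) ℤ p).toAddMonoidHom := by
    refine opc_addHom_ext fun σ => ?_
    change dualOpc (ZMod k) p (redOpc k _ (scl σ)) = (dualOpc ℤ p (scl σ) : ZMod k)
    rw [redOpc_scl]
    rcases p with i | i <;> simp [dualOpc, windOpc_simplexOpc]
  exact congrArg (fun h : Opc 1 ℤ (Surf g) →+ ZMod k => h x) this

theorem homOpc_classA_zmod (k : ℕ) (i : Fin g) :
    homOpc 1 (ZMod k) _ (classA (ZMod k) i) = redOpc k _ (homOpc 1 ℤ _ (classA ℤ i)) := by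
  rw [classA, classA, map_zsmul, map_zsmul, map_zsmul, homOpc_loopClass, homOpc_loopClass,
    redOpc_scl]

/-- If the images of `a_1` agree modulo `k`, the dual cocycles with coefficients in `ZMod k` read
off the column. Conversely, if the column is right, the image of `a_1` is `a_1` plus `k` times an
integral class, which reduction kills. The homology with coefficients need not be computed. -/
theorem mem_modE1_iff [NeZero g] (k : ℕ) (f : ModS g) :
    f ∈ modE1 g k ↔ ∀ p, ((sympRep g f).1 p (Sum.inl 0) : ZMod k) =
      if p = Sum.inl 0 then 1 else 0 := by
  obtain ⟨T, rfl⟩ := QuotientGroup.mk_surjective f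
  set z := mcgAct (fundamentalClass g) 1 ℤ (T : ModS g) (classA ℤ 0)
  have hM : ∀ p, (sympRep g (T : ModS g)).1 p (Sum.inl 0) = (surfBasis g).repr z p :=
    fun p => actMatrix_apply _ p _
  have hact : homOpc 1 (ZMod k) _ (mcgAct (fundamentalClass g) 1 (ZMod k) (T : ModS g)
      (classA (ZMod k) 0)) = redOpc k _ (homOpc 1 ℤ _ z) := by
    rw [mcgAct_coe, homOpc_homeoAct, homOpc_classA_zmod, redOpc_opcMap, ← homOpc_homeoAct]
    rfl
  have hmem : (T : ModS g) ∈ modE1 g k ↔ redOpc k _ (homOpc 1 ℤ _ z) =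
      redOpc k _ (homOpc 1 ℤ _ (classA (g := g) ℤ 0)) := by
    rw [← hact, ← homOpc_classA_zmod, (homOpc_injective _ _ _).eq_iff]
    rfl
  rw [show (QuotientGroup.mk T : ModS g) = (T : ModS g) from rfl, hmem]
  simp only [hM]
  constructor
  · intro h p
    have := congrArg (dualOpc (ZMod k) p) h
    rw [dualOpc_redOpc, dualOpc_redOpc, ← surfBasis_repr] at this
    rw [this]
    have e : dualOpc ℤ p (homOpc 1 ℤ _ (classA (g := g) ℤ 0)) = _ := dualOpc_class p (Sum.inl 0)
    rw [e]
    split_ifs <;> simp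
  · intro h
    have hd : ∀ p, ∃ c : ℤ, (surfBasis g).repr z p =
        (if p = Sum.inl 0 then 1 else 0) + (k : ℤ) * c := by
      intro p
      have h2 := h p
      have h3 : (((surfBasis g).repr z p - if p = Sum.inl 0 then 1 else 0 : ℤ) : ZMod k) = 0 := by
        rw [Int.cast_sub, h2]
        split_ifs <;> simp
      obtain ⟨c, hc⟩ := (ZMod.intCast_zmod_eq_zero_iff_dvd _ k).1 h3
      exact ⟨c, by linarith⟩
    choose c hc using hd
    have hz : z = classA ℤ 0 + (k : ℤ) • ∑ p, c p • classAB ℤ p := by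
      refine (surfBasis g).ext_elem fun p => ?_
      rw [hc, surfBasis_repr, ← Sum.elim_inl (classA ℤ) (classB ℤ) (0 : Fin g)]
      change _ = dualOpc ℤ p (homOpc 1 ℤ _ (classAB ℤ (Sum.inl 0) + _))
      simp [-Fintype.sum_sum_type, dualOpc_class]
    rw [hz, map_add, map_zsmul, map_add, redOpc_smul, add_zero]

end Basis

/-! ### Symplectic transvections -/

section Transvections

variable {g : ℕ}

/-- The symplectic form on `ℤ^{2g}` with `ω(b_i, a_i) = 1`. -/
def spForm (g : ℕ) : (Fin g ⊕ Fin g → ℤ) →ₗ[ℤ] (Fin g ⊕ Fin g → ℤ) →ₗ[ℤ] ℤ :=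
  LinearMap.mk₂ ℤ (fun u v => ∑ i, (u (Sum.inr i) * v (Sum.inl i) - u (Sum.inl i) * v (Sum.inr i)))
    (fun u u' v => by
      rw [← Finset.sum_add_distrib]
      exact Finset.sum_congr rfl fun i _ => by simp only [Pi.add_apply]; ring)
    (fun c u v => by
      rw [smul_eq_mul, Finset.mul_sum]
      exact Finset.sum_congr rfl fun i _ => by simp only [Pi.smul_apply, smul_eq_mul]; ring)
    (fun u v v' => by
      rw [← Finset.sum_add_distrib]
      exact Finset.sum_congr rfl fun i _ => by simp only [Pi.add_apply]; ring)
    (fun c u v => by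
      rw [smul_eq_mul, Finset.mul_sum]
      exact Finset.sum_congr rfl fun i _ => by simp only [Pi.smul_apply, smul_eq_mul]; ring)

theorem spForm_apply (u v : Fin g ⊕ Fin g → ℤ) : spForm g u v =
    ∑ i, (u (Sum.inr i) * v (Sum.inl i) - u (Sum.inl i) * v (Sum.inr i)) := rfl

theorem spForm_eq_J (u v : Fin g ⊕ Fin g → ℤ) :
    spForm g u v = u ⬝ᵥ (Matrix.J (Fin g) ℤ).mulVec v := by
  rw [spForm_apply, Matrix.J, Matrix.fromBlocks_mulVec]
  simp [dotProduct, Fintype.sum_sum_type, Matrix.neg_mulVec, Finset.sum_sub_distrib]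
  ring

@[simp]
theorem spForm_self (u : Fin g ⊕ Fin g → ℤ) : spForm g u u = 0 := by
  rw [spForm_apply]
  exact Finset.sum_eq_zero fun i _ => by ring

theorem spForm_swap (u v : Fin g ⊕ Fin g → ℤ) : spForm g v u = -spForm g u v := by
  rw [spForm_apply, spForm_apply, ← Finset.sum_neg_distrib]
  exact Finset.sum_congr rfl fun i _ => by ring

/-- The basis vector `a_i`. -/
def vecA (i : Fin g) : Fin g ⊕ Fin g → ℤ := Pi.single (Sum.inl i) 1

/-- The basis vector `b_i`. -/
def vecB (i : Fin g) : Fin g ⊕ Fin g → ℤ := Pi.single (Sum.inr i) 1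

@[simp]
theorem spForm_vecA (u : Fin g ⊕ Fin g → ℤ) (i : Fin g) :
    spForm g u (vecA i) = u (Sum.inr i) := by
  rw [spForm_apply, Finset.sum_eq_single i] <;> simp +contextual [vecA]

@[simp]
theorem spForm_vecB (u : Fin g ⊕ Fin g → ℤ) (i : Fin g) :
    spForm g u (vecB i) = -u (Sum.inl i) := by
  rw [spForm_apply, Finset.sum_eq_single i] <;> simp +contextual [vecB]

@[simp]
theorem vecA_spForm (u : Fin g ⊕ Fin g → ℤ) (i : Fin g) :
    spForm g (vecA i) u = -u (Sum.inr i) := by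
  rw [spForm_swap, spForm_vecA]

@[simp]
theorem vecB_spForm (u : Fin g ⊕ Fin g → ℤ) (i : Fin g) :
    spForm g (vecB i) u = u (Sum.inl i) := by
  rw [spForm_swap, spForm_vecB, neg_neg]

@[simp]
theorem vecA_inl (i j : Fin g) : vecA i (Sum.inl j) = if j = i then 1 else 0 := by
  simp [vecA, Pi.single_apply]

@[simp]
theorem vecA_inr (i j : Fin g) : vecA i (Sum.inr j) = 0 := by simp [vecA]

@[simp]
theorem vecB_inl (i j : Fin g) : vecB i (Sum.inl j) = 0 := by simp [vecB]

@[simp]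
theorem vecB_inr (i j : Fin g) : vecB i (Sum.inr j) = if j = i then 1 else 0 := by
  simp [vecB, Pi.single_apply]

/-- The action of the symplectic group on vectors. -/
def spAct (g : ℕ) : Matrix.symplecticGroup (Fin g) ℤ →* Module.End ℤ (Fin g ⊕ Fin g → ℤ) :=
  ((Matrix.toLinAlgEquiv' (R := ℤ) (n := Fin g ⊕ Fin g) :
    Matrix (Fin g ⊕ Fin g) (Fin g ⊕ Fin g) ℤ →* _)).comp (Submonoid.subtype _)

theorem spAct_apply (M : Matrix.symplecticGroup (Fin g) ℤ) (u : Fin g ⊕ Fin g → ℤ) :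
    spAct g M u = M.1.mulVec u := rfl

theorem spAct_injective : Function.Injective (spAct g) := fun _ _ h =>
  Subtype.ext (Matrix.toLinAlgEquiv'.injective h)

theorem spAct_mul_apply (M N : Matrix.symplecticGroup (Fin g) ℤ) (u : Fin g ⊕ Fin g → ℤ) :
    spAct g (M * N) u = spAct g M (spAct g N u) := by
  rw [map_mul]; rfl

theorem spAct_inv_apply_eq (M : Matrix.symplecticGroup (Fin g) ℤ) {u v : Fin g ⊕ Fin g → ℤ}
    (h : spAct g M u = v) : spAct g M⁻¹ v = u := by
  rw [← h, ← spAct_mul_apply, inv_mul_cancel, map_one]; rfl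

theorem spForm_spAct (M : Matrix.symplecticGroup (Fin g) ℤ) (u v : Fin g ⊕ Fin g → ℤ) :
    spForm g (spAct g M u) (spAct g M v) = spForm g u v := by
  have h := SymplecticGroup.mem_iff'.1 M.2
  rw [spForm_eq_J, spForm_eq_J, spAct_apply, spAct_apply]
  conv_rhs => rw [← h, ← Matrix.mulVec_mulVec, ← Matrix.mulVec_mulVec, Matrix.dotProduct_mulVec u,
    Matrix.vecMul_transpose]

/-- Linear maps which agree on the vectors `a_i`, `b_i` are equal. -/
theorem spAct_ext {M N : Matrix.symplecticGroup (Fin g) ℤ}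
    (hA : ∀ i, spAct g M (vecA i) = spAct g N (vecA i))
    (hB : ∀ i, spAct g M (vecB i) = spAct g N (vecB i)) : M = N := by
  refine spAct_injective (LinearMap.pi_ext' fun p => LinearMap.ext_ring ?_)
  rcases p with i | i
  · exact hA i
  · exact hB i

/-- The symplectic matrix of a linear map which preserves the form. -/
def spOf (f : (Fin g ⊕ Fin g → ℤ) →ₗ[ℤ] (Fin g ⊕ Fin g → ℤ))
    (h : ∀ u v, spForm g (f u) (f v) = spForm g u v) : Matrix.symplecticGroup (Fin g) ℤ :=
  ⟨LinearMap.toMatrix' f, by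
    rw [SymplecticGroup.mem_iff']
    ext p q
    have := h (Pi.single p 1) (Pi.single q 1)
    rw [spForm_eq_J, spForm_eq_J, ← LinearMap.toMatrix'_mulVec, ← LinearMap.toMatrix'_mulVec,
      Matrix.mulVec_mulVec, ← Matrix.vecMul_transpose, ← Matrix.dotProduct_mulVec,
      Matrix.mulVec_mulVec] at this
    simpa [Matrix.mul_assoc] using this⟩

@[simp]
theorem spAct_spOf (f : (Fin g ⊕ Fin g → ℤ) →ₗ[ℤ] (Fin g ⊕ Fin g → ℤ))
    (h : ∀ u v, spForm g (f u) (f v) = spForm g u v) (u : Fin g ⊕ Fin g → ℤ) :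
    spAct g (spOf f h) u = f u :=
  LinearMap.toMatrix'_mulVec f u

/-- The transvection `u ↦ u + n ω(u, c) c`. -/
def transv (n : ℤ) (c : Fin g ⊕ Fin g → ℤ) : Matrix.symplecticGroup (Fin g) ℤ :=
  spOf (LinearMap.id + n • ((spForm g).flip c).smulRight c) fun u v => by
    simp only [LinearMap.add_apply, LinearMap.id_apply, LinearMap.smul_apply,
      LinearMap.smulRight_apply, LinearMap.flip_apply, map_add, map_smul, smul_eq_mul, spForm_self]
    rw [spForm_swap v c]
    ring

@[simp]
theorem spAct_transv (n : ℤ) (c u : Fin g ⊕ Fin g → ℤ) :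
    spAct g (transv n c) u = u + (n * spForm g u c) • c := by
  simp [transv, mul_smul]

theorem ext_of_spAct {M N : Matrix.symplecticGroup (Fin g) ℤ}
    (h : ∀ u, spAct g M u = spAct g N u) : M = N :=
  spAct_injective (LinearMap.ext h)

theorem transv_mul (m n : ℤ) (c : Fin g ⊕ Fin g → ℤ) :
    transv m c * transv n c = transv (m + n) c := by
  refine ext_of_spAct fun u => ?_
  rw [spAct_mul_apply]
  simp only [spAct_transv, map_add, map_smul, spForm_self]
  module

theorem transv_zero (c : Fin g ⊕ Fin g → ℤ) : transv 0 c = 1 := by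
  refine ext_of_spAct fun u => ?_
  rw [spAct_transv, map_one]
  simp

theorem transv_neg (n : ℤ) (c : Fin g ⊕ Fin g → ℤ) : transv (-n) c = (transv n c)⁻¹ := by
  rw [eq_inv_iff_mul_eq_one, transv_mul, neg_add_cancel, transv_zero]

/-- The symplectic map `u ↦ u + ω(u, w) e + ω(u, e) w` for orthogonal vectors `e`, `w`. -/
def eichler (e w : Fin g ⊕ Fin g → ℤ) : Matrix.symplecticGroup (Fin g) ℤ :=
  transv 1 (e + w) * transv (-1) e * transv (-1) w

theorem spAct_eichler {e w : Fin g ⊕ Fin g → ℤ} (h : spForm g e w = 0) (u : Fin g ⊕ Fin g → ℤ) :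
    spAct g (eichler e w) u = u + spForm g u w • e + spForm g u e • w := by
  have h' : spForm g w e = 0 := by rw [spForm_swap, h, neg_zero]
  rw [eichler, spAct_mul_apply, spAct_mul_apply]
  simp only [spAct_transv, map_add, map_smul, spForm_self, h, h']
  module

/-- For fixed `e` the Eichler maps multiply as in a Heisenberg group: additively in `w`, up to a
transvection along `e`. -/
theorem eichler_add {e w w' : Fin g ⊕ Fin g → ℤ} (h : spForm g e w = 0) (h' : spForm g e w' = 0) :
    eichler e (w + w') = transv (-spForm g w' w) e * (eichler e w * eichler e w') := by
  have k : spForm g w e = 0 := by rw [spForm_swap, h, neg_zero]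
  have k' : spForm g w' e = 0 := by rw [spForm_swap, h', neg_zero]
  refine ext_of_spAct fun u => ?_
  rw [spAct_mul_apply, spAct_mul_apply, spAct_eichler (by rw [map_add, h, h', add_zero]),
    spAct_eichler h, spAct_eichler h', spAct_transv]
  simp only [map_add, map_smul, LinearMap.add_apply, LinearMap.smul_apply, smul_eq_mul,
    spForm_self, h, k, k']
  module

theorem eichler_zero (e : Fin g ⊕ Fin g → ℤ) : eichler e 0 = 1 := by
  refine ext_of_spAct fun u => ?_
  rw [spAct_eichler (map_zero _), map_one]
  simp

theorem eichler_neg {e w : Fin g ⊕ Fin g → ℤ} (h : spForm g e w = 0) :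
    eichler e (-w) = (eichler e w)⁻¹ := by
  have h2 := eichler_add h (w' := -w) (by rw [map_neg, h, neg_zero])
  rw [add_neg_cancel, eichler_zero, map_neg, LinearMap.neg_apply, spForm_self, neg_zero, neg_zero,
    transv_zero, one_mul] at h2
  exact eq_inv_of_mul_eq_one_right h2.symm

theorem eichler_conj (M : Matrix.symplecticGroup (Fin g) ℤ) {e w : Fin g ⊕ Fin g → ℤ}
    (h : spForm g e w = 0) :
    eichler (spAct g M e) (spAct g M w) = M * eichler e w * M⁻¹ := by
  rw [eq_mul_inv_iff_mul_eq]
  refine ext_of_spAct fun u => ?_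
  rw [spAct_mul_apply, spAct_mul_apply, spAct_eichler (by rw [spForm_spAct, h]), spAct_eichler h,
    spForm_spAct, spForm_spAct]
  simp only [map_add, map_smul]

/-! ### The embedding of `SL(2, ℤ)` at a handle -/

/-- The action of `SL(2, ℤ)` on the span of `a_j`, `b_j`. -/
def etaAt (j : Fin g) (A : Matrix.SpecialLinearGroup (Fin 2) ℤ) :
    Matrix.symplecticGroup (Fin g) ℤ :=
  spOf (LinearMap.id +
      LinearMap.smulRight ((A 0 0 - 1) • LinearMap.proj (Sum.inl j) +
        A 0 1 • LinearMap.proj (Sum.inr j) : (Fin g ⊕ Fin g → ℤ) →ₗ[ℤ] ℤ) (vecA j) +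
      LinearMap.smulRight (A 1 0 • LinearMap.proj (Sum.inl j) +
        (A 1 1 - 1) • LinearMap.proj (Sum.inr j) : (Fin g ⊕ Fin g → ℤ) →ₗ[ℤ] ℤ) (vecB j)) fun u v => by
    have hdet : A 0 0 * A 1 1 - A 0 1 * A 1 0 = 1 := by
      rw [← Matrix.det_fin_two]; exact A.det_coe
    simp only [LinearMap.add_apply, LinearMap.id_apply, LinearMap.smul_apply,
      LinearMap.smulRight_apply, LinearMap.proj_apply, map_add, map_smul, smul_eq_mul,
      spForm_vecA, spForm_vecB, vecA_spForm, vecB_spForm, vecA_inl, vecA_inr, vecB_inl, vecB_inr,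
      if_true]
    linear_combination (u (Sum.inr j) * v (Sum.inl j) - u (Sum.inl j) * v (Sum.inr j)) * hdet

@[simp]
theorem spAct_etaAt (j : Fin g) (A : Matrix.SpecialLinearGroup (Fin 2) ℤ)
    (u : Fin g ⊕ Fin g → ℤ) : spAct g (etaAt j A) u =
      u + ((A 0 0 - 1) * u (Sum.inl j) + A 0 1 * u (Sum.inr j)) • vecA j +
        (A 1 0 * u (Sum.inl j) + (A 1 1 - 1) * u (Sum.inr j)) • vecB j := by
  simp [etaAt]

theorem etaAt_mul (j : Fin g) (A B : Matrix.SpecialLinearGroup (Fin 2) ℤ) :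
    etaAt j (A * B) = etaAt j A * etaAt j B := by
  refine ext_of_spAct fun u => ?_
  rw [spAct_mul_apply]
  simp only [spAct_etaAt, Matrix.SpecialLinearGroup.coe_mul, Matrix.mul_apply, Fin.sum_univ_two,
    Pi.add_apply, Pi.smul_apply, smul_eq_mul, vecA_inl, vecA_inr, vecB_inl, vecB_inr, if_true]
  module

theorem etaAt_one (j : Fin g) : etaAt j 1 = 1 := by
  have h := etaAt_mul j 1 1
  rw [mul_one] at h
  exact left_eq_mul.1 h

/-- `etaAt` as a homomorphism. -/
def etaHom (j : Fin g) :
    Matrix.SpecialLinearGroup (Fin 2) ℤ →* Matrix.symplecticGroup (Fin g) ℤ where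
  toFun := etaAt j
  map_one' := etaAt_one j
  map_mul' := etaAt_mul j

theorem eta_eq_etaAt [NeZero g] (A : Matrix.SpecialLinearGroup (Fin 2) ℤ) :
    eta g A = etaAt 0 A := by
  refine ext_of_spAct fun u => ?_
  rw [spAct_apply, spAct_etaAt]
  simp only [eta, Matrix.fromBlocks_mulVec]
  ext p
  rcases p with i | i <;> by_cases h : i = 0
  · subst h
    simp [Matrix.mulVec_diagonal]; ring
  · simp [Matrix.mulVec_diagonal, h]
  · subst h
    simp [Matrix.mulVec_diagonal]; ring
  · simp [Matrix.mulVec_diagonal, h]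

theorem etaAt_T (j : Fin g) : etaAt j ModularGroup.T = transv 1 (vecA j) := by
  refine ext_of_spAct fun u => ?_
  rw [spAct_etaAt, spAct_transv, ModularGroup.coe_T]
  simp

theorem etaAt_S (j : Fin g) : etaAt j ModularGroup.S =
    transv (-1) (vecA j) * transv (-1) (vecB j) * transv (-1) (vecA j) := by
  refine ext_of_spAct fun u => ?_
  rw [spAct_mul_apply, spAct_mul_apply, spAct_etaAt, ModularGroup.coe_S]
  simp only [spAct_transv, map_add, map_smul, spForm_vecA, spForm_vecB, vecA_inl, vecA_inr,
    vecB_inr, if_true, Matrix.of_apply, Matrix.cons_val_zero, Matrix.cons_val_one]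
  module

/-- `SL(2, ℤ)` is generated by `S` and `T`, and both are words in the two transvections. -/
theorem etaAt_mem {H : Subgroup (Matrix.symplecticGroup (Fin g) ℤ)} {j : Fin g}
    (hA : transv 1 (vecA j) ∈ H) (hB : transv 1 (vecB j) ∈ H)
    (A : Matrix.SpecialLinearGroup (Fin 2) ℤ) : etaAt j A ∈ H := by
  have h : Subgroup.closure {ModularGroup.S, ModularGroup.T} ≤ H.comap (etaHom j) := by
    rw [Subgroup.closure_le]
    rintro _ (rfl | rfl)
    · change etaAt j _ ∈ H
      rw [etaAt_S, transv_neg, transv_neg]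
      exact H.mul_mem (H.mul_mem (H.inv_mem hA) (H.inv_mem hB)) (H.inv_mem hA)
    · change etaAt j _ ∈ H
      rwa [etaAt_T]
  rw [SpecialLinearGroup.SL2Z_generators] at h
  exact h (Subgroup.mem_top A)

end Transvections

/-! ### Generation by transvections and the first handle -/

section Generation

variable {g : ℕ}

/-- The span of the handles of index greater than `j`. -/
def handlesAbove (j : Fin g) : AddSubgroup (Fin g ⊕ Fin g → ℤ) where
  carrier := {z | ∀ i ≤ j, z (Sum.inl i) = 0 ∧ z (Sum.inr i) = 0}
  zero_mem' _ _ := ⟨rfl, rfl⟩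
  add_mem' hz hw i hi := ⟨by simp [(hz i hi).1, (hw i hi).1], by simp [(hz i hi).2, (hw i hi).2]⟩
  neg_mem' hz i hi := ⟨by simp [(hz i hi).1], by simp [(hz i hi).2]⟩

/-- `M` fixes the vectors `a_i`, `b_i` for `i < n`. -/
def FixesBelow (n : ℕ) (M : Matrix.symplecticGroup (Fin g) ℤ) : Prop :=
  ∀ i : Fin g, i.val < n → spAct g M (vecA i) = vecA i ∧ spAct g M (vecB i) = vecB i

theorem FixesBelow.mul {n : ℕ} {M N : Matrix.symplecticGroup (Fin g) ℤ} (hM : FixesBelow n M)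
    (hN : FixesBelow n N) : FixesBelow n (M * N) := fun i hi => by
  rw [spAct_mul_apply, spAct_mul_apply, (hN i hi).1, (hN i hi).2]
  exact hM i hi

theorem FixesBelow.inv {n : ℕ} {M : Matrix.symplecticGroup (Fin g) ℤ} (hM : FixesBelow n M) :
    FixesBelow n M⁻¹ := fun i hi =>
  ⟨spAct_inv_apply_eq M (hM i hi).1, spAct_inv_apply_eq M (hM i hi).2⟩

/-- The image of a vector which is orthogonal to the handles below `n`. -/
theorem FixesBelow.coord {n : ℕ} {M : Matrix.symplecticGroup (Fin g) ℤ} (hM : FixesBelow n M)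
    (u : Fin g ⊕ Fin g → ℤ) {i : Fin g} (hi : i.val < n) :
    spAct g M u (Sum.inl i) = u (Sum.inl i) ∧ spAct g M u (Sum.inr i) = u (Sum.inr i) := by
  constructor
  · rw [← vecB_spForm u, ← vecB_spForm (spAct g M u), ← spForm_spAct M (vecB i) u, (hM i hi).2]
  · rw [← spForm_vecA u, ← spForm_vecA (spAct g M u), ← spForm_spAct M u (vecA i), (hM i hi).1]

theorem spForm_handlesAbove {j : Fin g} {z : Fin g ⊕ Fin g → ℤ} (hz : z ∈ handlesAbove j)
    {i : Fin g} (hi : i ≤ j) : spForm g (vecA i) z = 0 ∧ spForm g (vecB i) z = 0 := by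
  rw [vecA_spForm, vecB_spForm, (hz i hi).1, (hz i hi).2]
  simp

theorem vecA_mem_handlesAbove {i j : Fin g} (h : j < i) : vecA i ∈ handlesAbove j :=
  fun l hl => by simp [(hl.trans_lt h).ne]

theorem vecB_mem_handlesAbove {i j : Fin g} (h : j < i) : vecB i ∈ handlesAbove j :=
  fun l hl => by simp [(hl.trans_lt h).ne]

theorem fixesBelow_transv {j : Fin g} {z : Fin g ⊕ Fin g → ℤ} (hz : z ∈ handlesAbove j) (n : ℤ) :
    FixesBelow (j.val + 1) (transv n z) := fun i hi => by
  obtain ⟨h1, h2⟩ := spForm_handlesAbove hz (i := i) (Nat.le_of_lt_succ hi)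
  rw [spAct_transv, spAct_transv, h1, h2]
  simp

theorem fixesBelow_etaAt (j : Fin g) (A : Matrix.SpecialLinearGroup (Fin 2) ℤ) :
    FixesBelow j.val (etaAt j A) := fun i hi => by
  have h : j ≠ i := fun h => by subst h; exact lt_irrefl _ hi
  constructor <;> rw [spAct_etaAt] <;> simp [h]

theorem etaAt_handlesAbove (j : Fin g) (A : Matrix.SpecialLinearGroup (Fin 2) ℤ)
    {z : Fin g ⊕ Fin g → ℤ} (hz : z ∈ handlesAbove j) : spAct g (etaAt j A) z = z := by
  rw [spAct_etaAt, (hz j le_rfl).1, (hz j le_rfl).2]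
  simp

theorem fixesBelow_eichler {j : Fin g} {z : Fin g ⊕ Fin g → ℤ} (hz : z ∈ handlesAbove j) :
    FixesBelow j.val (eichler (vecA j) z) := fun i hi => by
  have h : i ≠ j := fun h => by subst h; exact lt_irrefl _ hi
  obtain ⟨h1, h2⟩ := spForm_handlesAbove hz (i := i) (le_of_lt hi)
  have h3 := (spForm_handlesAbove hz le_rfl).1
  rw [spAct_eichler h3, spAct_eichler h3, h1, h2]
  simp [h.symm]

/-- A step towards unimodularity: if `x`, `y`, `d` are coprime and `y ≠ 0`, then `x + n d` and `y`
are coprime for some `n`. -/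
theorem exists_isCoprime_add_mul {x y d : ℤ} (hy : y ≠ 0)
    (h : ∀ p : ℕ, p.Prime → (p : ℤ) ∣ x → (p : ℤ) ∣ y → (p : ℤ) ∣ d → False) :
    ∃ n : ℤ, IsCoprime (x + n * d) y := by
  classical
  set s := y.natAbs.primeFactors.filter fun p : ℕ => ¬ (p : ℤ) ∣ x
  -- Take the product of the primes that divide `y` but not `x`. A prime divisor of `y` then divides
  -- exactly one of `x` and `n * d`, hence not their sum.
  refine ⟨((∏ q ∈ s, q : ℕ) : ℤ), ?_⟩
  rw [Int.isCoprime_iff_gcd_eq_one]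
  by_contra hne
  obtain ⟨p, hp, hpd⟩ := Nat.exists_prime_and_dvd hne
  have h1 : (p : ℤ) ∣ x + ((∏ q ∈ s, q : ℕ) : ℤ) * d :=
    (Int.natCast_dvd_natCast.2 hpd).trans (Int.gcd_dvd_left ..)
  have h2 : (p : ℤ) ∣ y := (Int.natCast_dvd_natCast.2 hpd).trans (Int.gcd_dvd_right ..)
  by_cases hx : (p : ℤ) ∣ x
  · rcases (Nat.prime_iff_prime_int.1 hp).dvd_or_dvd ((dvd_add_right hx).1 h1) with h3 | h3
    · obtain ⟨q, hq, hpq⟩ := (hp.prime.dvd_finsetProd_iff _).1 (Int.natCast_dvd_natCast.1 h3)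
      obtain ⟨hq1, hq2⟩ := Finset.mem_filter.1 hq
      rw [(Nat.prime_dvd_prime_iff_eq hp (Nat.prime_of_mem_primeFactors hq1)).1 hpq] at hx
      exact hq2 hx
    · exact h p hp hx h2 h3
  · have hs : p ∈ s := Finset.mem_filter.2
      ⟨Nat.mem_primeFactors.2 ⟨hp, Int.natCast_dvd.1 h2, Int.natAbs_ne_zero.2 hy⟩, hx⟩
    have h3 : (p : ℤ) ∣ ((∏ q ∈ s, q : ℕ) : ℤ) :=
      Int.natCast_dvd_natCast.2 (Finset.dvd_prod_of_mem _ hs)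
    exact hx ((dvd_add_left (h3.mul_right d)).1 h1)

/-! ### Reduction of a matrix to one that fixes a further handle -/

variable {H : Subgroup (Matrix.symplecticGroup (Fin g) ℤ)} {j : Fin g} {k : ℕ}

theorem transv_vecA_eq (j : Fin g) (n : ℤ) : transv n (vecA j) = etaAt j (ModularGroup.T ^ n) := by
  refine ext_of_spAct fun u => ?_
  rw [spAct_etaAt, spAct_transv, ModularGroup.coe_T_zpow]
  simp

theorem transv_vecA_mem (hη : ∀ A ∈ CongruenceSubgroup.Gamma1 k, etaAt j A ∈ H) (n : ℤ) :
    transv n (vecA j) ∈ H := by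
  rw [transv_vecA_eq]
  refine hη _ ((CongruenceSubgroup.Gamma1_mem k _).2 ?_)
  rw [ModularGroup.coe_T_zpow]
  simp

/-- The transvection along `a_j - a_{j+1}` gives the Eichler map for `z = a_{j+1}`. Conjugation by
matrices that fix the handles up to `j`, together with additivity, spreads this to all `z`. -/
theorem eichler_mem (hfix : ∀ M, FixesBelow (j.val + 1) M → M ∈ H)
    (hη : ∀ A ∈ CongruenceSubgroup.Gamma1 k, etaAt j A ∈ H)
    (hc : ∀ hj : j.val + 1 < g, transv 1 (vecA j - vecA ⟨j.val + 1, hj⟩) ∈ H)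
    {z : Fin g ⊕ Fin g → ℤ} (hz : z ∈ handlesAbove j) : eichler (vecA j) z ∈ H := by
  by_cases hj : j.val + 1 < g
  swap
  · have : z = 0 := by
      ext p
      rcases p with i | i
      · exact (hz i (by rw [Fin.le_def]; omega)).1
      · exact (hz i (by rw [Fin.le_def]; omega)).2
    rw [this, eichler_zero]
    exact H.one_mem
  have horth : ∀ {z}, z ∈ handlesAbove j → spForm g (vecA j) z = 0 :=
    fun hz => (spForm_handlesAbove hz le_rfl).1
  set l : Fin g := ⟨j.val + 1, hj⟩
  have hl : j < l := Fin.lt_def.2 (Nat.lt_succ_self _)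
  have hadd : ∀ {z w}, z ∈ handlesAbove j → w ∈ handlesAbove j → eichler (vecA j) z ∈ H →
      eichler (vecA j) w ∈ H → eichler (vecA j) (z + w) ∈ H := fun hz hw hz' hw' => by
    rw [eichler_add (horth hz) (horth hw)]
    exact H.mul_mem (transv_vecA_mem hη _) (H.mul_mem hz' hw')
  have hneg : ∀ {z}, z ∈ handlesAbove j → eichler (vecA j) z ∈ H →
      eichler (vecA j) (-z) ∈ H := fun hz hz' => by
    rw [eichler_neg (horth hz)]
    exact H.inv_mem hz'
  have hconj : ∀ {z} M, FixesBelow (j.val + 1) M → z ∈ handlesAbove j →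
      eichler (vecA j) z ∈ H → eichler (vecA j) (spAct g M z) ∈ H := fun M hM hz hz' => by
    have := eichler_conj M (horth hz)
    rw [(hM j (Nat.lt_succ_self _)).1] at this
    rw [this]
    exact H.mul_mem (H.mul_mem (hfix M hM) hz') (H.inv_mem (hfix M hM))
  have hAl := vecA_mem_handlesAbove hl
  have hBl := vecB_mem_handlesAbove hl
  -- By definition the Eichler map for `-vecA l` is the transvection along `vecA j - vecA l` times
  -- transvections along `vecA j` and `-vecA l`, and those lie in `H`.
  have ha : eichler (vecA j) (vecA l) ∈ H := by
    have h1 : eichler (vecA j) (-vecA l) ∈ H := by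
      rw [eichler, ← sub_eq_add_neg]
      exact H.mul_mem (H.mul_mem (hc hj) (transv_vecA_mem hη _))
        (hfix _ (fixesBelow_transv (neg_mem hAl) _))
    simpa using hneg (neg_mem hAl) h1
  -- The transvection along `z` fixes `vecA j` and takes `vecA l` to `vecA l + z`; the summand `vecA
  -- l` is then subtracted.
  have hone : ∀ {z}, z ∈ handlesAbove j → spForm g (vecA l) z = 1 → eichler (vecA j) z ∈ H := by
    intro z hz h1
    have h2 := hconj _ (fixesBelow_transv hz 1) hAl ha
    rw [spAct_transv, h1, mul_one, one_smul] at h2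
    simpa using hadd (neg_mem hAl) (add_mem hAl hz) (hneg hAl ha) h2
  have hb : ∀ n : ℤ, eichler (vecA j) (n • vecB l) ∈ H := by
    have h0 : eichler (vecA j) (vecB l) ∈ H := by
      have := hneg (neg_mem hBl) (hone (neg_mem hBl) (by simp))
      simpa using this
    intro n
    induction n using Int.induction_on with
    | zero => rw [zero_smul, eichler_zero]; exact H.one_mem
    | succ n ih =>
      rw [add_smul, one_smul]
      exact hadd (zsmul_mem hBl _) hBl ih h0
    | pred n ih =>
      rw [sub_smul, one_smul, sub_eq_add_neg]
      exact hadd (zsmul_mem hBl _) (neg_mem hBl) ih (hneg hBl h0)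
  -- Since `vecA l` pairs to `-1` with `vecB l`, adding `(m - 1) • vecB l` makes the pairing equal
  -- to `1`. The added multiple is removed again by `hb`.
  set m := spForm g (vecA l) z
  have h1 : z + (m - 1) • vecB l ∈ handlesAbove j := add_mem hz (zsmul_mem hBl _)
  have h2 := hone h1 (by
    rw [map_add, map_smul, spForm_vecB, vecA_inl, if_pos rfl, smul_eq_mul]
    change m + _ = 1
    ring)
  have h3 := hadd h1 (zsmul_mem hBl _) h2 (hb (-(m - 1)))
  rwa [neg_smul, add_neg_cancel_right] at h3

/-- The part of a vector in the handles above `j`, if its coordinates below `j` vanish. -/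
theorem sub_mem_handlesAbove {u : Fin g ⊕ Fin g → ℤ}
    (hu : ∀ i < j, u (Sum.inl i) = 0 ∧ u (Sum.inr i) = 0) :
    u - u (Sum.inl j) • vecA j - u (Sum.inr j) • vecB j ∈ handlesAbove j := fun i hi => by
  rcases hi.lt_or_eq with h | rfl
  · simp [hu i h, h.ne]
  · simp

theorem FixesBelow.coord_vecA {M : Matrix.symplecticGroup (Fin g) ℤ} (hM : FixesBelow j.val M)
    {i : Fin g} (hi : i < j) :
    spAct g M (vecA j) (Sum.inl i) = 0 ∧ spAct g M (vecA j) (Sum.inr i) = 0 := by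
  obtain ⟨h1, h2⟩ := hM.coord (vecA j) hi
  rw [h1, h2]
  simp [hi.ne]

theorem FixesBelow.coord_vecB {M : Matrix.symplecticGroup (Fin g) ℤ} (hM : FixesBelow j.val M)
    {i : Fin g} (hi : i < j) :
    spAct g M (vecB j) (Sum.inl i) = 0 ∧ spAct g M (vecB j) (Sum.inr i) = 0 := by
  obtain ⟨h1, h2⟩ := hM.coord (vecB j) hi
  rw [h1, h2]
  simp [hi.ne]

/-- As `M` fixes `a_j` and the form, the image of `b_j` is `b_j` plus a multiple of `a_j` plus a
vector `w` in the later handles. An Eichler map removes `w` and a transvection along `a_j` removes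
the multiple; both fix `a_j`. -/
theorem mem_of_fixes_vecA (hfix : ∀ M, FixesBelow (j.val + 1) M → M ∈ H)
    (hη : ∀ A ∈ CongruenceSubgroup.Gamma1 k, etaAt j A ∈ H)
    (hE : ∀ z ∈ handlesAbove j, eichler (vecA j) z ∈ H)
    {M : Matrix.symplecticGroup (Fin g) ℤ} (hM : FixesBelow j.val M)
    (ha : spAct g M (vecA j) = vecA j) : M ∈ H := by
  set u := spAct g M (vecB j)
  have hy : u (Sum.inr j) = 1 := by
    have := spForm_spAct M (vecB j) (vecA j)
    rw [ha, spForm_vecA, spForm_vecA, vecB_inr, if_pos rfl] at this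
    exact this
  set w := u - u (Sum.inl j) • vecA j - u (Sum.inr j) • vecB j
  have hw : w ∈ handlesAbove j := sub_mem_handlesAbove fun i hi => hM.coord_vecB hi
  have hu : u = u (Sum.inl j) • vecA j + vecB j + w := by
    simp only [w, hy]
    module
  have hw' := neg_mem hw
  have horth := (spForm_handlesAbove hw' le_rfl).1
  set x := spForm g u (-w)
  set n := -(u (Sum.inl j) + x)
  have hN : transv n (vecA j) * eichler (vecA j) (-w) * M ∈ H := by
    refine hfix _ fun i hi => ?_
    rcases Nat.lt_succ_iff_lt_or_eq.1 hi with h | h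
    · have h1 : FixesBelow j.val (transv n (vecA j)) := by
        rw [transv_vecA_eq]
        exact fixesBelow_etaAt _ _
      exact ((h1.mul (fixesBelow_eichler hw')).mul hM) i h
    · obtain rfl : i = j := Fin.ext h
      rw [spAct_mul_apply, spAct_mul_apply, spAct_mul_apply, spAct_mul_apply, ha,
        spAct_eichler horth, spAct_eichler horth]
      constructor
      · rw [horth]
        simp
      · change spAct g (transv n (vecA i)) (u + x • vecA i + spForm g u (vecA i) • -w) = vecB i
        have e : u + x • vecA i + spForm g u (vecA i) • -w =
            (u (Sum.inl i) + x) • vecA i + vecB i := by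
          rw [spForm_vecA, hy]
          conv_lhs => rw [hu]
          module
        rw [e, spAct_transv]
        simp only [spForm_vecA, Pi.add_apply, Pi.smul_apply, vecA_inr, vecB_inr, if_true, n]
        module
  have := H.mul_mem (H.inv_mem (H.mul_mem (transv_vecA_mem hη n) (hE _ hw'))) hN
  rwa [inv_mul_cancel_left] at this

/-- `M` fixes the handles below `j`, and `a_j` modulo `k`. -/
def FixesMod (j : Fin g) (k : ℕ) (M : Matrix.symplecticGroup (Fin g) ℤ) : Prop :=
  FixesBelow j.val M ∧ ∃ t, spAct g M (vecA j) = vecA j + (k : ℤ) • t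

theorem FixesMod.mul {M N : Matrix.symplecticGroup (Fin g) ℤ} (hM : FixesMod j k M)
    (hN : FixesMod j k N) : FixesMod j k (M * N) := by
  obtain ⟨hM, t, ht⟩ := hM
  obtain ⟨hN, s, hs⟩ := hN
  refine ⟨hM.mul hN, t + spAct g M s, ?_⟩
  rw [spAct_mul_apply, hs, map_add, map_smul, ht, smul_add, add_assoc]

theorem fixesMod_etaAt {A : Matrix.SpecialLinearGroup (Fin 2) ℤ}
    (hA : A ∈ CongruenceSubgroup.Gamma1 k) : FixesMod j k (etaAt j A) := by
  obtain ⟨h0, -, h1⟩ := (CongruenceSubgroup.Gamma1_mem k A).1 hA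
  obtain ⟨c, hc⟩ := (ZMod.intCast_zmod_eq_zero_iff_dvd (A 0 0 - 1) k).1 (by simp [h0])
  obtain ⟨d, hd⟩ := (ZMod.intCast_zmod_eq_zero_iff_dvd _ k).1 h1
  refine ⟨fixesBelow_etaAt j A, c • vecA j + d • vecB j, ?_⟩
  rw [spAct_etaAt, hc, hd]
  simp only [vecA_inl, vecA_inr, if_true]
  module

theorem spAct_eichler_vecA {z : Fin g ⊕ Fin g → ℤ} (hz : z ∈ handlesAbove j) :
    spAct g (eichler (vecA j) z) (vecA j) = vecA j := by
  have h := (spForm_handlesAbove hz le_rfl).1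
  rw [spAct_eichler h, h, spForm_self]
  simp

theorem fixesMod_eichler {z : Fin g ⊕ Fin g → ℤ} (hz : z ∈ handlesAbove j) :
    FixesMod j k (eichler (vecA j) z) :=
  ⟨fixesBelow_eichler hz, 0, by rw [spAct_eichler_vecA hz, smul_zero, add_zero]⟩

/-- The lower triangular matrix with entry `n`. -/
def lowerSL (n : ℤ) : Matrix.SpecialLinearGroup (Fin 2) ℤ := ⟨!![1, 0; n, 1], by simp⟩

theorem lowerSL_mem (k : ℕ) : lowerSL k ∈ CongruenceSubgroup.Gamma1 k :=
  (CongruenceSubgroup.Gamma1_mem k _).2 (by simp [lowerSL])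

variable {M : Matrix.symplecticGroup (Fin g) ℤ}

/-- Now `M a_j = a_j + k t` with `t` in the later handles. The matrix `lowerSL k` takes `a_j` to
`a_j + k b_j` and fixes `t`, so by conjugation the Eichler map of `a_j + k b_j` and `t` lies in `H`.
It carries `a_j + k t` back to `a_j`. -/
theorem mem_of_coord_eq (hk : k ≠ 0) (hfix : ∀ M, FixesBelow (j.val + 1) M → M ∈ H)
    (hη : ∀ A ∈ CongruenceSubgroup.Gamma1 k, etaAt j A ∈ H)
    (hE : ∀ z ∈ handlesAbove j, eichler (vecA j) z ∈ H) (hM : FixesMod j k M)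
    (hx : spAct g M (vecA j) (Sum.inl j) = 1) (hy : spAct g M (vecA j) (Sum.inr j) = 0) :
    M ∈ H := by
  obtain ⟨hM, t, ht⟩ := hM
  have hk' : (k : ℤ) ≠ 0 := by exact_mod_cast hk
  have htW : t ∈ handlesAbove j := by
    have h : ∀ p, (k : ℤ) * t p = spAct g M (vecA j) p - vecA j p := fun p => by
      rw [ht]; simp
    intro i hi
    have h0 : spAct g M (vecA j) (Sum.inl i) - vecA j (Sum.inl i) = 0 ∧
        spAct g M (vecA j) (Sum.inr i) - vecA j (Sum.inr i) = 0 := by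
      rcases hi.lt_or_eq with h | rfl
      · rw [(hM.coord_vecA h).1, (hM.coord_vecA h).2]
        simp [h.ne]
      · rw [hx, hy]
        simp
    exact ⟨(mul_eq_zero.1 ((h _).trans h0.1)).resolve_left hk',
      (mul_eq_zero.1 ((h _).trans h0.2)).resolve_left hk'⟩
  set L := etaAt j (lowerSL k)
  have hL : L ∈ H := hη _ (lowerSL_mem k)
  have hLb : FixesBelow j.val L := fixesBelow_etaAt j _
  have horth := (spForm_handlesAbove htW le_rfl).1
  have horthB := (spForm_handlesAbove htW le_rfl).2
  have hLa : spAct g L (vecA j) = vecA j + (k : ℤ) • vecB j := by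
    rw [spAct_etaAt]
    simp [lowerSL]
  have hconj := eichler_conj L horth
  rw [etaAt_handlesAbove j _ htW, hLa] at hconj
  have hN : eichler (vecA j + (k : ℤ) • vecB j) t ∈ H := by
    rw [hconj]
    exact H.mul_mem (H.mul_mem hL (hE _ htW)) (H.inv_mem hL)
  have hNb : FixesBelow j.val (eichler (vecA j + (k : ℤ) • vecB j) t) := by
    rw [hconj]
    exact (hLb.mul (fixesBelow_eichler htW)).mul hLb.inv
  -- The pairing of `a_j + k t` with `a_j + k b_j` is `-k` and that with `t` is `0`, so the Eichler
  -- map subtracts exactly `k t`.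
  have hNM := mem_of_fixes_vecA hfix hη hE (hNb.mul hM) (by
    have h0 : spForm g (vecA j + (k : ℤ) • vecB j) t = 0 := by
      rw [map_add, map_smul, LinearMap.add_apply, LinearMap.smul_apply, horth, horthB]
      simp
    have h1 : t (Sum.inr j) = 0 := (htW j le_rfl).2
    have h2 : t (Sum.inl j) = 0 := (htW j le_rfl).1
    rw [spAct_mul_apply, ht, spAct_eichler h0]
    simp only [map_add, map_smul, LinearMap.add_apply, LinearMap.smul_apply, spForm_self, horth,
      spForm_vecA, spForm_vecB, vecA_inl, h1, h2, if_true, smul_eq_mul]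
    module)
  have := H.mul_mem (H.inv_mem hN) hNM
  rwa [inv_mul_cancel_left] at this

/-- With `p x + q y = 1`, the matrix with rows `(p, q)` and `(-y, x)` takes `(x, y)` to `(1, 0)`. It
lies in `Γ_1(k)`: since `x ≡ 1` and `y ≡ 0`, also `p ≡ 1` modulo `k`. -/
theorem mem_of_isCoprime (hk : k ≠ 0) (hfix : ∀ M, FixesBelow (j.val + 1) M → M ∈ H)
    (hη : ∀ A ∈ CongruenceSubgroup.Gamma1 k, etaAt j A ∈ H)
    (hE : ∀ z ∈ handlesAbove j, eichler (vecA j) z ∈ H) (hM : FixesMod j k M)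
    (hxy : IsCoprime (spAct g M (vecA j) (Sum.inl j)) (spAct g M (vecA j) (Sum.inr j))) :
    M ∈ H := by
  obtain ⟨p, q, hpq⟩ := hxy
  obtain ⟨t, ht⟩ := hM.2
  set v := spAct g M (vecA j)
  set x := v (Sum.inl j)
  set y := v (Sum.inr j)
  have hx : (x : ZMod k) = 1 := by
    have : x = 1 + k * t (Sum.inl j) := by simp only [x, ht]; simp
    rw [this]; simp
  have hy : (y : ZMod k) = 0 := by
    have : y = k * t (Sum.inr j) := by simp only [y, ht]; simp
    rw [this]; simp
  have hp : (p : ZMod k) = 1 := by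
    have := congrArg (Int.cast : ℤ → ZMod k) hpq
    push_cast at this
    rwa [hx, hy, mul_one, mul_zero, add_zero] at this
  let A : Matrix.SpecialLinearGroup (Fin 2) ℤ := ⟨!![p, q; -y, x], by
    rw [Matrix.det_fin_two_of, ← hpq]; ring⟩
  have hA : A ∈ CongruenceSubgroup.Gamma1 k :=
    (CongruenceSubgroup.Gamma1_mem k _).2 (by simp [A, hx, hy, hp])
  have hv : spAct g (etaAt j A * M) (vecA j) =
      v + ((p - 1) * x + q * y) • vecA j + (-y * x + (x - 1) * y) • vecB j := by
    rw [spAct_mul_apply, spAct_etaAt]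
    rfl
  have hN := mem_of_coord_eq hk hfix hη hE ((fixesMod_etaAt hA).mul hM)
    (by
      rw [hv]
      simp only [Pi.add_apply, Pi.smul_apply, vecA_inl, vecB_inl, if_true, smul_eq_mul]
      change x + _ + _ = 1
      linear_combination hpq)
    (by
      rw [hv]
      simp only [Pi.add_apply, Pi.smul_apply, vecA_inr, vecB_inr, if_true, smul_eq_mul]
      change y + _ + _ = 0
      ring)
  have := H.mul_mem (H.inv_mem (hη A hA)) hN
  rwa [inv_mul_cancel_left] at this

/-- There is a vector in the handles above `j` which witnesses that the image of `a_j` is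
unimodular. -/
theorem exists_handlesAbove_unimodular (hM : FixesBelow j.val M) :
    ∃ w ∈ handlesAbove j, ∃ p q : ℤ, p * spAct g M (vecA j) (Sum.inl j) +
      q * spAct g M (vecA j) (Sum.inr j) + spForm g (spAct g M (vecA j)) w = 1 := by
  set v := spAct g M (vecA j)
  set u := spAct g M (vecB j)
  -- The images `v` of `a_j` and `u` of `b_j` still pair to `-1`. Splitting `u` into its part in the
  -- handle `j` and the rest gives the relation, after a change of sign.
  refine ⟨-(u - u (Sum.inl j) • vecA j - u (Sum.inr j) • vecB j),
    neg_mem (sub_mem_handlesAbove fun i hi => hM.coord_vecB hi), u (Sum.inr j),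
    -u (Sum.inl j), ?_⟩
  have h : spForm g v u = -1 := by
    rw [spForm_spAct]
    simp
  simp only [map_neg, map_sub, map_smul, h, spForm_vecA, spForm_vecB, smul_eq_mul]
  ring

theorem coord_eichler_mul {w : Fin g ⊕ Fin g → ℤ} (hw : w ∈ handlesAbove j) :
    spAct g (eichler (vecA j) w * M) (vecA j) (Sum.inl j) =
        spAct g M (vecA j) (Sum.inl j) + spForm g (spAct g M (vecA j)) w ∧
      spAct g (eichler (vecA j) w * M) (vecA j) (Sum.inr j) =
        spAct g M (vecA j) (Sum.inr j) := by
  rw [spAct_mul_apply, spAct_eichler (spForm_handlesAbove hw le_rfl).1]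
  simp [(hw j le_rfl).1, (hw j le_rfl).2]

/-- The Eichler map of `n w` adds `n ω(M a_j, w)` to the first coordinate and keeps the second. As
the two coordinates and this pairing are coprime together, a suitable `n` makes the coordinates
coprime. -/
theorem mem_of_coordB_ne_zero (hk : k ≠ 0) (hfix : ∀ M, FixesBelow (j.val + 1) M → M ∈ H)
    (hη : ∀ A ∈ CongruenceSubgroup.Gamma1 k, etaAt j A ∈ H)
    (hE : ∀ z ∈ handlesAbove j, eichler (vecA j) z ∈ H) (hM : FixesMod j k M)
    (hy : spAct g M (vecA j) (Sum.inr j) ≠ 0) : M ∈ H := by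
  obtain ⟨w, hw, p, q, hpq⟩ := exists_handlesAbove_unimodular hM.1
  obtain ⟨n, hn⟩ := exists_isCoprime_add_mul (x := spAct g M (vecA j) (Sum.inl j))
    (d := spForm g (spAct g M (vecA j)) w) hy fun l hl h1 h2 h3 => by
      refine (Nat.prime_iff_prime_int.1 hl).not_dvd_one ?_
      rw [← hpq]
      exact dvd_add (dvd_add (h1.mul_left p) (h2.mul_left q)) h3
  have hnw := zsmul_mem hw n
  obtain ⟨e1, e2⟩ := coord_eichler_mul (M := M) hnw
  have hN := mem_of_isCoprime hk hfix hη hE ((fixesMod_eichler hnw).mul hM) (by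
    rw [e1, e2, map_smul]
    exact hn)
  have := H.mul_mem (H.inv_mem (hE _ hnw)) hN
  rwa [inv_mul_cancel_left] at this

/-- If the second coordinate vanishes, `lowerSL k` replaces it by `k` times the first, which is not
zero. -/
theorem mem_of_coordA_ne_zero (hk : k ≠ 0) (hfix : ∀ M, FixesBelow (j.val + 1) M → M ∈ H)
    (hη : ∀ A ∈ CongruenceSubgroup.Gamma1 k, etaAt j A ∈ H)
    (hE : ∀ z ∈ handlesAbove j, eichler (vecA j) z ∈ H) (hM : FixesMod j k M)
    (hx : spAct g M (vecA j) (Sum.inl j) ≠ 0) : M ∈ H := by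
  by_cases hy : spAct g M (vecA j) (Sum.inr j) = 0
  swap
  · exact mem_of_coordB_ne_zero hk hfix hη hE hM hy
  have hL := lowerSL_mem k
  have hN := mem_of_coordB_ne_zero hk hfix hη hE ((fixesMod_etaAt hL).mul hM) (by
    rw [spAct_mul_apply, spAct_etaAt]
    simp [lowerSL, hy, hx, hk])
  have := H.mul_mem (H.inv_mem (hη _ hL)) hN
  rwa [inv_mul_cancel_left] at this

/-- The symplectic matrices which fix the handles below `j`, and `a_j` modulo `k`, are generated by
those which fix the handles up to `j`, by `Γ_1(k)`, and by the transvection along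
`a_j - a_{j+1}`. -/
theorem mem_of_fixesMod (hk : k ≠ 0) (hfix : ∀ M, FixesBelow (j.val + 1) M → M ∈ H)
    (hη : ∀ A ∈ CongruenceSubgroup.Gamma1 k, etaAt j A ∈ H)
    (hc : ∀ hj : j.val + 1 < g, transv 1 (vecA j - vecA ⟨j.val + 1, hj⟩) ∈ H)
    (hM : FixesMod j k M) : M ∈ H := by
  have hE : ∀ z ∈ handlesAbove j, eichler (vecA j) z ∈ H := fun z => eichler_mem hfix hη hc
  by_cases hx : spAct g M (vecA j) (Sum.inl j) = 0
  swap
  · exact mem_of_coordA_ne_zero hk hfix hη hE hM hx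
  by_cases hy : spAct g M (vecA j) (Sum.inr j) = 0
  swap
  · exact mem_of_coordB_ne_zero hk hfix hη hE hM hy
  -- Both coordinates vanish, which can happen only for `k = 1`. Then `w` pairs to `1` with the
  -- image of `a_j`, and its Eichler map makes the first coordinate equal to `1`.
  obtain ⟨w, hw, p, q, hpq⟩ := exists_handlesAbove_unimodular hM.1
  rw [hx, hy, mul_zero, mul_zero, add_zero, zero_add] at hpq
  have hN := mem_of_coordA_ne_zero hk hfix hη hE ((fixesMod_eichler hw).mul hM) (by
    rw [(coord_eichler_mul hw).1, hx, hpq]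
    norm_num)
  have := H.mul_mem (H.inv_mem (hE _ hw)) hN
  rwa [inv_mul_cancel_left] at this

/-- The symplectic matrices which fix the handles below `n` are generated by transvections. -/
theorem mem_of_fixesBelow {M : Matrix.symplecticGroup (Fin g) ℤ} (n : ℕ)
    (hA : ∀ i : Fin g, n ≤ i.val → transv 1 (vecA i) ∈ H)
    (hB : ∀ i : Fin g, n ≤ i.val → transv 1 (vecB i) ∈ H)
    (hC : ∀ (i : Fin g) (hi : i.val + 1 < g), n ≤ i.val →
      transv 1 (vecA i - vecA ⟨i.val + 1, hi⟩) ∈ H)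
    (hM : FixesBelow n M) : M ∈ H := by
  by_cases hn : n < g
  swap
  · have : M = 1 := by
      refine spAct_ext (fun i => ?_) fun i => ?_
      · rw [map_one]
        exact (hM i (by omega)).1
      · rw [map_one]
        exact (hM i (by omega)).2
    rw [this]
    exact H.one_mem
  -- Modulo `1` the condition on `a_j` is void and all of `SL(2, ℤ)` is allowed at the handle; it
  -- comes from the transvections along `a_j` and `b_j`.
  refine mem_of_fixesMod (j := ⟨n, hn⟩) (k := 1) one_ne_zero (fun N hN => ?_)
    (fun A _ => etaAt_mem (hA _ le_rfl) (hB _ le_rfl) A) (fun hj => hC ⟨n, hn⟩ hj le_rfl)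
    ⟨hM, spAct g M (vecA ⟨n, hn⟩) - vecA ⟨n, hn⟩, by simp⟩
  exact mem_of_fixesBelow (n + 1) (fun i hi => hA i (by omega)) (fun i hi => hB i (by omega))
    (fun i hi hni => hC i hi (by omega)) hN
termination_by g - n

end Generation

/-! ### The images of the Dehn twists -/

section Images

variable {g : ℕ}

theorem spAct_sympRep_vecA (f : ModS g) (i : Fin g) : spAct g (sympRep g f) (vecA i) =
    (surfBasis g).repr (mcgAct (fundamentalClass g) 1 ℤ f (classA ℤ i)) :=
  sympRep_mulVec_single f (Sum.inl i)

theorem spAct_sympRep_vecB (f : ModS g) (i : Fin g) : spAct g (sympRep g f) (vecB i) =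
    (surfBasis g).repr (mcgAct (fundamentalClass g) 1 ℤ f (classB ℤ i)) :=
  sympRep_mulVec_single f (Sum.inr i)

theorem repr_classA (i : Fin g) : ⇑((surfBasis g).repr (classA ℤ i)) = vecA i :=
  repr_classAB (Sum.inl i)

theorem repr_classB (i : Fin g) : ⇑((surfBasis g).repr (classB ℤ i)) = vecB i :=
  repr_classAB (Sum.inr i)

theorem sympRep_twistB (i : Fin g) :
    sympRep g (twistH (hStrips_period i) : ModS g) = transv 1 (vecB i) := by
  refine spAct_ext (fun j => ?_) fun j => ?_
  · rw [spAct_sympRep_vecA, twistB_classA, map_sub, Finsupp.coe_sub, repr_classA, spAct_transv,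
      spForm_vecB, vecA_inl]
    by_cases h : j = i
    · subst h
      rw [if_pos rfl, if_pos rfl, repr_classB]
      module
    · simp [h, Ne.symm h]
  · rw [spAct_sympRep_vecB, twistB_classB, repr_classB, spAct_transv, spForm_vecB, vecB_inl]
    simp

theorem sympRep_twistA (i : Fin g) :
    sympRep g (twistV (vStrips_period_one i) : ModS g) = transv 1 (vecA i) := by
  refine spAct_ext (fun j => ?_) fun j => ?_
  · rw [spAct_sympRep_vecA, twistV_classA, repr_classA, spAct_transv, spForm_vecA, vecA_inr]
    simp
  · rw [spAct_sympRep_vecB, twistA_classB, map_add, Finsupp.coe_add, repr_classB, spAct_transv,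
      spForm_vecA, vecB_inr]
    by_cases h : j = i
    · subst h
      rw [if_pos rfl, if_pos rfl, repr_classA]
      module
    · simp [h, Ne.symm h]

theorem sympRep_twistC (i : Fin g) (hi : i.val + 1 < g) :
    sympRep g (twistV (vStrips_period_two i hi) : ModS g) =
      transv 1 (vecA i - vecA ⟨i.val + 1, hi⟩) := by
  refine spAct_ext (fun j => ?_) fun j => ?_
  · rw [spAct_sympRep_vecA, twistV_classA, repr_classA, spAct_transv, map_sub, spForm_vecA,
      spForm_vecA, vecA_inr, vecA_inr]
    simp
  · have hne : (⟨i.val + 1, hi⟩ : Fin g) ≠ i := fun h => by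
      have := congrArg Fin.val h
      simp at this
    rw [spAct_sympRep_vecB, twistC_classB i j hi, map_add, Finsupp.coe_add, repr_classB, spAct_transv,
      map_sub, spForm_vecA, spForm_vecA, vecB_inr, vecB_inr]
    by_cases h : j = i
    · subst h
      rw [if_pos rfl, if_pos rfl, if_neg hne, map_sub, Finsupp.coe_sub, repr_classA, repr_classA]
      module
    · by_cases h2 : j = ⟨i.val + 1, hi⟩
      · subst h2
        rw [if_neg h, if_pos rfl, if_neg hne.symm, if_pos rfl, map_neg, map_sub, Finsupp.coe_neg,
          Finsupp.coe_sub, repr_classA, repr_classA]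
        module
      · simp [h, h2, Ne.symm h, Ne.symm h2]

theorem mem_modE1_iff_fixesMod [NeZero g] (k : ℕ) (f : ModS g) :
    f ∈ modE1 g k ↔ FixesMod 0 k (sympRep g f) := by
  have hcol : ∀ p, (sympRep g f).1 p (Sum.inl 0) = spAct g (sympRep g f) (vecA 0) p := fun p => by
    rw [spAct_apply, vecA, Matrix.mulVec_single_one, Matrix.col_apply]
  have hv : ∀ p, (if p = Sum.inl 0 then 1 else 0 : ℤ) = vecA (g := g) 0 p := fun p => by
    rw [vecA, Pi.single_apply]
  rw [mem_modE1_iff]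
  constructor
  · intro h
    refine ⟨fun i hi => (Nat.not_lt_zero _ hi).elim, ?_⟩
    have hd : ∀ p, ∃ c, spAct g (sympRep g f) (vecA 0) p - vecA 0 p = (k : ℤ) * c := fun p => by
      refine (ZMod.intCast_zmod_eq_zero_iff_dvd _ k).1 ?_
      rw [Int.cast_sub, ← hcol, h p, ← hv]
      split_ifs <;> simp
    choose c hc using hd
    refine ⟨c, funext fun p => ?_⟩
    rw [Pi.add_apply, Pi.smul_apply, smul_eq_mul, ← hc p]
    ring
  · rintro ⟨-, t, ht⟩ p
    rw [hcol, ht, Pi.add_apply, Pi.smul_apply, ← hv]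
    push_cast
    simp

end Images

end

/-! ### Generators of the image of the stabilizer -/

theorem theorem2p3 (g k : ℕ) [NeZero g] (hk : 1 ≤ k) :
    ∃ e : Module.Basis (Fin g ⊕ Fin g) ℤ (SHom 1 ℤ (Surf g)),
      (∀ i : Fin g, e (Sum.inl i) = classA ℤ i ∧ e (Sum.inr i) = classB ℤ i) ∧
      ∃ Ψ : ModS g →* Matrix.symplecticGroup (Fin g) ℤ,
        (∀ f : ModS g, (Ψ f : Matrix (Fin g ⊕ Fin g) (Fin g ⊕ Fin g) ℤ) =
          LinearMap.toMatrix e e (mcgAct (fundamentalClass g) 1 ℤ f)) ∧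
        Subgroup.map Ψ (modE1 g k) =
          Subgroup.closure
            (eta g '' (CongruenceSubgroup.Gamma1 k : Set (Matrix.SpecialLinearGroup (Fin 2) ℤ)) ∪
              Ψ '' twistSet g) := by
  refine ⟨surfBasis g, fun i => ⟨surfBasis_apply _, surfBasis_apply _⟩, sympRep g,
    fun f => rfl, le_antisymm ?_ ?_⟩
  · set H := Subgroup.closure
      (eta g '' (CongruenceSubgroup.Gamma1 k : Set (Matrix.SpecialLinearGroup (Fin 2) ℤ)) ∪
        sympRep g '' twistSet g)
    have htw : ∀ f ∈ twistSet g, sympRep g f ∈ H := fun f hf =>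
      Subgroup.subset_closure (Or.inr ⟨f, hf, rfl⟩)
    have hA : ∀ i : Fin g, 1 ≤ i.val → transv 1 (vecA i) ∈ H := fun i hi => by
      rw [← sympRep_twistA]
      exact htw _ (Or.inl ⟨i, hi, Or.inl ((isDehnTwist_annA i _).2 rfl)⟩)
    have hB : ∀ i : Fin g, 1 ≤ i.val → transv 1 (vecB i) ∈ H := fun i hi => by
      rw [← sympRep_twistB]
      exact htw _ (Or.inl ⟨i, hi, Or.inr ((isDehnTwist_annB i _).2 rfl)⟩)
    have hC : ∀ (i : Fin g) (hi : i.val + 1 < g),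
        transv 1 (vecA i - vecA ⟨i.val + 1, hi⟩) ∈ H := fun i hi => by
      rw [← sympRep_twistC]
      exact htw _ (Or.inr ⟨i, hi, (isDehnTwist_annC i hi _).2 rfl⟩)
    rintro _ ⟨f, hf, rfl⟩
    -- The first handle uses the given `k` with `Γ_1(k)`; matrices that fix this handle are covered
    -- by the transvections of the later handles.
    refine mem_of_fixesMod (j := 0) (k := k) (by omega) (fun M hM => ?_) (fun A hA' => ?_)
      (fun hj => hC 0 hj) ((mem_modE1_iff_fixesMod k f).1 hf)
    · exact mem_of_fixesBelow 1 hA hB (fun i hi _ => hC i hi) hM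
    · rw [← eta_eq_etaAt]
      exact Subgroup.subset_closure (Or.inl ⟨A, hA', rfl⟩)
  · rw [Subgroup.closure_le]
    rintro _ (⟨A, hA, rfl⟩ | ⟨f, hf, rfl⟩)
    · rw [eta_eq_etaAt]
      -- The twists about `a_1` and `b_1` are not among the generators, but they are mapping
      -- classes, so all of `SL(2, ℤ)` in the first handle is realized.
      obtain ⟨f, hf⟩ : etaAt 0 A ∈ (sympRep g).range :=
        etaAt_mem (MonoidHom.mem_range.2 ⟨_, sympRep_twistA 0⟩)
          (MonoidHom.mem_range.2 ⟨_, sympRep_twistB 0⟩) A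
      refine ⟨f, (mem_modE1_iff_fixesMod k f).2 ?_, hf⟩
      rw [hf]
      exact fixesMod_etaAt hA
    · refine ⟨f, (mem_modE1_iff_fixesMod k f).2
        ⟨fun i hi => (Nat.not_lt_zero _ hi).elim, 0, ?_⟩, rfl⟩
      -- Among the curves `a_i`, `b_i`, `c_i` only `b_1` crosses `a_1`, and its twist is excluded;
      -- so the listed twists fix `a_1` integrally, not only modulo `k`.
      rw [smul_zero, add_zero, spAct_sympRep_vecA, ← repr_classA]
      congr 2
      rcases hf with ⟨i, hi, hf | hf⟩ | ⟨i, hi, hf⟩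
      · rw [(isDehnTwist_annA i f).1 hf, twistV_classA]
      · rw [(isDehnTwist_annB i f).1 hf, twistB_classA, if_neg, sub_zero]
        rintro rfl
        exact lt_irrefl _ hi
      · rw [(isDehnTwist_annC i hi f).1 hf, twistV_classA]
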